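/- **Setting.** Let $\alpha\in(0,1)$, let $\mathcal Y$ be a Polish space with a $\sigma$-finite measure $\mu$, let $\Theta\subset\mathbb R$ be an interval, and let $(\ell(\cdot|\theta))_{\theta\in\Theta}$ be jointly measurable probability densities with respect to $\mu$. The model is assumed regular: for $\mu$-a.e. $y$, $\ell(y|\theta)>0$ for all $\theta\in\Theta$ and $\theta\mapsto\ell(y|\theta)$ is $C^2$ on $\Theta$; distinct parameters give distinct distributions; $\int\ell(y|\theta)\,d\mu(y)=1$ can be differentiated twice under the integral sign, i.e. for all $\theta\in\Theta$ the functions $\partial_\theta\ell(\cdot|\theta)$ and $\partial^2_\theta\ell(\cdot|\theta)$ are $\mu$-integrable with integral $0$; every $\theta\in\Theta$ has a neighbourhood in $\Theta$ on which $|\partial_{\theta}^2\log\ell(y|\cdot)|$ is bounded, for $\mu$-a.e. $y$, by some $h(y)$ with $\int h\,\ell(\cdot|\theta)\,d\mu<\infty$; and the Fisher information $\mathcal I(\theta)=-\int\partial_\theta^2[\log\ell(y|\theta)]\,\ell(y|\theta)\,d\mu(y)$ is positive and continuous on $\Theta$. (Derivatives at an endpoint of $\Theta$ are one-sided.) The Jeffreys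 prior has density $J=\sqrt{|\mathcal I|}$. **Definitions.** A prior on a set $S\subset\mathbb R$ is a non-zero measure with a locally bounded, a.e. continuous density with respect to the Lebesgue measure on $S$, considered up to a positive factor; $\propto$ means equality up to a positive factor. For a probability measure $\pi$ put $\ell_k(\mathbf y|\theta)=\prod_{j\le k}\ell(y_j|\theta)$, $p_k(\mathbf y)=\int\ell_k(\mathbf y|\theta)\,d\pi(\theta)$, $f_\alpha(x)=\frac{x^\alpha-\alpha x-(1-\alpha)}{\alpha(\alpha-1)}$ and $$I_{D_\alpha}(\pi|k)=\int\int_{\mathcal Y^k} f_\alpha\Big(\frac{p_k(\mathbf y)}{\ell_k(\mathbf y|\theta)}\Big)\ell_k(\mathbf y|\theta)\,d\mu^{\otimes k}(\mathbf y)\,d\pi(\theta).$$ An increasing sequence $(K_i)_{i\in\mathbb N}$ of compact sets with $\bigcup_iK_i=S$ is called openly increasing if there are $i_0$ and sets $V_i$, open in $S$, with $K_i\subset V_i\subset K_{i+1}$ for all $i\ge i_0$. The re-normalized restriction of $\pi$ to $K$ is $\pi(\cdot\cap K)/\pi(K)$ (when $\pi(K)>0$). Given a class $\mathcal P$ of priors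 on $S$, $\pi^\ast\in\mathcal P$ is a $D_\alpha$-reference prior over $\mathcal P$ (with rate $k^{\alpha/2}$) if there is an openly increasing sequence $(K_i)$ of compact sets with union $S$ and $\pi^\ast(K_i)>0$ such that for all $i$ and all $\pi\in\mathcal P$ with $\pi(K_i)>0$, with $\pi^\ast_i,\pi_i$ the re-normalized restrictions to $K_i$, the limit $$\lim_{k\to\infty}k^{\alpha/2}\big(I_{D_\alpha}(\pi^\ast_i|k)-I_{D_\alpha}(\pi_i|k)\big)$$ exists, is finite and is $\ge0$. Further, $\pi^\ast\in\mathcal P$ is a quasi $D_\alpha$-reference prior over $\mathcal P$ along an openly increasing sequence $(\Theta_i)$ of compact sets with union $S$ if for every $i$ there is a $D_\alpha$-reference prior $\pi^\ast_i$ (with parameter space $\Theta_i$) over the class $\mathcal P_i$ of re-normalized restrictions to $\Theta_i$ of elements of $\mathcal P$, such that $(\pi_i^\ast)$ converges Q-vaguely to $\pi^\ast$ on $S$: for some constants $s_i>0$, $s_i\int f\,d\pi_i^\ast\to\int f\,d\pi^\ast$ for every continuous $f:S\to\mathbb R$ with compact support. It is a quasi $D_\alpha$-reference prior over $\mathcal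 P$ if this holds along some such sequence. We say that $\pi^\ast$ is *the* quasi $D_\alpha$-reference prior over $\mathcal P$ if it is one and if, along every openly increasing sequence of compact intervals $[s_i,t_i]$, $s_i<t_i$, with union $S$, it is a quasi $D_\alpha$-reference prior, and the only one up to a positive factor. **Theorem.** (1) Let $\Theta=[c,b)$ with $c<b$, or $\Theta=(b,c]$ with $b<c$, where $b,c\in\mathbb R$. If $J(\theta)\sim C|\theta-b|^a$ as $\theta\to b$ in $\Theta$, for constants $C\in\mathbb R$ and $a\le-1$, then $\pi^\ast(\theta)\propto|\theta-b|^a$ is the quasi $D_\alpha$-reference prior over $\{\pi(\theta)\propto|\theta-b|^u:\ u\in\mathbb R\}$. (2) Let $\Theta=[c,+\infty)$ with $c>0$ and $b=+\infty$, or $\Theta=(-\infty,c]$ with $c<0$ and $b=-\infty$. If $J(\theta)\sim C|\theta|^a$ as $\theta\to b$, for constants $C\in\mathbb R$ and $a\ge-1$, then $\pi^\ast(\theta)\propto|\theta|^a$ is the quasi $D_\alpha$-reference prior over $\{\pi(\theta)\propto|\theta|^u:\ u\in\mathbb R\}$. -/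

import Mathlib

open MeasureTheory Set Filter Topology

noncomputable section

namespace QuasiRef

/-! ### Statistical model, Fisher information, Jeffreys prior

A model is a family of densities `ℓ y θ = ℓ(y | θ)` with respect to a measure `μ` on the observation
space. Only the values at `θ ∈ Θ` matter. `Θ ⊆ ℝ` is an interval that may contain one of its
endpoints; derivatives in `θ` are therefore taken within `Θ` (one-sided at the endpoint). -/

/-- Likelihood of a sample of `k` i.i.d. observations. -/
def likelihood {𝓨 : Type*} (ℓ : 𝓨 → ℝ → ℝ) (k : ℕ) (y : Fin k → 𝓨) (θ : ℝ) : ℝ :=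
  ∏ j, ℓ (y j) θ

/-- Fisher information `-∫ ∂²_θ log ℓ(y|θ) ℓ(y|θ) dμ(y)`. -/
def fisherInfo {𝓨 : Type*} [MeasurableSpace 𝓨] (μ : Measure 𝓨) (ℓ : 𝓨 → ℝ → ℝ) (Θ : Set ℝ)
    (θ : ℝ) : ℝ :=
  -∫ y, iteratedDerivWithin 2 (fun t => Real.log (ℓ y t)) Θ θ * ℓ y θ ∂μ

/-- Density of the Jeffreys prior (one representative; it is defined up to a positive factor). -/
def jeffreys {𝓨 : Type*} [MeasurableSpace 𝓨] (μ : Measure 𝓨) (ℓ : 𝓨 → ℝ → ℝ) (Θ : Set ℝ)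
    (θ : ℝ) : ℝ :=
  Real.sqrt |fisherInfo μ ℓ Θ θ|

/-- A model with the classical regularity that gives the Fisher information its usual meaning. -/
structure RegularModel {𝓨 : Type*} [MeasurableSpace 𝓨] (μ : Measure 𝓨) (ℓ : 𝓨 → ℝ → ℝ)
    (Θ : Set ℝ) : Prop where
  measurable : Measurable (Function.uncurry ℓ)
  /-- each `ℓ(·|θ)` is a probability density -/
  integral_eq_one : ∀ θ ∈ Θ, ∫ y, ℓ y θ ∂μ = 1
  /-- the densities have a common support, -/
  pos : ∀ᵐ y ∂μ, ∀ θ ∈ Θ, 0 < ℓ y θ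
  /-- and are twice continuously differentiable in the parameter -/
  contDiffOn : ∀ᵐ y ∂μ, ContDiffOn ℝ 2 (ℓ y) Θ
  /-- distinct parameters give distinct distributions -/
  identifiable : ∀ θ ∈ Θ, ∀ θ' ∈ Θ, (fun y => ℓ y θ) =ᵐ[μ] (fun y => ℓ y θ') → θ = θ'
  /-- `∫ ℓ(y|θ) dμ(y) = 1` may be differentiated twice under the integral sign -/
  integrable_deriv : ∀ θ ∈ Θ, Integrable (fun y => derivWithin (ℓ y) Θ θ) μ
  integral_deriv : ∀ θ ∈ Θ, ∫ y, derivWithin (ℓ y) Θ θ ∂μ = 0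
  integrable_deriv2 : ∀ θ ∈ Θ, Integrable (fun y => iteratedDerivWithin 2 (ℓ y) Θ θ) μ
  integral_deriv2 : ∀ θ ∈ Θ, ∫ y, iteratedDerivWithin 2 (ℓ y) Θ θ ∂μ = 0
  /-- near each `θ`, `∂² log ℓ` is dominated by a function integrable under the distribution of
  parameter `θ` -/
  dominated : ∀ θ ∈ Θ, ∃ τ > 0, ∃ h : 𝓨 → ℝ, Integrable (fun y => h y * ℓ y θ) μ ∧
    ∀ᵐ y ∂μ, ∀ θ' ∈ Θ, |θ' - θ| < τ →
      |iteratedDerivWithin 2 (fun t => Real.log (ℓ y t)) Θ θ'| ≤ h y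
  fisher_pos : ∀ θ ∈ Θ, 0 < fisherInfo μ ℓ Θ θ
  fisher_continuousOn : ContinuousOn (fisherInfo μ ℓ Θ) Θ

/-! ### Priors -/

/-- Equality of (possibly infinite) measures up to a positive factor. -/
def PropEquiv (π₁ π₂ : Measure ℝ) : Prop :=
  ∃ δ : ℝ, 0 < δ ∧ π₁ = ENNReal.ofReal δ • π₂

/-- `π` represents a prior on `Θ`: a non-zero measure, carried by `Θ`, with a locally bounded and
a.e. continuous density with respect to the Lebesgue measure on `Θ`. -/
def IsPrior (Θ : Set ℝ) (π : Measure ℝ) : Prop :=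
  π ≠ 0 ∧ ∃ f : ℝ → ℝ, Measurable f ∧ (∀ θ, 0 ≤ f θ) ∧
    (∀ θ ∈ Θ, ∃ M : ℝ, ∀ᶠ t in 𝓝[Θ] θ, f t ≤ M) ∧
    (∀ᵐ θ ∂(volume.restrict Θ), ContinuousWithinAt f Θ θ) ∧
    π = (volume.restrict Θ).withDensity (fun θ => ENNReal.ofReal (f θ))

/-- The prior on `Θ` with density `g(θ)^u`. -/
def powerPrior (Θ : Set ℝ) (g : ℝ → ℝ) (u : ℝ) : Measure ℝ :=
  (volume.restrict Θ).withDensity (fun θ => ENNReal.ofReal (g θ ^ u))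

/-- All priors on `Θ` with density proportional to `g(θ)^u` for some real `u`. -/
def powerClass (Θ : Set ℝ) (g : ℝ → ℝ) : Set (Measure ℝ) :=
  {π | ∃ u : ℝ, PropEquiv π (powerPrior Θ g u)}

/-- Re-normalized restrictions `π(· ∩ K) / π(K)` to `K` of the elements of `P`. -/
def renormRestrictions (P : Set (Measure ℝ)) (K : Set ℝ) : Set (Measure ℝ) :=
  {ρ | ∃ π ∈ P, 0 < π K ∧ ρ = ProbabilityTheory.cond π K}

/-! ### Mutual information -/

/-- `f_α(x) = (x^α - α x - (1 - α)) / (α (α - 1))`. -/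
def fAlpha (α x : ℝ) : ℝ := (x ^ α - α * x - (1 - α)) / (α * (α - 1))

/-- Density of the marginal distribution of `k` observations under the prior `π`. -/
def marginal {𝓨 : Type*} (ℓ : 𝓨 → ℝ → ℝ) (π : Measure ℝ) (k : ℕ) (y : Fin k → 𝓨) : ℝ :=
  ∫ θ, likelihood ℓ k y θ ∂π

/-- `α`-divergence between the `k`-sample distribution of parameter `θ` and the marginal. -/
def divergence {𝓨 : Type*} [MeasurableSpace 𝓨] (μ : Measure 𝓨) (ℓ : 𝓨 → ℝ → ℝ) (α : ℝ)
    (π : Measure ℝ) (k : ℕ) (θ : ℝ) : ℝ :=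
  ∫ y : Fin k → 𝓨, fAlpha α (marginal ℓ π k y / likelihood ℓ k y θ) * likelihood ℓ k y θ
    ∂(Measure.pi fun _ => μ)

/-- `α`-mutual information `I(π|k)` of a probability measure `π` and `k` observations. -/
def mutualInfo {𝓨 : Type*} [MeasurableSpace 𝓨] (μ : Measure 𝓨) (ℓ : 𝓨 → ℝ → ℝ) (α : ℝ)
    (π : Measure ℝ) (k : ℕ) : ℝ :=
  ∫ θ, divergence μ ℓ α π k θ ∂π

/-! ### Reference priors and quasi reference priors -/

/-- `K` is an openly increasing sequence of compact subsets of `S` with union `S`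
(open means open in `S`). -/
def OpenlyIncreasing (S : Set ℝ) (K : ℕ → Set ℝ) : Prop :=
  (∀ i, IsCompact (K i)) ∧ Monotone K ∧ (⋃ i, K i) = S ∧
    ∃ i₀ : ℕ, ∃ V : ℕ → Set ℝ, ∀ i ≥ i₀,
      (∃ O : Set ℝ, IsOpen O ∧ V i = O ∩ S) ∧ K i ⊆ V i ∧ V i ⊆ K (i + 1)

/-- `πs` is a reference prior with rate `φ`, for the parameter space `S`, over the class `P` of
priors on `S`. -/
def IsReferencePrior {𝓨 : Type*} [MeasurableSpace 𝓨] (μ : Measure 𝓨) (ℓ : 𝓨 → ℝ → ℝ) (α : ℝ)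
    (φ : ℕ → ℝ) (S : Set ℝ) (P : Set (Measure ℝ)) (πs : Measure ℝ) : Prop :=
  (∀ π ∈ P, IsPrior S π) ∧ πs ∈ P ∧
    ∃ K : ℕ → Set ℝ, OpenlyIncreasing S K ∧ (∀ i, 0 < πs (K i)) ∧
      ∀ i, ∀ π ∈ P, 0 < π (K i) → ∃ L : ℝ, 0 ≤ L ∧
        Tendsto (fun k : ℕ => φ k * (mutualInfo μ ℓ α (ProbabilityTheory.cond πs (K i)) k -
          mutualInfo μ ℓ α (ProbabilityTheory.cond π (K i)) k)) atTop (𝓝 L)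

/-- Q-vague convergence on `S`: after multiplication by suitable positive constants, `ρ i`
converges vaguely to `π`, that is, against continuous functions on `S` with compact support. -/
def QVagueTendsto (S : Set ℝ) (ρ : ℕ → Measure ℝ) (π : Measure ℝ) : Prop :=
  ∃ s : ℕ → ℝ, (∀ i, 0 < s i) ∧
    ∀ f : ℝ → ℝ, ContinuousOn f S → (∃ T ⊆ S, IsCompact T ∧ ∀ θ, θ ∉ T → f θ = 0) →
      Tendsto (fun i => s i * ∫ θ, f θ ∂(ρ i)) atTop (𝓝 (∫ θ, f θ ∂π))

/-- `πs` is a quasi reference prior over the class `P` of priors on `S`, along the sequence `K`. -/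
def IsQuasiReferencePriorAlong {𝓨 : Type*} [MeasurableSpace 𝓨] (μ : Measure 𝓨)
    (ℓ : 𝓨 → ℝ → ℝ) (α : ℝ) (φ : ℕ → ℝ) (S : Set ℝ) (P : Set (Measure ℝ)) (K : ℕ → Set ℝ)
    (πs : Measure ℝ) : Prop :=
  (∀ π ∈ P, IsPrior S π) ∧ πs ∈ P ∧ OpenlyIncreasing S K ∧
    ∃ ρ : ℕ → Measure ℝ,
      (∀ i, IsReferencePrior μ ℓ α φ (K i) (renormRestrictions P (K i)) (ρ i)) ∧
      QVagueTendsto S ρ πs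

/-- `πs` is a quasi reference prior over the class `P` of priors on `S`. -/
def IsQuasiReferencePrior {𝓨 : Type*} [MeasurableSpace 𝓨] (μ : Measure 𝓨)
    (ℓ : 𝓨 → ℝ → ℝ) (α : ℝ) (φ : ℕ → ℝ) (S : Set ℝ) (P : Set (Measure ℝ))
    (πs : Measure ℝ) : Prop :=
  ∃ K : ℕ → Set ℝ, IsQuasiReferencePriorAlong μ ℓ α φ S P K πs

/-- `πs` is *the* quasi reference prior over `P`: it is one, and along any sequence of
non-degenerate compact intervals it is one and the only one, up to a positive factor. -/
def IsTheQuasiReferencePrior {𝓨 : Type*} [MeasurableSpace 𝓨] (μ : Measure 𝓨)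
    (ℓ : 𝓨 → ℝ → ℝ) (α : ℝ) (φ : ℕ → ℝ) (S : Set ℝ) (P : Set (Measure ℝ))
    (πs : Measure ℝ) : Prop :=
  IsQuasiReferencePrior μ ℓ α φ S P πs ∧
    ∀ K : ℕ → Set ℝ, OpenlyIncreasing S K → (∀ i, ∃ s t : ℝ, s < t ∧ K i = Icc s t) →
      ∀ π : Measure ℝ, IsQuasiReferencePriorAlong μ ℓ α φ S P K π ↔ PropEquiv π πs

end QuasiRef

end

/-!
The proof has a statistical half and an analytic half.

**Mutual information.** Let `q` be a continuous probability density on a compact interval of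
parameters. Since `f_α` is affine in `x ^ α` and `x`, and likelihood ratios have mean one, the
mutual information is an affine function of the mean over `θ ∼ q` of the `α`-th moments, under
`θ`, of `∫ q(x) L_k(x) dx`, where `L_k(x)` is the likelihood ratio of `k` observations between `x`
and `θ`. At the local scale `x = θ + h / √(k I(θ))` the likelihood ratio is approximately
`exp (h Δ - h² / 2)` with `Δ` asymptotically standard normal
(`SmoothFamily.exists_logLik_remainder`), so that these moments, multiplied by `k ^ (α / 2)`, tend
to `limitConst α * q(θ) ^ α * I(θ) ^ (-α / 2)`. Passing to the limit under the integrals requires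
a bound for the moments away from `θ` that is uniform in `k` (`SmoothFamily.exists_tail_bound`):
the squared Hellinger distance is bounded below by a multiple of `(x - θ)²`, hence the affinities
of the product laws decay like `exp (-c k (x - θ)²)`, and a one-dimensional Sobolev inequality,
`rpow_integral_le`, controls a power of an integral by integrals of powers. These ingredients meet
in `tendsto_integral_rpow_of_locallyGaussian` and give the expansion
`SmoothFamily.tendsto_mutualInfo`, whose first order term is `limitConst α / (α (α - 1))` times
`∫ q ^ (1 + α) J ^ (-α)`. As `α (α - 1) < 0`, the reference priors over the restrictions of the
power priors to a compact interval are the minimisers of this integral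
(`PriorBase.isReferencePrior_iff`), written as the function `priorObjective` of the exponent `u`.
A minimiser exists, because for large `|u|` the mass concentrates at an endpoint
(`exists_forall_priorObjective_le`).

**Optimal exponents.** By Hölder's inequality `∫ q ^ (1 + α) J ^ (-α) ≥ (∫ J) ^ (-α)`, with
equality for `q ∝ J` only. The hypothesis on `a` says that `∫ J` diverges at the open end of `Θ`.
Hence, along compact intervals that exhaust `Θ`, the part of `Θ` where `J` is not close to
`C x ^ a` is negligible, and the exponent `a` attains the Hölder bound asymptotically
(`PowerTail.tendsto_priorObjective`). The minimisers `u_i` then attain it too, and the stability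
of Hölder's inequality makes `x ^ (u_i - a)` almost constant on most of the mass of `J`. As a
fixed proportion of this mass lies outside any window `[y, 2 y]`, there are two such points of
ratio at least `2`, and `u_i → a` (`PowerTail.tendsto_minimiser`). Convergence of the exponents is
Q-vague convergence of the priors, and testing Q-vague limits on a compact interval determines the
exponent, which gives uniqueness (`PriorBase.isTheQuasiReferencePrior`). The four kinds of
parameter intervals are reduced to `(0, R]` and `[R, ∞)` by an affine change of variable
(`AffineChart`).
-/

namespace QuasiRef

/-! ### Smooth families on a compact interval and their affinities -/

/-- A family of positive densities `ℓ(·|θ)`, `θ ∈ [s, t]`, that is regular for *every* observation,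
with score `sc y θ = ∂_θ log ℓ(y|θ)` and information `I`. The last field is a second order
expansion of the log-likelihood at interior points with an integrably dominated remainder. -/
structure SmoothFamily {𝓨 : Type*} [MeasurableSpace 𝓨] (μ : Measure 𝓨) (ℓ : 𝓨 → ℝ → ℝ) (s t : ℝ)
    (I : ℝ → ℝ) (sc : 𝓨 → ℝ → ℝ) : Prop where
  lt : s < t
  measurable : Measurable (Function.uncurry ℓ)
  pos : ∀ y, ∀ θ ∈ Icc s t, 0 < ℓ y θ
  cont : ∀ y, ContinuousOn (ℓ y) (Icc s t)
  score_measurable : Measurable (Function.uncurry sc)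
  score_cont : ∀ y, ContinuousOn (sc y) (Icc s t)
  hasDerivAt : ∀ y, ∀ θ ∈ Ioo s t, HasDerivAt (ℓ y) (sc y θ * ℓ y θ) θ
  integral_eq_one : ∀ θ ∈ Icc s t, ∫ y, ℓ y θ ∂μ = 1
  identifiable : ∀ θ ∈ Icc s t, ∀ θ' ∈ Icc s t,
    (fun y => ℓ y θ) =ᵐ[μ] (fun y => ℓ y θ') → θ = θ'
  score_integral : ∀ θ ∈ Icc s t, ∫ y, sc y θ * ℓ y θ ∂μ = 0
  sq_integrable : ∀ θ ∈ Icc s t, Integrable (fun y => sc y θ ^ 2 * ℓ y θ) μ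
  sq_integral : ∀ θ ∈ Icc s t, ∫ y, sc y θ ^ 2 * ℓ y θ ∂μ = I θ
  info_pos : ∀ θ ∈ Icc s t, 0 < I θ
  info_cont : ContinuousOn I (Icc s t)
  expansion : ∀ θ ∈ Ioo s t, ∃ hs : 𝓨 → ℝ, AEStronglyMeasurable hs μ ∧
    Integrable (fun y => hs y * ℓ y θ) μ ∧ ∫ y, hs y * ℓ y θ ∂μ = -I θ ∧
    ∃ τ > 0, ∃ H : 𝓨 → ℝ, Integrable (fun y => H y * ℓ y θ) μ ∧
      (∀ᵐ y ∂μ, ∀ x, |x| < τ → θ + x ∈ Icc s t →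
        |Real.log (ℓ y (θ + x)) - Real.log (ℓ y θ) - x * sc y θ - x ^ 2 / 2 * hs y| ≤
          x ^ 2 * H y) ∧
      (∀ᵐ y ∂μ, Tendsto (fun x => (Real.log (ℓ y (θ + x)) - Real.log (ℓ y θ) - x * sc y θ
        - x ^ 2 / 2 * hs y) / x ^ 2) (𝓝[≠] 0) (𝓝 0))

/-- Young's inequality with a remainder that makes `x = y` the only case of equality. -/
lemma rpow_mul_rpow_le_sub_sq {γ x y : ℝ} (h0 : 0 < γ) (h1 : γ < 1) (hx : 0 ≤ x) (hy : 0 ≤ y) :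
    x ^ γ * y ^ (1 - γ) ≤ γ * x + (1 - γ) * y - min γ (1 - γ) * (√x - √y) ^ 2 := by
  -- by symmetry it is enough to treat exponents at most one half
  have key : ∀ {δ x y : ℝ}, 0 < δ → δ ≤ 1 / 2 → 0 ≤ x → 0 ≤ y →
      x ^ δ * y ^ (1 - δ) ≤ δ * x + (1 - δ) * y - δ * (√x - √y) ^ 2 := by
    intro δ x y h0 h1 hx hy
    have h := Real.geom_mean_le_arith_mean2_weighted (w₁ := 2 * δ) (w₂ := 1 - 2 * δ)
      (p₁ := √(x * y)) (p₂ := y) (by linarith) (by linarith) (Real.sqrt_nonneg _) hy (by ring)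
    have e : √(x * y) ^ (2 * δ) * y ^ (1 - 2 * δ) = x ^ δ * y ^ (1 - δ) := by
      rw [Real.sqrt_eq_rpow, ← Real.rpow_mul (by positivity), Real.mul_rpow hx hy]
      rw [show (1 / 2 : ℝ) * (2 * δ) = δ by ring, mul_assoc, ← Real.rpow_add_of_nonneg hy
        (by linarith) (by linarith)]
      congr 2; ring
    rw [e, Real.sqrt_mul hx] at h
    nlinarith [Real.sq_sqrt hx, Real.sq_sqrt hy]
  rcases le_total γ (1 / 2) with h | h
  · rw [min_eq_left (by linarith)]
    exact key h0 h hx hy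
  · rw [min_eq_right (by linarith)]
    have := key (δ := 1 - γ) (by linarith) (by linarith) hy hx
    rw [sub_sub_cancel] at this
    nlinarith [this]

section

variable {𝓨 : Type*} [MeasurableSpace 𝓨] {μ : Measure 𝓨} {ℓ : 𝓨 → ℝ → ℝ} {s t : ℝ}
  {I : ℝ → ℝ} {sc : 𝓨 → ℝ → ℝ}

namespace SmoothFamily

lemma measurable_left (hF : SmoothFamily μ ℓ s t I sc) (θ : ℝ) : Measurable fun y => ℓ y θ :=
  hF.measurable.comp (by fun_prop : Measurable fun y : 𝓨 => (y, θ))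

lemma score_measurable_left (hF : SmoothFamily μ ℓ s t I sc) (θ : ℝ) :
    Measurable fun y => sc y θ :=
  hF.score_measurable.comp (by fun_prop : Measurable fun y : 𝓨 => (y, θ))

lemma integrable (hF : SmoothFamily μ ℓ s t I sc) {θ : ℝ} (hθ : θ ∈ Icc s t) :
    Integrable (fun y => ℓ y θ) μ := by
  by_contra h
  have := hF.integral_eq_one θ hθ
  rw [integral_undef h] at this
  exact zero_ne_one this

/-- Mean value theorem for `√ℓ`. -/
lemma exists_sqrt_sub_eq (hF : SmoothFamily μ ℓ s t I sc) (y : 𝓨) {a b : ℝ} (ha : a ∈ Icc s t)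
    (hb : b ∈ Icc s t) (hab : a ≠ b) :
    ∃ ξ ∈ Icc (min a b) (max a b), √(ℓ y a) - √(ℓ y b) = (a - b) * (sc y ξ * √(ℓ y ξ) / 2) := by
  have key : ∀ {a b : ℝ}, a ∈ Icc s t → b ∈ Icc s t → a < b →
      ∃ ξ ∈ Icc a b, √(ℓ y b) - √(ℓ y a) = (b - a) * (sc y ξ * √(ℓ y ξ) / 2) := by
    intro a b ha hb hab
    have hsub : Icc a b ⊆ Icc s t := Icc_subset_Icc ha.1 hb.2
    have hc : ContinuousOn (fun x => √(ℓ y x)) (Icc a b) := ((hF.cont y).mono hsub).sqrt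
    have hd : ∀ x ∈ Ioo a b, HasDerivAt (fun x => √(ℓ y x)) (sc y x * √(ℓ y x) / 2) x := by
      intro x hx
      have hx' : x ∈ Ioo s t := ⟨ha.1.trans_lt hx.1, hx.2.trans_le hb.2⟩
      have hp := hF.pos y x (Ioo_subset_Icc_self hx')
      convert (hF.hasDerivAt y x hx').sqrt hp.ne' using 1
      have h2 : √(ℓ y x) ≠ 0 := (Real.sqrt_pos.2 hp).ne'
      field_simp
      rw [Real.sq_sqrt hp.le]
    obtain ⟨ξ, hξ, he⟩ := exists_hasDerivAt_eq_slope _ _ hab hc hd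
    refine ⟨ξ, Ioo_subset_Icc_self hξ, ?_⟩
    rw [he]
    field_simp [(sub_pos.2 hab).ne']
  rcases lt_or_gt_of_ne hab with h | h
  · obtain ⟨ξ, hξ, he⟩ := key ha hb h
    exact ⟨ξ, by rwa [min_eq_left h.le, max_eq_right h.le], by linarith⟩
  · obtain ⟨ξ, hξ, he⟩ := key hb ha h
    exact ⟨ξ, by rwa [min_eq_right h.le, max_eq_left h.le], he⟩

/-- The squared Hellinger distance is at least quadratic on the compact parameter interval:
identifiability handles distant parameters, positive information handles close ones. -/
lemma exists_hellinger_lower (hF : SmoothFamily μ ℓ s t I sc) :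
    ∃ c > 0, ∀ a ∈ Icc s t, ∀ b ∈ Icc s t,
      ENNReal.ofReal (c * (a - b) ^ 2) ≤ ∫⁻ y, ENNReal.ofReal ((√(ℓ y a) - √(ℓ y b)) ^ 2) ∂μ := by
  by_contra hcon
  push Not at hcon
  -- violating pairs for the constants `1 / (n + 1)` accumulate at some `(a0, b0)` by compactness
  choose a ha b hb hlt using fun n : ℕ => hcon (1 / ((n : ℝ) + 1)) (by positivity)
  have hcpt : IsCompact (Icc s t ×ˢ Icc s t) := isCompact_Icc.prod isCompact_Icc
  obtain ⟨⟨a0, b0⟩, ⟨ha0, hb0⟩, φ, hφ, hlim⟩ :=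
    hcpt.tendsto_subseq (x := fun n => (a n, b n)) fun n => ⟨ha n, hb n⟩
  have hla : Tendsto (fun n => a (φ n)) atTop (𝓝 a0) :=
    (continuous_fst.tendsto _).comp hlim
  have hlb : Tendsto (fun n => b (φ n)) atTop (𝓝 b0) :=
    (continuous_snd.tendsto _).comp hlim
  have hc0 : Tendsto (fun n : ℕ => 1 / ((φ n : ℝ) + 1)) atTop (𝓝 0) :=
    tendsto_one_div_add_atTop_nhds_zero_nat.comp hφ.tendsto_atTop
  have hcont : ∀ {u : ℕ → ℝ} {u0 : ℝ} (f : ℝ → ℝ), ContinuousOn f (Icc s t) →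
      (∀ n, u n ∈ Icc s t) → u0 ∈ Icc s t → Tendsto u atTop (𝓝 u0) →
      Tendsto (fun n => f (u n)) atTop (𝓝 (f u0)) := by
    intro u u0 f hf hu hu0 hl
    exact (hf u0 hu0).tendsto.comp (tendsto_nhdsWithin_iff.2 ⟨hl, Eventually.of_forall hu⟩)
  have hmeas : ∀ u v : ℝ, Measurable fun y => (√(ℓ y u) - √(ℓ y v)) := fun u v =>
    (hF.measurable_left u).sqrt.sub (hF.measurable_left v).sqrt
  by_cases hab : a0 = b0
  · -- if `a0 = b0`, Fatou's lemma for the difference quotients of `√ℓ` gives `I a0 = 0`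
    subst hab
    have hne : ∀ n, a n ≠ b n := by
      intro n h
      have := hlt n
      simp [h] at this
    let f : ℕ → 𝓨 → ENNReal := fun n y =>
      ENNReal.ofReal (((√(ℓ y (a (φ n))) - √(ℓ y (b (φ n)))) / (a (φ n) - b (φ n))) ^ 2)
    have hfm : ∀ n, Measurable (f n) := fun n =>
      (((hmeas _ _).div_const _).pow_const 2).ennreal_ofReal
    have hpt : ∀ y, Tendsto (fun n => f n y) atTop
        (𝓝 (ENNReal.ofReal ((sc y a0 * √(ℓ y a0) / 2) ^ 2))) := by
      intro y
      choose ξ hξ hξe using fun n => hF.exists_sqrt_sub_eq y (ha (φ n)) (hb (φ n)) (hne (φ n))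
      have hξI : ∀ n, ξ n ∈ Icc s t := fun n =>
        ⟨(le_min (ha _).1 (hb _).1).trans (hξ n).1, (hξ n).2.trans (max_le (ha _).2 (hb _).2)⟩
      have hξl : Tendsto ξ atTop (𝓝 a0) := by
        have h1 := hla.min hlb
        have h2 := hla.max hlb
        simp only [min_self, max_self] at h1 h2
        exact tendsto_of_tendsto_of_tendsto_of_le_of_le h1 h2 (fun n => (hξ n).1)
          (fun n => (hξ n).2)
      have := hcont (fun x => (sc y x * √(ℓ y x) / 2) ^ 2)
        ((((hF.score_cont y).mul (hF.cont y).sqrt).div_const 2).pow 2) hξI ha0 hξl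
      refine (ENNReal.continuous_ofReal.tendsto _).comp (this.congr fun n => ?_)
      rw [hξe n, mul_div_cancel_left₀ _ (sub_ne_zero.2 (hne _))]
    have hle : ∀ n, ∫⁻ y, f n y ∂μ ≤ ENNReal.ofReal (1 / ((φ n : ℝ) + 1)) := by
      intro n
      have hd : (0 : ℝ) < (a (φ n) - b (φ n)) ^ 2 := by
        have := sub_ne_zero.2 (hne (φ n)); positivity
      have h1 : ∀ y, f n y = ENNReal.ofReal ((√(ℓ y (a (φ n))) - √(ℓ y (b (φ n)))) ^ 2) *
          ENNReal.ofReal ((a (φ n) - b (φ n)) ^ 2)⁻¹ := by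
        intro y
        rw [← ENNReal.ofReal_mul (by positivity), ← div_eq_mul_inv, ← div_pow]
      simp_rw [h1]
      rw [lintegral_mul_const _ ((hmeas _ _).pow_const 2).ennreal_ofReal]
      calc _ ≤ ENNReal.ofReal (1 / ((φ n : ℝ) + 1) * (a (φ n) - b (φ n)) ^ 2) *
            ENNReal.ofReal ((a (φ n) - b (φ n)) ^ 2)⁻¹ := by
            gcongr; exact (hlt (φ n)).le
        _ = _ := by
            rw [← ENNReal.ofReal_mul (by positivity), mul_assoc, mul_inv_cancel₀ hd.ne', mul_one]
    have hfatou : ∫⁻ y, liminf (fun n => f n y) atTop ∂μ ≤ liminf (fun n => ∫⁻ y, f n y ∂μ) atTop :=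
      lintegral_liminf_le hfm
    have h0 : liminf (fun n => ∫⁻ y, f n y ∂μ) atTop = 0 := by
      refine Tendsto.liminf_eq ?_
      refine tendsto_of_tendsto_of_tendsto_of_le_of_le tendsto_const_nhds ?_
        (fun _ => zero_le) hle
      simpa [Function.comp_def] using (ENNReal.continuous_ofReal.tendsto _).comp hc0
    rw [h0, lintegral_congr fun y => (hpt y).liminf_eq] at hfatou
    have h2 : ∫⁻ y, ENNReal.ofReal (sc y a0 ^ 2 * ℓ y a0 / 4) ∂μ = 0 := by
      refine le_antisymm (le_of_eq_of_le (lintegral_congr fun y => ?_) hfatou) zero_le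
      congr 1
      rw [div_pow, mul_pow, Real.sq_sqrt (hF.pos y a0 ha0).le]; norm_num
    rw [← ofReal_integral_eq_lintegral_ofReal ((hF.sq_integrable a0 ha0).div_const 4)
      (Eventually.of_forall fun y => by have := (hF.pos y a0 ha0).le; positivity),
      integral_div, hF.sq_integral a0 ha0, ENNReal.ofReal_eq_zero] at h2
    linarith [hF.info_pos a0 ha0]
  · -- if `a0 ≠ b0`, Fatou's lemma gives equal densities, against identifiability
    let f : ℕ → 𝓨 → ENNReal := fun n y =>
      ENNReal.ofReal ((√(ℓ y (a (φ n))) - √(ℓ y (b (φ n)))) ^ 2)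
    have hfm : ∀ n, Measurable (f n) := fun n => ((hmeas _ _).pow_const 2).ennreal_ofReal
    have hpt : ∀ y, Tendsto (fun n => f n y) atTop
        (𝓝 (ENNReal.ofReal ((√(ℓ y a0) - √(ℓ y b0)) ^ 2))) := by
      intro y
      refine (ENNReal.continuous_ofReal.tendsto _).comp (Tendsto.pow (Tendsto.sub ?_ ?_) 2)
      · exact hcont (fun x => √(ℓ y x)) (hF.cont y).sqrt (fun n => ha _) ha0 hla
      · exact hcont (fun x => √(ℓ y x)) (hF.cont y).sqrt (fun n => hb _) hb0 hlb
    have hfatou : ∫⁻ y, liminf (fun n => f n y) atTop ∂μ ≤ liminf (fun n => ∫⁻ y, f n y ∂μ) atTop :=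
      lintegral_liminf_le hfm
    have h0 : liminf (fun n => ∫⁻ y, f n y ∂μ) atTop = 0 := by
      refine Tendsto.liminf_eq ?_
      refine tendsto_of_tendsto_of_tendsto_of_le_of_le tendsto_const_nhds ?_
        (fun _ => zero_le) (fun n => (hlt (φ n)).le)
      have := hc0.mul ((hla.sub hlb).pow 2)
      rw [zero_mul] at this
      simpa [Function.comp_def] using (ENNReal.continuous_ofReal.tendsto _).comp this
    rw [h0, lintegral_congr fun y => (hpt y).liminf_eq, nonpos_iff_eq_zero,
      lintegral_eq_zero_iff ((hmeas _ _).pow_const 2).ennreal_ofReal] at hfatou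
    refine hab (hF.identifiable a0 ha0 b0 hb0 ?_)
    filter_upwards [hfatou] with y hy
    simp only [Pi.zero_apply, ENNReal.ofReal_eq_zero] at hy
    have h3 : √(ℓ y a0) = √(ℓ y b0) := by
      have : √(ℓ y a0) - √(ℓ y b0) = 0 := by
        have := le_antisymm hy (sq_nonneg _); simpa using this
      linarith
    exact (Real.sqrt_inj (hF.pos y a0 ha0).le (hF.pos y b0 hb0).le).1 h3

lemma affinity_integrable (hF : SmoothFamily μ ℓ s t I sc) {γ : ℝ} (h0 : 0 < γ) (h1 : γ < 1)
    {a b : ℝ} (ha : a ∈ Icc s t) (hb : b ∈ Icc s t) :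
    Integrable (fun y => ℓ y a ^ γ * ℓ y b ^ (1 - γ)) μ := by
  refine Integrable.mono' (((hF.integrable ha).const_mul γ).add
    ((hF.integrable hb).const_mul (1 - γ))) ?_ (Eventually.of_forall fun y => ?_)
  · exact (((hF.measurable_left a).pow_const γ).mul
      ((hF.measurable_left b).pow_const (1 - γ))).aestronglyMeasurable
  · have pa := (hF.pos y a ha).le
    have pb := (hF.pos y b hb).le
    rw [Real.norm_of_nonneg (by positivity)]
    exact Real.geom_mean_le_arith_mean2_weighted h0.le (by linarith) pa pb (by ring)

/-- The affinity of the `k`-sample distributions decays like a Gaussian in the parameter. -/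
lemma exists_affinity_le (hF : SmoothFamily μ ℓ s t I sc) [SigmaFinite μ] {γ : ℝ} (h0 : 0 < γ)
    (h1 : γ < 1) :
    ∃ c > 0, ∀ a ∈ Icc s t, ∀ b ∈ Icc s t, ∀ k : ℕ,
      ∫⁻ y : Fin k → 𝓨, ENNReal.ofReal (likelihood ℓ k y a ^ γ * likelihood ℓ k y b ^ (1 - γ))
        ∂(Measure.pi fun _ => μ) ≤ ENNReal.ofReal (Real.exp (-(c * k * (a - b) ^ 2))) := by
  obtain ⟨c, hc, hlow⟩ := hF.exists_hellinger_lower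
  have hm : 0 < min γ (1 - γ) := lt_min h0 (by linarith)
  refine ⟨min γ (1 - γ) * c, by positivity, fun a ha b hb k => ?_⟩
  have hone : ∫ y, ℓ y a ^ γ * ℓ y b ^ (1 - γ) ∂μ ≤
      Real.exp (-(min γ (1 - γ) * c * (a - b) ^ 2)) := by
    have hsqi : Integrable (fun y => (√(ℓ y a) - √(ℓ y b)) ^ 2) μ := by
      refine Integrable.mono' (((hF.integrable ha).const_mul 2).add
        ((hF.integrable hb).const_mul 2)) ?_ (Eventually.of_forall fun y => ?_)
      · exact (((hF.measurable_left a).sqrt.sub (hF.measurable_left b).sqrt).pow_const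
          2).aestronglyMeasurable
      · rw [Real.norm_of_nonneg (sq_nonneg _)]
        have := Real.sq_sqrt (hF.pos y a ha).le
        have := Real.sq_sqrt (hF.pos y b hb).le
        simp only [Pi.add_apply]
        nlinarith [sq_nonneg (√(ℓ y a) + √(ℓ y b))]
    have hl := hlow a ha b hb
    rw [← ofReal_integral_eq_lintegral_ofReal hsqi (Eventually.of_forall fun y => sq_nonneg _),
      ENNReal.ofReal_le_ofReal_iff (integral_nonneg fun y => sq_nonneg _)] at hl
    calc ∫ y, ℓ y a ^ γ * ℓ y b ^ (1 - γ) ∂μ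
        ≤ ∫ y, γ * ℓ y a + (1 - γ) * ℓ y b - min γ (1 - γ) * (√(ℓ y a) - √(ℓ y b)) ^ 2 ∂μ := by
          refine integral_mono (hF.affinity_integrable h0 h1 ha hb)
            ((((hF.integrable ha).const_mul γ).add ((hF.integrable hb).const_mul (1 - γ))).sub
              (hsqi.const_mul _)) fun y => ?_
          exact rpow_mul_rpow_le_sub_sq h0 h1 (hF.pos y a ha).le (hF.pos y b hb).le
      _ = 1 - min γ (1 - γ) * ∫ y, (√(ℓ y a) - √(ℓ y b)) ^ 2 ∂μ := by
          have hab : Integrable (fun y => γ * ℓ y a + (1 - γ) * ℓ y b) μ :=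
            ((hF.integrable ha).const_mul γ).add ((hF.integrable hb).const_mul (1 - γ))
          rw [integral_sub hab (hsqi.const_mul _),
            integral_add ((hF.integrable ha).const_mul γ) ((hF.integrable hb).const_mul (1 - γ)),
            integral_const_mul, integral_const_mul, integral_const_mul, hF.integral_eq_one a ha,
            hF.integral_eq_one b hb]
          ring
      _ ≤ 1 - min γ (1 - γ) * (c * (a - b) ^ 2) := by gcongr
      _ ≤ _ := by
          have := Real.add_one_le_exp (-(min γ (1 - γ) * c * (a - b) ^ 2))
          linarith
  have hprod : ∀ y : Fin k → 𝓨, likelihood ℓ k y a ^ γ * likelihood ℓ k y b ^ (1 - γ) =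
      ∏ j, (ℓ (y j) a ^ γ * ℓ (y j) b ^ (1 - γ)) := by
    intro y
    rw [likelihood, likelihood, Finset.prod_mul_distrib,
      Real.finsetProd_rpow _ _ (fun j _ => (hF.pos _ a ha).le),
      Real.finsetProd_rpow _ _ (fun j _ => (hF.pos _ b hb).le)]
  simp_rw [hprod]
  have hnn : ∀ y, 0 ≤ ℓ y a ^ γ * ℓ y b ^ (1 - γ) := fun y => by
    have pa := (hF.pos y a ha).le
    have pb := (hF.pos y b hb).le
    positivity
  rw [← ofReal_integral_eq_lintegral_ofReal
    (Integrable.fintype_prod fun _ => hF.affinity_integrable h0 h1 ha hb)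
    (Eventually.of_forall fun y => Finset.prod_nonneg fun j _ => hnn _)]
  apply ENNReal.ofReal_le_ofReal
  rw [integral_fintype_prod_eq_pow (fun y => ℓ y a ^ γ * ℓ y b ^ (1 - γ)), Fintype.card_fin]
  calc _ ≤ Real.exp (-(min γ (1 - γ) * c * (a - b) ^ 2)) ^ k :=
        pow_le_pow_left₀ (integral_nonneg hnn) hone k
    _ = _ := by rw [← Real.exp_nat_mul]; congr 1; ring

end SmoothFamily

/-! ### Tail bounds for integrated likelihood ratios -/

/-- A one-dimensional Sobolev inequality in multiplicative form: the `β`-th power of the integral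
of `L` is controlled by linear functionals of `L ^ β` and of its derivative. -/
lemma rpow_integral_le {L S : ℝ → ℝ} {a b e β n : ℝ} (hab : a ≤ b) (he : e ∈ Icc a b)
    (h0 : 0 < β) (h1 : β < 1) (hn : 0 ≤ n) (hpos : ∀ x ∈ Icc a b, 0 < L x)
    (hL : ContinuousOn L (Icc a b)) (hS : ContinuousOn S (Icc a b))
    (hd : ∀ x ∈ Ioo a b, HasDerivAt L (S x * L x) x) :
    (n * ∫ x in a..b, L x) ^ β ≤
      L e ^ β + (∫ x in a..b, β * (L x ^ β * |S x|)) + n * ∫ x in a..b, L x ^ β := by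
  have hg : ContinuousOn (fun x => L x ^ β) (Icc a b) :=
    hL.rpow_const fun x hx => Or.inl (hpos x hx).ne'
  have hg' : ContinuousOn (fun x => β * (L x ^ β * S x)) (Icc a b) :=
    continuousOn_const.mul (hg.mul hS)
  have hga : ContinuousOn (fun x => β * (L x ^ β * |S x|)) (Icc a b) :=
    continuousOn_const.mul (hg.mul hS.abs)
  have hderiv : ∀ x ∈ Ioo a b, HasDerivAt (fun x => L x ^ β) (β * (L x ^ β * S x)) x := by
    intro x hx
    have hp := hpos x (Ioo_subset_Icc_self hx)
    convert (hd x hx).rpow_const (p := β) (Or.inl hp.ne') using 1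
    rw [Real.rpow_sub_one hp.ne']
    field_simp
  -- the oscillation of `L ^ β` is at most its total variation `V`, hence `L ^ β ≤ L e ^ β + V`
  set V := ∫ x in a..b, β * (L x ^ β * |S x|) with hV
  have key : ∀ {u v : ℝ}, a ≤ u → u ≤ v → v ≤ b → |L v ^ β - L u ^ β| ≤ V := by
    intro u v hau huv hvb
    have hsub : Icc u v ⊆ Icc a b := Icc_subset_Icc hau hvb
    rw [← intervalIntegral.integral_eq_sub_of_hasDerivAt_of_le huv (hg.mono hsub)
      (fun x hx => hderiv x ⟨hau.trans_lt hx.1, hx.2.trans_le hvb⟩)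
      ((hg'.mono hsub).intervalIntegrable_of_Icc huv)]
    calc |∫ x in u..v, β * (L x ^ β * S x)| ≤ ∫ x in u..v, |β * (L x ^ β * S x)| :=
          intervalIntegral.abs_integral_le_integral_abs huv
      _ = ∫ x in u..v, β * (L x ^ β * |S x|) := by
          refine intervalIntegral.integral_congr fun x hx => ?_
          rw [uIcc_of_le huv] at hx
          have := (hpos x (hsub hx)).le
          rw [abs_mul, abs_mul, abs_of_pos h0, abs_of_nonneg (by positivity)]
      _ ≤ V := by
          refine intervalIntegral.integral_mono_interval hau huv hvb ?_
            (hga.intervalIntegrable_of_Icc hab)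
          refine (ae_restrict_iff' measurableSet_Ioc).2 (Eventually.of_forall fun x hx => ?_)
          have := (hpos x (Ioc_subset_Icc_self hx)).le
          simp only [Pi.zero_apply]
          positivity
  have hsup : ∀ x ∈ Icc a b, L x ^ β ≤ L e ^ β + V := by
    intro x hx
    rcases le_total e x with h | h
    · have := le_of_abs_le (key he.1 h hx.2); linarith
    · have := neg_le_of_abs_le (key hx.1 h he.2); linarith
  have hM : 0 < L e ^ β + V := by
    have := Real.rpow_pos_of_pos (hpos e he) β
    exact this.trans_le (hsup e he)
  set M := L e ^ β + V with hMdef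
  set G := ∫ x in a..b, L x ^ β with hGdef
  have hG : 0 ≤ G := intervalIntegral.integral_nonneg hab fun x hx => by
    have := (hpos x hx).le; positivity
  -- `L = (L ^ β) ^ ((1 - β) / β) * L ^ β`, and the first factor is bounded
  have hint : ∫ x in a..b, L x ≤ M ^ ((1 - β) / β) * G := by
    rw [hGdef, ← intervalIntegral.integral_const_mul]
    refine intervalIntegral.integral_mono_on hab (hL.intervalIntegrable_of_Icc hab)
      ((continuousOn_const.mul hg).intervalIntegrable_of_Icc hab) fun x hx => ?_
    have hp := hpos x hx
    have : L x = (L x ^ β) ^ ((1 - β) / β) * L x ^ β := by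
      rw [← Real.rpow_mul hp.le, ← Real.rpow_add hp, mul_div_cancel₀ _ h0.ne', sub_add_cancel,
        Real.rpow_one]
    calc L x = (L x ^ β) ^ ((1 - β) / β) * L x ^ β := this
      _ ≤ _ := mul_le_mul_of_nonneg_right (Real.rpow_le_rpow (by positivity) (hsup x hx)
          (div_nonneg (by linarith) h0.le)) (by positivity)
  have hLint : 0 ≤ ∫ x in a..b, L x :=
    intervalIntegral.integral_nonneg hab fun x hx => (hpos x hx).le
  calc (n * ∫ x in a..b, L x) ^ β ≤ (n * (M ^ ((1 - β) / β) * G)) ^ β := by gcongr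
    _ = (n * G) ^ β * M ^ (1 - β) := by
        rw [mul_left_comm, Real.mul_rpow (by positivity) (by positivity), ← Real.rpow_mul hM.le,
          div_mul_cancel₀ _ h0.ne', mul_comm]
    _ ≤ β * (n * G) + (1 - β) * M :=
        Real.geom_mean_le_arith_mean2_weighted h0.le (by linarith) (by positivity) hM.le (by ring)
    _ ≤ M + n * G := by nlinarith [mul_nonneg hn hG]

/-- The distribution of one observation under the parameter `θ`. -/
noncomputable def obsLaw (μ : Measure 𝓨) (ℓ : 𝓨 → ℝ → ℝ) (θ : ℝ) : Measure 𝓨 :=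
  μ.withDensity fun y => ENNReal.ofReal (ℓ y θ)

/-- Score of a sample of `k` observations. -/
noncomputable def sampleScore (sc : 𝓨 → ℝ → ℝ) (k : ℕ) (y : Fin k → 𝓨) (θ : ℝ) : ℝ :=
  ∑ j, sc (y j) θ

namespace SmoothFamily

lemma likelihood_pos (hF : SmoothFamily μ ℓ s t I sc) {k : ℕ} (y : Fin k → 𝓨) {θ : ℝ}
    (hθ : θ ∈ Icc s t) : 0 < likelihood ℓ k y θ :=
  Finset.prod_pos fun j _ => hF.pos (y j) θ hθ

lemma likelihood_cont (hF : SmoothFamily μ ℓ s t I sc) {k : ℕ} (y : Fin k → 𝓨) :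
    ContinuousOn (likelihood ℓ k y) (Icc s t) :=
  continuousOn_finsetProd _ fun j _ => hF.cont (y j)

lemma likelihood_hasDerivAt (hF : SmoothFamily μ ℓ s t I sc) {k : ℕ} (y : Fin k → 𝓨) {θ : ℝ}
    (hθ : θ ∈ Ioo s t) :
    HasDerivAt (likelihood ℓ k y) (sampleScore sc k y θ * likelihood ℓ k y θ) θ := by
  have h := HasDerivAt.fun_finsetProd (u := Finset.univ) (f := fun j => ℓ (y j))
    (f' := fun j => sc (y j) θ * ℓ (y j) θ) (x := θ) fun j _ => hF.hasDerivAt (y j) θ hθ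
  refine h.congr_deriv ?_
  rw [sampleScore, Finset.sum_mul]
  refine Finset.sum_congr rfl fun j hj => ?_
  rw [likelihood, ← Finset.mul_prod_erase _ _ hj, smul_eq_mul]
  ring

lemma likelihood_measurable (hF : SmoothFamily μ ℓ s t I sc) (k : ℕ) :
    Measurable fun p : (Fin k → 𝓨) × ℝ => likelihood ℓ k p.1 p.2 :=
  Finset.measurable_fun_prod _ fun j _ =>
    hF.measurable.comp (by fun_prop : Measurable fun p : (Fin k → 𝓨) × ℝ => (p.1 j, p.2))

lemma likelihood_measurable_left (hF : SmoothFamily μ ℓ s t I sc) (k : ℕ) (θ : ℝ) :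
    Measurable fun y : Fin k → 𝓨 => likelihood ℓ k y θ :=
  (hF.likelihood_measurable k).comp (by fun_prop : Measurable fun y : Fin k → 𝓨 => (y, θ))

lemma sampleScore_measurable (hF : SmoothFamily μ ℓ s t I sc) (k : ℕ) :
    Measurable fun p : (Fin k → 𝓨) × ℝ => sampleScore sc k p.1 p.2 :=
  Finset.measurable_fun_sum _ fun j _ =>
    hF.score_measurable.comp (by fun_prop : Measurable fun p : (Fin k → 𝓨) × ℝ => (p.1 j, p.2))

lemma sampleScore_measurable_left (hF : SmoothFamily μ ℓ s t I sc) (k : ℕ) (θ : ℝ) :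
    Measurable fun y : Fin k → 𝓨 => sampleScore sc k y θ :=
  (hF.sampleScore_measurable k).comp (by fun_prop : Measurable fun y : Fin k → 𝓨 => (y, θ))

lemma isProbabilityMeasure_obsLaw (hF : SmoothFamily μ ℓ s t I sc) {θ : ℝ} (hθ : θ ∈ Icc s t) :
    IsProbabilityMeasure (obsLaw μ ℓ θ) := by
  constructor
  rw [obsLaw, withDensity_apply _ MeasurableSet.univ, Measure.restrict_univ,
    ← ofReal_integral_eq_lintegral_ofReal (hF.integrable hθ)
      (Eventually.of_forall fun y => (hF.pos y θ hθ).le), hF.integral_eq_one θ hθ,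
    ENNReal.ofReal_one]

lemma integrable_obsLaw (hF : SmoothFamily μ ℓ s t I sc) {θ : ℝ} (hθ : θ ∈ Icc s t) {f : 𝓨 → ℝ}
    (hf : Integrable (fun y => f y * ℓ y θ) μ) : Integrable f (obsLaw μ ℓ θ) := by
  rw [obsLaw, integrable_withDensity_iff (hF.measurable_left θ).ennreal_ofReal
    (Eventually.of_forall fun y => ENNReal.ofReal_lt_top)]
  simpa only [ENNReal.toReal_ofReal (hF.pos _ θ hθ).le] using hf

lemma integral_obsLaw (hF : SmoothFamily μ ℓ s t I sc) {θ : ℝ} (hθ : θ ∈ Icc s t) (f : 𝓨 → ℝ) :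
    ∫ y, f y ∂(obsLaw μ ℓ θ) = ∫ y, f y * ℓ y θ ∂μ := by
  rw [obsLaw, integral_withDensity_eq_integral_toReal_smul (hF.measurable_left θ).ennreal_ofReal
    (Eventually.of_forall fun y => ENNReal.ofReal_lt_top)]
  refine integral_congr_ae (Eventually.of_forall fun y => ?_)
  simp only [ENNReal.toReal_ofReal (hF.pos _ θ hθ).le, smul_eq_mul, mul_comm]

/-- The joint law of `k` observations has density `likelihood ℓ k · θ`. -/
lemma pi_obsLaw (hF : SmoothFamily μ ℓ s t I sc) [SigmaFinite μ] {θ : ℝ} (hθ : θ ∈ Icc s t)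
    (k : ℕ) : Measure.pi (fun _ : Fin k => obsLaw μ ℓ θ) =
      (Measure.pi fun _ => μ).withDensity fun y => ENNReal.ofReal (likelihood ℓ k y θ) := by
  have := hF.isProbabilityMeasure_obsLaw hθ
  refine Measure.pi_eq fun A hA => ?_
  have h1 : ∀ j, obsLaw μ ℓ θ (A j) =
      ENNReal.ofReal (∫ y, (A j).indicator (fun y => ℓ y θ) y ∂μ) := by
    intro j
    rw [obsLaw, withDensity_apply _ (hA j), integral_indicator (hA j),
      ofReal_integral_eq_lintegral_ofReal (hF.integrable hθ).integrableOn
        (Eventually.of_forall fun y => (hF.pos y θ hθ).le)]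
  simp_rw [h1]
  have hnn : ∀ j y, 0 ≤ (A j).indicator (fun y => ℓ y θ) y := fun j y =>
    indicator_nonneg (fun y _ => (hF.pos y θ hθ).le) y
  symm
  rw [← ENNReal.ofReal_prod_of_nonneg fun j _ => integral_nonneg (hnn j),
    ← integral_fintype_prod_eq_prod (μ := fun _ : Fin k => μ)
      (fun j => (A j).indicator fun y => ℓ y θ),
    ofReal_integral_eq_lintegral_ofReal
      (Integrable.fintype_prod_dep fun j => (hF.integrable hθ).indicator (hA j))
      (Eventually.of_forall fun y => Finset.prod_nonneg fun j _ => hnn j _),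
    withDensity_apply _ (MeasurableSet.univ_pi hA),
    ← lintegral_indicator (MeasurableSet.univ_pi hA)]
  refine lintegral_congr fun y => ?_
  by_cases hy : y ∈ univ.pi A
  · rw [indicator_of_mem hy]
    congr 1
    exact Finset.prod_congr rfl fun j _ => indicator_of_mem (hy j (mem_univ j)) _
  · rw [indicator_of_notMem hy]
    simp only [Set.mem_pi, mem_univ, true_implies, not_forall] at hy
    obtain ⟨j, hj⟩ := hy
    rw [Finset.prod_eq_zero (Finset.mem_univ j) (indicator_of_notMem hj _), ENNReal.ofReal_zero]

lemma lintegral_pi_obsLaw (hF : SmoothFamily μ ℓ s t I sc) [SigmaFinite μ] {θ : ℝ}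
    (hθ : θ ∈ Icc s t) (k : ℕ) {f : (Fin k → 𝓨) → ENNReal} (hf : Measurable f) :
    ∫⁻ y, f y ∂(Measure.pi fun _ : Fin k => obsLaw μ ℓ θ) =
      ∫⁻ y, ENNReal.ofReal (likelihood ℓ k y θ) * f y ∂(Measure.pi fun _ => μ) := by
  rw [hF.pi_obsLaw hθ, lintegral_withDensity_eq_lintegral_mul _
    (hF.likelihood_measurable_left k θ).ennreal_ofReal hf]
  rfl

lemma score_memLp (hF : SmoothFamily μ ℓ s t I sc) {θ : ℝ} (hθ : θ ∈ Icc s t) :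
    MemLp (fun y => sc y θ) 2 (obsLaw μ ℓ θ) := by
  rw [memLp_two_iff_integrable_sq (hF.score_measurable_left θ).aestronglyMeasurable]
  exact hF.integrable_obsLaw hθ (hF.sq_integrable θ hθ)

/-- The score of `k` observations has variance `k I(θ)`. -/
lemma lintegral_sampleScore_sq (hF : SmoothFamily μ ℓ s t I sc) [SigmaFinite μ] {θ : ℝ}
    (hθ : θ ∈ Icc s t) (k : ℕ) :
    ∫⁻ y : Fin k → 𝓨, ENNReal.ofReal (likelihood ℓ k y θ * sampleScore sc k y θ ^ 2)
      ∂(Measure.pi fun _ => μ) = ENNReal.ofReal (k * I θ) := by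
  have := hF.isProbabilityMeasure_obsLaw hθ
  have hm0 : ∫ y, sc y θ ∂(obsLaw μ ℓ θ) = 0 := by
    rw [hF.integral_obsLaw hθ, hF.score_integral θ hθ]
  have hL : ∀ j : Fin k, MemLp (fun y : Fin k → 𝓨 => sc (y j) θ) 2
      (Measure.pi fun _ : Fin k => obsLaw μ ℓ θ) := fun j =>
    (hF.score_memLp hθ).comp_measurePreserving (measurePreserving_eval _ j)
  have hS : MemLp (fun y : Fin k → 𝓨 => sampleScore sc k y θ) 2
      (Measure.pi fun _ : Fin k => obsLaw μ ℓ θ) := memLp_finsetSum _ fun j _ => hL j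
  have hmean : ∫ y, sampleScore sc k y θ ∂(Measure.pi fun _ : Fin k => obsLaw μ ℓ θ) = 0 := by
    simp only [sampleScore]
    rw [integral_finsetSum _ fun j _ => (hL j).integrable one_le_two]
    refine Finset.sum_eq_zero fun j _ => ?_
    rw [← hm0]
    conv_rhs => rw [← (measurePreserving_eval (fun _ : Fin k => obsLaw μ ℓ θ) j).map_eq]
    rw [integral_map (measurable_pi_apply j).aemeasurable
      (hF.score_measurable_left θ).aestronglyMeasurable]
  have hv := ProbabilityTheory.variance_sum_pi (μ := fun _ : Fin k => obsLaw μ ℓ θ)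
    (X := fun _ y => sc y θ) fun _ => hF.score_memLp hθ
  have e : (∑ i : Fin k, fun ω : Fin k → 𝓨 => sc (ω i) θ) = fun y => sampleScore sc k y θ := by
    ext y; simp [sampleScore]
  rw [e, ProbabilityTheory.variance_of_integral_eq_zero hS.aemeasurable hmean,
    ProbabilityTheory.variance_of_integral_eq_zero (hF.score_memLp hθ).aemeasurable hm0,
    hF.integral_obsLaw hθ, hF.sq_integral θ hθ, Finset.sum_const, Finset.card_univ,
    Fintype.card_fin, nsmul_eq_mul] at hv
  rw [← hv, ofReal_integral_eq_lintegral_ofReal hS.integrable_sq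
    (Eventually.of_forall fun y => sq_nonneg _), hF.lintegral_pi_obsLaw hθ k
    ((hF.sampleScore_measurable_left k θ).pow_const 2).ennreal_ofReal]
  refine lintegral_congr fun y => ?_
  rw [ENNReal.ofReal_mul (hF.likelihood_pos y hθ).le]

end SmoothFamily

lemma ofReal_intervalIntegral_eq_lintegral {f : ℝ → ℝ} {a b : ℝ} (hab : a ≤ b)
    (hf : ContinuousOn f (Icc a b)) (h0 : ∀ x ∈ Icc a b, 0 ≤ f x) :
    ENNReal.ofReal (∫ x in a..b, f x) = ∫⁻ x in Ioc a b, ENNReal.ofReal (f x) := by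
  rw [intervalIntegral.integral_of_le hab, ofReal_integral_eq_lintegral_ofReal]
  · exact (hf.integrableOn_Icc).mono_set Ioc_subset_Icc_self
  · exact (ae_restrict_iff' measurableSet_Ioc).2 (Eventually.of_forall fun x hx =>
      h0 x (Ioc_subset_Icc_self hx))

namespace SmoothFamily

lemma exists_info_le (hF : SmoothFamily μ ℓ s t I sc) : ∃ B, ∀ θ ∈ Icc s t, I θ ≤ B := by
  obtain ⟨B, hB⟩ := (isCompact_Icc.bddAbove_image hF.info_cont)
  exact ⟨B, fun θ hθ => hB (mem_image_of_mem _ hθ)⟩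

/-- The first absolute moment of the score, weighted by the geometric mean of the likelihoods at
`x` and `θ`. Cauchy–Schwarz splits it into the variance `k I(x)` of the score under `x` and the
affinity of exponent `2 β - 1`, which is positive as `β > 1 / 2`. -/
lemma exists_score_affinity_le (hF : SmoothFamily μ ℓ s t I sc) [SigmaFinite μ] {β : ℝ}
    (h0 : 1 / 2 < β) (h1 : β < 1) :
    ∃ c > 0, ∃ C ≥ 0, ∀ x ∈ Icc s t, ∀ θ ∈ Icc s t, ∀ k : ℕ,
      ∫⁻ y : Fin k → 𝓨, ENNReal.ofReal (likelihood ℓ k y x ^ β * likelihood ℓ k y θ ^ (1 - β) *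
        |sampleScore sc k y x|) ∂(Measure.pi fun _ => μ) ≤
          ENNReal.ofReal (C * √k * Real.exp (-(c * k * (x - θ) ^ 2))) := by
  obtain ⟨c, hc, haff⟩ := hF.exists_affinity_le (γ := 2 * β - 1) (by linarith) (by linarith)
  obtain ⟨B, hB⟩ := hF.exists_info_le
  refine ⟨c / 2, by positivity, √B, Real.sqrt_nonneg _, fun x hx θ hθ k => ?_⟩
  have hlx := hF.likelihood_measurable_left k x
  have hlθ := hF.likelihood_measurable_left k θ
  have hS := hF.sampleScore_measurable_left k x
  set f : (Fin k → 𝓨) → ENNReal := fun y => ENNReal.ofReal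
    (likelihood ℓ k y x ^ ((2 * β - 1) / 2) * likelihood ℓ k y θ ^ (1 - β)) with hf
  set g : (Fin k → 𝓨) → ENNReal := fun y => ENNReal.ofReal
    (likelihood ℓ k y x ^ (1 / 2 : ℝ) * |sampleScore sc k y x|) with hg
  have hfm : AEMeasurable f (Measure.pi fun _ : Fin k => μ) :=
    ((hlx.pow_const _).mul (hlθ.pow_const _)).ennreal_ofReal.aemeasurable
  have hgm : AEMeasurable g (Measure.pi fun _ : Fin k => μ) :=
    ((hlx.pow_const _).mul (by fun_prop)).ennreal_ofReal.aemeasurable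
  have hCS := ENNReal.lintegral_mul_le_Lp_mul_Lq (Measure.pi fun _ : Fin k => μ)
    Real.HolderConjugate.two_two hfm hgm
  have e1 : ∀ y, (f * g) y = ENNReal.ofReal (likelihood ℓ k y x ^ β *
      likelihood ℓ k y θ ^ (1 - β) * |sampleScore sc k y x|) := by
    intro y
    have px := hF.likelihood_pos y hx
    have pθ := hF.likelihood_pos y hθ
    rw [Pi.mul_apply, hf, hg]
    simp only
    rw [← ENNReal.ofReal_mul (by positivity)]
    congr 1
    rw [show β = (2 * β - 1) / 2 + 1 / 2 by ring, Real.rpow_add px]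
    ring_nf
  have e2 : ∫⁻ y, f y ^ (2 : ℝ) ∂(Measure.pi fun _ : Fin k => μ) ≤
      ENNReal.ofReal (Real.exp (-(c * k * (x - θ) ^ 2))) := by
    refine le_trans (le_of_eq (lintegral_congr fun y => ?_)) (haff x hx θ hθ k)
    have px := hF.likelihood_pos y hx
    have pθ := hF.likelihood_pos y hθ
    rw [hf]
    simp only
    rw [ENNReal.ofReal_rpow_of_nonneg (by positivity) (by norm_num),
      Real.mul_rpow (by positivity) (by positivity), ← Real.rpow_mul px.le, ← Real.rpow_mul pθ.le]
    congr 3 <;> ring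
  have e3 : ∫⁻ y, g y ^ (2 : ℝ) ∂(Measure.pi fun _ : Fin k => μ) ≤ ENNReal.ofReal (k * B) := by
    refine le_trans (le_of_eq ?_) (ENNReal.ofReal_le_ofReal
      (mul_le_mul_of_nonneg_left (hB x hx) (Nat.cast_nonneg k)))
    rw [← hF.lintegral_sampleScore_sq hx k]
    refine lintegral_congr fun y => ?_
    have px := hF.likelihood_pos y hx
    rw [hg]
    simp only
    rw [ENNReal.ofReal_rpow_of_nonneg (by positivity) (by norm_num),
      Real.mul_rpow (by positivity) (by positivity), ← Real.rpow_mul px.le]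
    norm_num
  simp_rw [← e1]
  refine hCS.trans ?_
  have hBnn : 0 ≤ B := (hF.info_pos x hx).le.trans (hB x hx)
  calc _ ≤ ENNReal.ofReal (Real.exp (-(c * k * (x - θ) ^ 2))) ^ (1 / 2 : ℝ) *
        ENNReal.ofReal (k * B) ^ (1 / 2 : ℝ) := by gcongr
    _ = _ := by
      rw [ENNReal.ofReal_rpow_of_nonneg (by positivity) (by norm_num),
        ENNReal.ofReal_rpow_of_nonneg (by positivity) (by norm_num),
        ← ENNReal.ofReal_mul (by positivity), ← Real.exp_mul, ← Real.sqrt_eq_rpow,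
        Real.sqrt_mul (by positivity)]
      congr 1
      rw [show -(c * k * (x - θ) ^ 2) * (1 / 2) = -(c / 2 * k * (x - θ) ^ 2) by ring]
      ring

/-- The `β`-th moment of the likelihood ratio integrated over `[a, b]` is bounded by a Gaussian
integral, uniformly in the sample size. The factor `√k` is the local scale of the problem. The
likelihood ratio itself has mean `1` at every parameter; it is the power `β < 1` that produces the
decay, and `rpow_integral_le` that moves the power inside the integral. -/
lemma exists_tail_bound (hF : SmoothFamily μ ℓ s t I sc) [SigmaFinite μ] {β : ℝ}
    (h0 : 1 / 2 < β) (h1 : β < 1) :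
    ∃ c > 0, ∃ C ≥ 0, ∀ θ ∈ Icc s t, ∀ a b e : ℝ, s ≤ a → a ≤ b → b ≤ t → e ∈ Icc a b → ∀ k : ℕ,
      ∫⁻ y, ENNReal.ofReal ((√k * ∫ x in a..b, likelihood ℓ k y x / likelihood ℓ k y θ) ^ β)
        ∂(Measure.pi fun _ : Fin k => obsLaw μ ℓ θ) ≤
      ENNReal.ofReal (Real.exp (-(c * k * (e - θ) ^ 2)) +
        C * (√k * ∫ x in a..b, Real.exp (-(c * k * (x - θ) ^ 2)))) := by
  have hβ : 0 < β := by linarith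
  obtain ⟨c₁, hc₁, haff⟩ := hF.exists_affinity_le hβ h1
  obtain ⟨c₂, hc₂, C₂, hC₂, hsc⟩ := hF.exists_score_affinity_le h0 h1
  set c := min c₁ c₂ with hc
  have hcpos : 0 < c := lt_min hc₁ hc₂
  refine ⟨c, hcpos, C₂ + 1, by positivity, fun θ hθ a b e hsa hab hbt he k => ?_⟩
  have hsub : Icc a b ⊆ Icc s t := Icc_subset_Icc hsa hbt
  -- both exponential rates may be lowered to the common value `c`
  have hexp : ∀ {d : ℝ}, c ≤ d → ∀ x, Real.exp (-(d * k * (x - θ) ^ 2)) ≤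
      Real.exp (-(c * k * (x - θ) ^ 2)) := by
    intro d hd x
    gcongr
  have hm := hF.likelihood_measurable k
  have hmθ : Measurable fun p : (Fin k → 𝓨) × ℝ => likelihood ℓ k p.1 θ :=
    (hF.likelihood_measurable_left k θ).comp measurable_fst
  have hmS := hF.sampleScore_measurable k
  rw [hF.pi_obsLaw hθ]
  refine (lintegral_withDensity_le_lintegral_mul _
    (hF.likelihood_measurable_left k θ).ennreal_ofReal _).trans ?_
  -- `A y x` is the `β`-th power of the likelihood ratio, weighted by the density under `θ`
  let A : (Fin k → 𝓨) → ℝ → ℝ := fun y x => likelihood ℓ k y x ^ β * likelihood ℓ k y θ ^ (1 - β)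
  have hAm : Measurable fun p : (Fin k → 𝓨) × ℝ => A p.1 p.2 :=
    (hm.pow_const _).mul (hmθ.pow_const _)
  have hA0 : ∀ y, ∀ x ∈ Icc a b, 0 ≤ A y x := fun y x hx => by
    have px := hF.likelihood_pos y (hsub hx)
    have pθ := hF.likelihood_pos y hθ
    positivity
  have hAc : ∀ y, ContinuousOn (A y) (Icc a b) := fun y =>
    (((hF.likelihood_cont y).mono hsub).rpow_const
      fun x hx => Or.inl (hF.likelihood_pos y (hsub hx)).ne').mul continuousOn_const
  have hSc : ∀ y : Fin k → 𝓨, ContinuousOn (sampleScore sc k y) (Icc a b) := fun y =>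
    (continuousOn_finsetSum _ fun j _ => hF.score_cont (y j)).mono hsub
  have hpt : ∀ y : Fin k → 𝓨, ENNReal.ofReal (likelihood ℓ k y θ) *
      ENNReal.ofReal ((√k * ∫ x in a..b, likelihood ℓ k y x / likelihood ℓ k y θ) ^ β) ≤
      ENNReal.ofReal (A y e) +
        ((∫⁻ x in Ioc a b, ENNReal.ofReal (A y x * |sampleScore sc k y x|)) +
          ENNReal.ofReal √k * ∫⁻ x in Ioc a b, ENNReal.ofReal (A y x)) := by
    intro y
    have pθ := hF.likelihood_pos y hθ
    have hAL : ∀ x ∈ Icc a b, likelihood ℓ k y θ *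
        (likelihood ℓ k y x / likelihood ℓ k y θ) ^ β = A y x := by
      intro x hx
      have px := hF.likelihood_pos y (hsub hx)
      simp only [A]
      rw [Real.div_rpow px.le pθ.le, Real.rpow_sub pθ, Real.rpow_one]
      ring
    have hpath := rpow_integral_le (L := fun x => likelihood ℓ k y x / likelihood ℓ k y θ)
      (S := sampleScore sc k y) hab he hβ h1 (Real.sqrt_nonneg k)
      (fun x hx => div_pos (hF.likelihood_pos y (hsub hx)) pθ)
      (((hF.likelihood_cont y).mono hsub).div_const _) (hSc y) (fun x hx => by
        have := (hF.likelihood_hasDerivAt y (θ := x)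
          ⟨hsa.trans_lt hx.1, hx.2.trans_le hbt⟩).div_const (likelihood ℓ k y θ)
        rwa [mul_div_assoc] at this)
    rw [← ENNReal.ofReal_mul pθ.le,
      ← ofReal_intervalIntegral_eq_lintegral hab (hAc y) (hA0 y),
      ← ofReal_intervalIntegral_eq_lintegral (f := fun x => A y x * |sampleScore sc k y x|) hab
        ((hAc y).mul (hSc y).abs)
        (fun x hx => mul_nonneg (hA0 y x hx) (abs_nonneg _)),
      ← ENNReal.ofReal_mul (Real.sqrt_nonneg _), ← ENNReal.ofReal_add, ← ENNReal.ofReal_add]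
    · apply ENNReal.ofReal_le_ofReal
      calc _ ≤ likelihood ℓ k y θ * _ := mul_le_mul_of_nonneg_left hpath pθ.le
        _ = A y e + (∫ x in a..b, β * (A y x * |sampleScore sc k y x|)) +
            √k * ∫ x in a..b, A y x := by
          rw [mul_add, mul_add, hAL e he, ← intervalIntegral.integral_const_mul, mul_left_comm,
            ← intervalIntegral.integral_const_mul]
          congr 2
          · refine intervalIntegral.integral_congr fun x hx => ?_
            rw [uIcc_of_le hab] at hx
            rw [← hAL x hx]; ring
          · refine intervalIntegral.integral_congr fun x hx => ?_
            rw [uIcc_of_le hab] at hx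
            exact hAL x hx
        _ ≤ _ := by
          rw [intervalIntegral.integral_const_mul, add_assoc]
          have : 0 ≤ ∫ x in a..b, A y x * |sampleScore sc k y x| :=
            intervalIntegral.integral_nonneg hab fun x hx =>
              mul_nonneg (hA0 y x hx) (abs_nonneg _)
          gcongr
          nlinarith
    · exact hA0 y e he
    · exact add_nonneg (intervalIntegral.integral_nonneg hab fun x hx =>
        mul_nonneg (hA0 y x hx) (abs_nonneg _)) (mul_nonneg (Real.sqrt_nonneg _)
        (intervalIntegral.integral_nonneg hab fun x hx => hA0 y x hx))
    · exact intervalIntegral.integral_nonneg hab fun x hx =>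
        mul_nonneg (hA0 y x hx) (abs_nonneg _)
    · exact mul_nonneg (Real.sqrt_nonneg _)
        (intervalIntegral.integral_nonneg hab fun x hx => hA0 y x hx)
  have hexpc : ContinuousOn (fun x => Real.exp (-(c * k * (x - θ) ^ 2))) (Icc a b) := by fun_prop
  have hI0 : 0 ≤ ∫ x in a..b, Real.exp (-(c * k * (x - θ) ^ 2)) :=
    intervalIntegral.integral_nonneg hab fun x _ => (Real.exp_pos _).le
  have hT1 : ∫⁻ y, ENNReal.ofReal (A y e) ∂(Measure.pi fun _ : Fin k => μ) ≤
      ENNReal.ofReal (Real.exp (-(c * k * (e - θ) ^ 2))) :=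
    (haff e (hsub he) θ hθ k).trans (ENNReal.ofReal_le_ofReal (hexp (min_le_left _ _) e))
  have hT2 : ∫⁻ y, (∫⁻ x in Ioc a b, ENNReal.ofReal (A y x * |sampleScore sc k y x|))
      ∂(Measure.pi fun _ : Fin k => μ) ≤
      ENNReal.ofReal (C₂ * (√k * ∫ x in a..b, Real.exp (-(c * k * (x - θ) ^ 2)))) := by
    rw [lintegral_lintegral_swap (hAm.mul (measurable_norm.comp hmS)).ennreal_ofReal.aemeasurable]
    calc _ ≤ ∫⁻ x in Ioc a b, ENNReal.ofReal (C₂ * √k * Real.exp (-(c * k * (x - θ) ^ 2))) := by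
          refine setLIntegral_mono (by fun_prop) fun x hx => ?_
          refine (hsc x (hsub (Ioc_subset_Icc_self hx)) θ hθ k).trans
            (ENNReal.ofReal_le_ofReal ?_)
          exact mul_le_mul_of_nonneg_left (hexp (min_le_right _ _) x) (by positivity)
      _ = _ := by
          rw [← ofReal_intervalIntegral_eq_lintegral
            (f := fun x => C₂ * √k * Real.exp (-(c * k * (x - θ) ^ 2))) hab
            (continuousOn_const.mul hexpc)
            (fun x _ => by positivity), intervalIntegral.integral_const_mul, mul_assoc]
  have hT3 : ∫⁻ y, (ENNReal.ofReal √k * ∫⁻ x in Ioc a b, ENNReal.ofReal (A y x))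
      ∂(Measure.pi fun _ : Fin k => μ) ≤
      ENNReal.ofReal (√k * ∫ x in a..b, Real.exp (-(c * k * (x - θ) ^ 2))) := by
    rw [lintegral_const_mul' _ _ ENNReal.ofReal_ne_top,
      lintegral_lintegral_swap hAm.ennreal_ofReal.aemeasurable,
      ENNReal.ofReal_mul (Real.sqrt_nonneg _)]
    gcongr
    calc _ ≤ ∫⁻ x in Ioc a b, ENNReal.ofReal (Real.exp (-(c * k * (x - θ) ^ 2))) := by
          refine setLIntegral_mono (by fun_prop) fun x hx => ?_
          exact (haff x (hsub (Ioc_subset_Icc_self hx)) θ hθ k).trans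
            (ENNReal.ofReal_le_ofReal (hexp (min_le_left _ _) x))
      _ = _ := (ofReal_intervalIntegral_eq_lintegral hab hexpc
            (fun x _ => by positivity)).symm
  refine (lintegral_mono hpt).trans ?_
  have hAe : Measurable fun y => ENNReal.ofReal (A y e) :=
    (hAm.comp (by fun_prop : Measurable fun y : Fin k → 𝓨 => (y, e))).ennreal_ofReal
  have hAS : Measurable fun y =>
      ∫⁻ x in Ioc a b, ENNReal.ofReal (A y x * |sampleScore sc k y x|) :=
    (hAm.mul (measurable_norm.comp hmS)).ennreal_ofReal.lintegral_prod_right'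
  rw [lintegral_add_left hAe, lintegral_add_left hAS,
    ENNReal.ofReal_add (by positivity) (by positivity), add_one_mul,
    ENNReal.ofReal_add (by positivity) (by positivity)]
  exact add_le_add hT1 (add_le_add hT2 hT3)

end SmoothFamily

end

/-! ### Fractional moments of integrated likelihood ratios in a Gaussian limit -/

lemma abs_rpow_sub_rpow_le {α x y : ℝ} (h0 : 0 < α) (h1 : α ≤ 1) (hx : 0 ≤ x) (hy : 0 ≤ y) :
    |x ^ α - y ^ α| ≤ |x - y| ^ α := by
  have key : ∀ {x y : ℝ}, 0 ≤ y → y ≤ x → |x ^ α - y ^ α| ≤ |x - y| ^ α := by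
    intro x y hy hxy
    have h : x ^ α ≤ (x - y) ^ α + y ^ α := by
      have := Real.rpow_add_le_add_rpow (sub_nonneg.2 hxy) hy h0.le h1
      rwa [sub_add_cancel] at this
    rw [abs_of_nonneg (sub_nonneg.2 (Real.rpow_le_rpow hy hxy h0.le)),
      abs_of_nonneg (sub_nonneg.2 hxy)]
    linarith
  rcases le_total y x with h | h
  · exact key hy h
  · rw [abs_sub_comm, abs_sub_comm x]; exact key hx h

lemma rpow_le_one_add {α x : ℝ} (h0 : 0 < α) (h1 : α ≤ 1) (hx : 0 ≤ x) : x ^ α ≤ 1 + x := by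
  rcases le_total x 1 with h | h
  · have := Real.rpow_le_one hx h h0.le; linarith
  · have := Real.rpow_le_rpow_of_exponent_le h h1
    rw [Real.rpow_one] at this; linarith

lemma integrable_rpow_of_integrable {Ω : Type*} [MeasurableSpace Ω] {P : Measure Ω}
    [IsFiniteMeasure P] {α : ℝ} (h0 : 0 < α) (h1 : α ≤ 1) {X : Ω → ℝ} (hX : Integrable X P)
    (hX0 : ∀ᵐ ω ∂P, 0 ≤ X ω) : Integrable (fun ω => X ω ^ α) P := by
  refine ((integrable_const (1 : ℝ)).add hX).mono'
    (hX.aestronglyMeasurable.aemeasurable.pow_const α).aestronglyMeasurable ?_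
  filter_upwards [hX0] with ω hω
  rw [Real.norm_of_nonneg (by positivity)]
  exact rpow_le_one_add h0 h1 hω

/-- Jensen's inequality for concave powers. -/
lemma integral_rpow_le_rpow_integral {Ω : Type*} [MeasurableSpace Ω] {P : Measure Ω}
    [IsProbabilityMeasure P] {α : ℝ} (h0 : 0 < α) (h1 : α ≤ 1) {X : Ω → ℝ} (hX : Integrable X P)
    (hX0 : ∀ᵐ ω ∂P, 0 ≤ X ω) : ∫ ω, X ω ^ α ∂P ≤ (∫ ω, X ω ∂P) ^ α :=
  (Real.concaveOn_rpow h0.le h1).le_map_integral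
    (Real.continuous_rpow_const h0.le).continuousOn isClosed_Ici hX0 hX
    (integrable_rpow_of_integrable h0 h1 hX hX0)

/-- Likelihood ratio of the Gaussian shift experiment at the local parameter `h`. -/
noncomputable def gaussRatio (h z : ℝ) : ℝ := Real.exp (h * z - h ^ 2 / 2)

lemma gaussRatio_pos (h z : ℝ) : 0 < gaussRatio h z := Real.exp_pos _

lemma continuous_gaussRatio : Continuous fun p : ℝ × ℝ => gaussRatio p.1 p.2 := by
  unfold gaussRatio; fun_prop

/-- The Gaussian likelihood ratio, truncated in size and integrated over a bounded window. -/
noncomputable def truncRatio (H N z : ℝ) : ℝ := ∫ h in Ioo (-H) H, min (gaussRatio h z) N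

/-- The constant of the asymptotic expansion of the `α`-mutual information. -/
noncomputable def limitConst (α : ℝ) : ℝ :=
  ∫ z, (∫ h, gaussRatio h z) ^ α ∂(ProbabilityTheory.gaussianReal 0 1)

lemma integrable_min_window {H N z : ℝ} (hN : 0 < N) :
    IntegrableOn (fun h => min (gaussRatio h z) N) (Ioo (-H) H) := by
  refine Integrable.mono' (g := fun _ => N) (integrable_const _) ?_
    (Eventually.of_forall fun h => ?_)
  · unfold gaussRatio; fun_prop
  · rw [Real.norm_of_nonneg (le_min (gaussRatio_pos _ _).le hN.le)]
    exact min_le_right _ _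

lemma truncRatio_nonneg {H N : ℝ} (hN : 0 < N) (z : ℝ) : 0 ≤ truncRatio H N z :=
  integral_nonneg fun h => le_min (gaussRatio_pos h z).le hN.le

lemma truncRatio_le {H N : ℝ} (hH : 0 ≤ H) (hN : 0 < N) (z : ℝ) :
    truncRatio H N z ≤ 2 * H * N := by
  calc truncRatio H N z ≤ ∫ h in Ioo (-H) H, N :=
        integral_mono (integrable_min_window hN) (integrable_const _) fun h => min_le_right _ _
    _ = 2 * H * N := by
        rw [setIntegral_const, Measure.real, Real.volume_Ioo, ENNReal.toReal_ofReal (by linarith),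
          smul_eq_mul]
        ring

lemma continuous_truncRatio {H N : ℝ} (hN : 0 < N) : Continuous (truncRatio H N) := by
  unfold truncRatio
  refine continuous_of_dominated (bound := fun _ => N) (fun z => ?_) (fun z => ?_)
    (integrable_const _) ?_
  · exact (integrable_min_window hN).aestronglyMeasurable
  · refine Eventually.of_forall fun h => ?_
    rw [Real.norm_of_nonneg (le_min (gaussRatio_pos _ _).le hN.le)]
    exact min_le_right _ _
  · refine Eventually.of_forall fun h => ?_
    unfold gaussRatio; fun_prop

/-- Comparison of the `α`-th moment of an integrated likelihood ratio with its truncated Gaussian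
counterpart, on one probability space. -/
lemma moment_diff_le {Ω : Type*} [MeasurableSpace Ω] {P : Measure Ω} [IsProbabilityMeasure P]
    {L : ℝ → Ω → ℝ} {Δ : Ω → ℝ} {q : ℝ → ℝ} {Q B H N α : ℝ} (h0 : 0 < α) (h1 : α < 1)
    (hH : 0 ≤ H) (hN : 0 < N) (hLm : Measurable fun p : ℝ × Ω => L p.1 p.2)
    (hL0 : ∀ h ω, 0 ≤ L h ω) (hLint : Integrable (fun p : ℝ × Ω => L p.1 p.2) (volume.prod P))
    (hL1 : ∀ h, Integrable (L h) P ∧ ∫ ω, L h ω ∂P ≤ 1) (hΔ : Measurable Δ)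
    (hqm : Measurable q) (hq0 : ∀ h, 0 ≤ q h) (hqB : ∀ h, q h ≤ B) (hQ0 : 0 ≤ Q) (hQB : Q ≤ B) :
    |∫ ω, (∫ h, q h * L h ω) ^ α ∂P - ∫ ω, (Q * truncRatio H N (Δ ω)) ^ α ∂P| ≤
      B ^ α * ∫ ω, (∫ h in (Ioo (-H) H)ᶜ, L h ω) ^ α ∂P +
      (∫ h in Ioo (-H) H, (B * (1 - ∫ ω, min (gaussRatio h (Δ ω)) N ∂P) +
        2 * B * (∫ ω, |min (L h ω) N - min (gaussRatio h (Δ ω)) N| ∂P) + N * |q h - Q|)) ^ α := by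
  have hB : 0 ≤ B := hQ0.trans hQB
  set W := Ioo (-H) H with hW
  have hWm : MeasurableSet W := measurableSet_Ioo
  have hGm : Measurable fun p : ℝ × Ω => gaussRatio p.1 (Δ p.2) :=
    continuous_gaussRatio.measurable.comp (by fun_prop : Measurable fun p : ℝ × Ω => (p.1, Δ p.2))
  have hminG : ∀ h z, 0 ≤ min (gaussRatio h z) N := fun h z => le_min (gaussRatio_pos h z).le hN.le
  have hminL : ∀ h ω, 0 ≤ min (L h ω) N := fun h ω => le_min (hL0 h ω) hN.le
  -- integrability over the window
  have hLW : Integrable (fun p : ℝ × Ω => L p.1 p.2) ((volume.restrict W).prod P) := by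
    have := hLint.integrableOn (s := W ×ˢ univ)
    rwa [IntegrableOn, ← Measure.prod_restrict, Measure.restrict_univ] at this
  have hminLW : Integrable (fun p : ℝ × Ω => min (L p.1 p.2) N) ((volume.restrict W).prod P) :=
    Integrable.mono' (g := fun _ => N) (integrable_const _)
      (hLm.min measurable_const).aestronglyMeasurable (Eventually.of_forall fun p => by
        rw [Real.norm_of_nonneg (hminL _ _)]; exact min_le_right _ _)
  have hminGW : Integrable (fun p : ℝ × Ω => min (gaussRatio p.1 (Δ p.2)) N)
      ((volume.restrict W).prod P) :=
    Integrable.mono' (g := fun _ => N) (integrable_const _)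
      (hGm.min measurable_const).aestronglyMeasurable (Eventually.of_forall fun p => by
        rw [Real.norm_of_nonneg (hminG _ _)]; exact min_le_right _ _)
  have hqW : Integrable (fun p : ℝ × Ω => N * |q p.1 - Q|) ((volume.restrict W).prod P) := by
    refine Integrable.mono' (g := fun _ => N * B) (integrable_const _)
      ((measurable_norm.comp ((hqm.comp measurable_fst).sub_const Q)).const_mul
        N).aestronglyMeasurable (Eventually.of_forall fun p => ?_)
    rw [Real.norm_of_nonneg (by positivity)]
    gcongr
    rw [abs_le]; constructor <;> linarith [hq0 p.1, hqB p.1]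
  -- the three errors in the window: mass above the truncation level `N`, variation of `q`, and
  -- difference of the truncated ratios
  set sf : ℝ × Ω → ℝ := fun p => B * (L p.1 p.2 - min (L p.1 p.2) N) + N * |q p.1 - Q| +
    B * |min (L p.1 p.2) N - min (gaussRatio p.1 (Δ p.2)) N| with hsf
  have hsfW : Integrable sf ((volume.restrict W).prod P) :=
    (((hLW.sub hminLW).const_mul B).add hqW).add ((hminLW.sub hminGW).abs.const_mul B)
  have hsf0 : ∀ p, 0 ≤ sf p := fun p => by
    have := sub_nonneg.2 (min_le_left (L p.1 p.2) N)
    positivity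
  set X : Ω → ℝ := fun ω => ∫ h, q h * L h ω with hX
  set Y : Ω → ℝ := fun ω => Q * truncRatio H N (Δ ω) with hY
  set T : Ω → ℝ := fun ω => ∫ h in Wᶜ, L h ω with hT
  set S : Ω → ℝ := fun ω => ∫ h in W, sf (h, ω) with hS
  have hLsec : ∀ᵐ ω ∂P, Integrable fun h => L h ω := hLint.prod_left_ae
  have hsfsec : ∀ᵐ ω ∂P, Integrable (fun h => sf (h, ω)) (volume.restrict W) :=
    hsfW.prod_left_ae
  have hqL : Integrable (fun p : ℝ × Ω => q p.1 * L p.1 p.2) (volume.prod P) := by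
    refine (hLint.const_mul B).mono' ((hqm.comp measurable_fst).mul hLm).aestronglyMeasurable
      (Eventually.of_forall fun p => ?_)
    rw [Real.norm_of_nonneg (mul_nonneg (hq0 _) (hL0 _ _))]
    exact mul_le_mul_of_nonneg_right (hqB _) (hL0 _ _)
  have hXi : Integrable X P := hqL.integral_prod_right
  have hSi : Integrable S P := hsfW.integral_prod_right
  have hTi : Integrable T P := by
    have : Integrable (fun p : ℝ × Ω => L p.1 p.2) ((volume.restrict Wᶜ).prod P) := by
      have := hLint.integrableOn (s := Wᶜ ×ˢ univ)
      rwa [IntegrableOn, ← Measure.prod_restrict, Measure.restrict_univ] at this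
    exact this.integral_prod_right
  have hX0 : ∀ ω, 0 ≤ X ω := fun ω => integral_nonneg fun h => mul_nonneg (hq0 h) (hL0 h ω)
  have hY0 : ∀ ω, 0 ≤ Y ω := fun ω => mul_nonneg hQ0 (truncRatio_nonneg hN _)
  have hT0 : ∀ ω, 0 ≤ T ω := fun ω => integral_nonneg fun h => hL0 h ω
  have hS0 : ∀ ω, 0 ≤ S ω := fun ω => integral_nonneg fun h => hsf0 (h, ω)
  have hYi : Integrable Y P := by
    refine Integrable.mono' (g := fun _ => Q * (2 * H * N)) (integrable_const _)
      ((continuous_truncRatio hN).measurable.comp hΔ |>.const_mul Q).aestronglyMeasurable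
      (Eventually.of_forall fun ω => ?_)
    rw [Real.norm_of_nonneg (hY0 ω)]
    exact mul_le_mul_of_nonneg_left (truncRatio_le hH hN _) hQ0
  have hXα := integrable_rpow_of_integrable h0 h1.le hXi (Eventually.of_forall hX0)
  have hYα := integrable_rpow_of_integrable h0 h1.le hYi (Eventually.of_forall hY0)
  have hTα := integrable_rpow_of_integrable h0 h1.le hTi (Eventually.of_forall hT0)
  have hSα := integrable_rpow_of_integrable h0 h1.le hSi (Eventually.of_forall hS0)
  have hdiff : ∀ᵐ ω ∂P, |X ω ^ α - Y ω ^ α| ≤ B ^ α * T ω ^ α + S ω ^ α := by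
    filter_upwards [hLsec, hsfsec] with ω hLω hsω
    have hqLω : Integrable fun h => q h * L h ω := by
      refine (hLω.const_mul B).mono' (hqm.aestronglyMeasurable.mul hLω.aestronglyMeasurable)
        (Eventually.of_forall fun h => ?_)
      rw [Real.norm_of_nonneg (mul_nonneg (hq0 _) (hL0 _ _))]
      exact mul_le_mul_of_nonneg_right (hqB _) (hL0 _ _)
    have hXY : |X ω - Y ω| ≤ B * T ω + S ω := by
      have e : X ω - Y ω = (∫ h in Wᶜ, q h * L h ω) +
          ∫ h in W, (q h * L h ω - Q * min (gaussRatio h (Δ ω)) N) := by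
        rw [integral_sub hqLω.integrableOn ((integrable_min_window hN).const_mul Q),
          integral_const_mul, hX, hY]
        simp only
        rw [← integral_add_compl hWm hqLω, truncRatio]
        ring
      rw [e]
      refine (abs_add_le _ _).trans (add_le_add ?_ ?_)
      · rw [abs_of_nonneg (integral_nonneg fun h => mul_nonneg (hq0 h) (hL0 h ω)), hT]
        simp only
        rw [← integral_const_mul]
        exact integral_mono hqLω.integrableOn (hLω.integrableOn.const_mul B) fun h =>
          mul_le_mul_of_nonneg_right (hqB _) (hL0 _ _)
      · refine abs_integral_le_integral_abs.trans (integral_mono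
          (hqLω.integrableOn.sub ((integrable_min_window hN).const_mul Q)).abs hsω fun h => ?_)
        simp only [hsf]
        have a1 := sub_nonneg.2 (min_le_left (L h ω) N)
        have a2 := hminL h ω
        have a3 := min_le_right (L h ω) N
        calc |q h * L h ω - Q * min (gaussRatio h (Δ ω)) N|
            = |q h * (L h ω - min (L h ω) N) + (q h - Q) * min (L h ω) N +
                Q * (min (L h ω) N - min (gaussRatio h (Δ ω)) N)| := by congr 1; ring
          _ ≤ |q h * (L h ω - min (L h ω) N)| + |(q h - Q) * min (L h ω) N| +
                |Q * (min (L h ω) N - min (gaussRatio h (Δ ω)) N)| :=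
              (abs_add_le _ _).trans (add_le_add (abs_add_le _ _) le_rfl)
          _ ≤ _ := by
              rw [abs_mul, abs_mul, abs_mul, abs_of_nonneg (hq0 h), abs_of_nonneg a1,
                abs_of_nonneg a2, abs_of_nonneg hQ0, mul_comm N]
              gcongr
              exact hqB h
    calc |X ω ^ α - Y ω ^ α| ≤ |X ω - Y ω| ^ α := abs_rpow_sub_rpow_le h0 h1.le (hX0 ω) (hY0 ω)
      _ ≤ (B * T ω + S ω) ^ α := by gcongr
      _ ≤ (B * T ω) ^ α + S ω ^ α :=
          Real.rpow_add_le_add_rpow (mul_nonneg hB (hT0 ω)) (hS0 ω) h0.le h1.le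
      _ = _ := by rw [Real.mul_rpow hB (hT0 ω)]
  have hSint : ∫ ω, S ω ∂P ≤ ∫ h in W, (B * (1 - ∫ ω, min (gaussRatio h (Δ ω)) N ∂P) +
        2 * B * (∫ ω, |min (L h ω) N - min (gaussRatio h (Δ ω)) N| ∂P) + N * |q h - Q|) := by
    have hswap : ∫ ω, S ω ∂P = ∫ h in W, ∫ ω, sf (h, ω) ∂P :=
      (integral_integral_swap (f := fun h ω => sf (h, ω)) hsfW).symm
    rw [hswap]
    refine integral_mono hsfW.integral_prod_left ?_ fun h => ?_
    · exact ((((integrable_const (1 : ℝ)).sub hminGW.integral_prod_left).const_mul B).add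
        ((hminLW.sub hminGW).abs.integral_prod_left.const_mul (2 * B))).add
        (by simpa using hqW.integral_prod_left)
    · have i1 := (hL1 h).1
      have i2 : Integrable (fun ω => min (L h ω) N) P :=
        Integrable.mono' (g := fun _ => N) (integrable_const _)
          ((hLm.comp (by fun_prop : Measurable fun ω : Ω => (h, ω))).min
            measurable_const).aestronglyMeasurable (Eventually.of_forall fun p => by
            rw [Real.norm_of_nonneg (hminL _ _)]; exact min_le_right _ _)
      have i3 : Integrable (fun ω => min (gaussRatio h (Δ ω)) N) P :=
        Integrable.mono' (g := fun _ => N) (integrable_const _)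
          ((hGm.comp (by fun_prop : Measurable fun ω : Ω => (h, ω))).min
            measurable_const).aestronglyMeasurable (Eventually.of_forall fun p => by
            rw [Real.norm_of_nonneg (hminG _ _)]; exact min_le_right _ _)
      have i4 : Integrable (fun ω => |min (L h ω) N - min (gaussRatio h (Δ ω)) N|) P :=
        (i2.sub i3).abs
      have e : ∫ ω, sf (h, ω) ∂P = B * ((∫ ω, L h ω ∂P) - ∫ ω, min (L h ω) N ∂P) +
          N * |q h - Q| + B * ∫ ω, |min (L h ω) N - min (gaussRatio h (Δ ω)) N| ∂P := by
        simp only [hsf]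
        have j1 : Integrable (fun ω => B * (L h ω - min (L h ω) N)) P := (i1.sub i2).const_mul B
        have j2 : Integrable (fun _ : Ω => N * |q h - Q|) P := integrable_const _
        have j3 : Integrable (fun ω => B * (L h ω - min (L h ω) N) + N * |q h - Q|) P :=
          j1.add j2
        rw [integral_add j3 (i4.const_mul B), integral_add j1 j2, integral_const_mul,
          integral_sub i1 i2, integral_const, integral_const_mul]
        simp
      -- together with `∫ L ≤ 1` this bounds the mass of `L` above the level `N`
      have hlow : ∫ ω, min (gaussRatio h (Δ ω)) N ∂P -
          ∫ ω, |min (L h ω) N - min (gaussRatio h (Δ ω)) N| ∂P ≤ ∫ ω, min (L h ω) N ∂P := by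
        rw [← integral_sub i3 i4]
        refine integral_mono (i3.sub i4) i2 fun ω => ?_
        have := neg_abs_le (min (L h ω) N - min (gaussRatio h (Δ ω)) N)
        simp only; linarith
      have hone := (hL1 h).2
      simp only
      rw [e]
      nlinarith
  calc |∫ ω, X ω ^ α ∂P - ∫ ω, Y ω ^ α ∂P| = |∫ ω, (X ω ^ α - Y ω ^ α) ∂P| := by
        rw [integral_sub hXα hYα]
    _ ≤ ∫ ω, |X ω ^ α - Y ω ^ α| ∂P := abs_integral_le_integral_abs
    _ ≤ ∫ ω, (B ^ α * T ω ^ α + S ω ^ α) ∂P :=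
        integral_mono_ae (hXα.sub hYα).abs ((hTα.const_mul _).add hSα) hdiff
    _ = B ^ α * ∫ ω, T ω ^ α ∂P + ∫ ω, S ω ^ α ∂P := by
        rw [integral_add (hTα.const_mul _) hSα, integral_const_mul]
    _ ≤ _ := by
        gcongr
        exact (integral_rpow_le_rpow_integral h0 h1.le hSi (Eventually.of_forall hS0)).trans
          (Real.rpow_le_rpow (integral_nonneg hS0) hSint h0.le)

lemma gaussRatio_eq (h z : ℝ) :
    gaussRatio h z = Real.exp (z ^ 2 / 2) * Real.exp (-(1 / 2) * (h - z) ^ 2) := by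
  rw [gaussRatio, ← Real.exp_add]; congr 1; ring

lemma integrable_gaussRatio (z : ℝ) : Integrable fun h => gaussRatio h z := by
  simp_rw [gaussRatio_eq]
  exact ((integrable_exp_neg_mul_sq (by norm_num : (0 : ℝ) < 1 / 2)).comp_sub_right z).const_mul _

lemma integral_gaussRatio (z : ℝ) :
    ∫ h, gaussRatio h z = √(2 * Real.pi) * Real.exp (z ^ 2 / 2) := by
  simp_rw [gaussRatio_eq]
  rw [integral_const_mul, integral_sub_right_eq_self (fun x => Real.exp (-(1 / 2) * x ^ 2)) z,
    integral_gaussian, mul_comm]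
  congr 2; ring

lemma integrable_gaussRatio_right (h : ℝ) :
    Integrable (gaussRatio h) (ProbabilityTheory.gaussianReal 0 1) := by
  have := (ProbabilityTheory.integrable_exp_mul_gaussianReal (μ := 0) (v := 1) h).mul_const
    (Real.exp (-(h ^ 2 / 2)))
  refine this.congr (Eventually.of_forall fun z => ?_)
  simp only [gaussRatio]
  rw [← Real.exp_add, sub_eq_add_neg]

lemma integral_gaussRatio_right (h : ℝ) :
    ∫ z, gaussRatio h z ∂(ProbabilityTheory.gaussianReal 0 1) = 1 := by
  have e : ∀ z, gaussRatio h z = Real.exp (h * z) * Real.exp (-(h ^ 2 / 2)) := fun z => by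
    rw [gaussRatio, ← Real.exp_add, sub_eq_add_neg]
  simp_rw [e]
  rw [integral_mul_const]
  have := congrFun (ProbabilityTheory.mgf_id_gaussianReal (μ := 0) (v := 1)) h
  simp only [ProbabilityTheory.mgf, id_eq] at this
  rw [this, ← Real.exp_add]
  simp

lemma integrable_rpow_integral_gaussRatio {α : ℝ} (h1 : α < 1) :
    Integrable (fun z => (∫ h, gaussRatio h z) ^ α) (ProbabilityTheory.gaussianReal 0 1) := by
  simp_rw [integral_gaussRatio]
  rw [ProbabilityTheory.gaussianReal_of_var_ne_zero _ one_ne_zero,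
    integrable_withDensity_iff (ProbabilityTheory.measurable_gaussianPDF 0 1)
      (Eventually.of_forall fun _ => ProbabilityTheory.gaussianPDF_lt_top)]
  simp_rw [ProbabilityTheory.toReal_gaussianPDF, ProbabilityTheory.gaussianPDFReal]
  have hi := (integrable_exp_neg_mul_sq (by linarith : 0 < (1 - α) / 2)).const_mul
    ((√(2 * Real.pi)) ^ α * (√(2 * Real.pi * (1 : NNReal)))⁻¹)
  refine hi.congr (Eventually.of_forall fun z => ?_)
  simp only
  rw [Real.mul_rpow (by positivity) (by positivity), ← Real.exp_mul]
  have : Real.exp (-((1 - α) / 2) * z ^ 2) = Real.exp (z ^ 2 / 2 * α) *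
      Real.exp (-(z - 0) ^ 2 / (2 * (1 : NNReal))) := by
    rw [← Real.exp_add]; congr 1; push_cast; ring
  rw [this]; ring

lemma limitConst_pos {α : ℝ} (h1 : α < 1) : 0 < limitConst α := by
  have hp : ∀ z, 0 < (∫ h, gaussRatio h z) ^ α := fun z => by
    rw [integral_gaussRatio]; positivity
  refine (integral_pos_iff_support_of_nonneg (fun z => (hp z).le)
    (integrable_rpow_integral_gaussRatio h1)).2 ?_
  have : Function.support (fun z => (∫ h, gaussRatio h z) ^ α) = univ :=
    eq_univ_of_forall fun z => (hp z).ne'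
  rw [this, measure_univ]
  exact one_pos

lemma tendsto_min_natCast (x : ℝ) {u : ℕ → ℕ} (hu : Tendsto u atTop atTop) :
    Tendsto (fun n => min x (u n : ℝ)) atTop (𝓝 x) := by
  refine tendsto_const_nhds.congr' ?_
  filter_upwards [(tendsto_natCast_atTop_atTop.comp hu).eventually_ge_atTop x] with n hn
  exact (min_eq_left hn).symm

/-- The truncation levels of the window of half-width `H` can be chosen so large that the
truncated Gaussian likelihood ratios lose almost no mass. -/
lemma exists_truncation : ∃ u : ℕ → ℕ, (∀ H, H + 1 ≤ u H) ∧ ∀ H : ℕ,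
    ∫ h in Ioo (-(H : ℝ)) H,
      (1 - ∫ z, min (gaussRatio h z) (u H) ∂(ProbabilityTheory.gaussianReal 0 1)) <
        1 / ((H : ℝ) + 1) := by
  have key : ∀ H : ℕ, ∃ N : ℕ, H + 1 ≤ N ∧ ∫ h in Ioo (-(H : ℝ)) H,
      (1 - ∫ z, min (gaussRatio h z) N ∂(ProbabilityTheory.gaussianReal 0 1)) <
        1 / ((H : ℝ) + 1) := by
    intro H
    have hlim : Tendsto (fun N : ℕ => ∫ h in Ioo (-(H : ℝ)) H,
        (1 - ∫ z, min (gaussRatio h z) N ∂(ProbabilityTheory.gaussianReal 0 1))) atTop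
        (𝓝 (∫ h in Ioo (-(H : ℝ)) H, (0 : ℝ))) := by
      refine tendsto_integral_of_dominated_convergence (fun _ => 1) (fun N => ?_)
        (integrable_const _) (fun N => Eventually.of_forall fun h => ?_)
        (Eventually.of_forall fun h => ?_)
      · refine (measurable_const.sub (StronglyMeasurable.measurable ?_)).aestronglyMeasurable
        exact (continuous_gaussRatio.min continuous_const).stronglyMeasurable.integral_prod_right'
          (f := fun p : ℝ × ℝ => min (gaussRatio p.1 p.2) N)
      · have h0 : 0 ≤ ∫ z, min (gaussRatio h z) N ∂(ProbabilityTheory.gaussianReal 0 1) :=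
          integral_nonneg fun z => le_min (gaussRatio_pos h z).le (Nat.cast_nonneg N)
        have h1 : ∫ z, min (gaussRatio h z) N ∂(ProbabilityTheory.gaussianReal 0 1) ≤ 1 := by
          rw [← integral_gaussRatio_right h]
          refine integral_mono_of_nonneg (Eventually.of_forall fun z =>
            le_min (gaussRatio_pos h z).le (Nat.cast_nonneg N)) (integrable_gaussRatio_right h)
            (Eventually.of_forall fun z => min_le_left _ _)
        rw [Real.norm_of_nonneg (by linarith)]
        linarith
      · have : Tendsto (fun N : ℕ => ∫ z, min (gaussRatio h z) N
            ∂(ProbabilityTheory.gaussianReal 0 1)) atTop (𝓝 1) := by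
          rw [← integral_gaussRatio_right h]
          refine tendsto_integral_of_dominated_convergence (gaussRatio h) (fun N => ?_)
            (integrable_gaussRatio_right h) (fun N => Eventually.of_forall fun z => ?_)
            (Eventually.of_forall fun z => ?_)
          · exact ((integrable_gaussRatio_right h).aestronglyMeasurable.inf
              aestronglyMeasurable_const)
          · rw [Real.norm_of_nonneg (le_min (gaussRatio_pos h z).le (Nat.cast_nonneg N))]
            exact min_le_left _ _
          · exact tendsto_min_natCast _ tendsto_id
        simpa using (tendsto_const_nhds (x := (1 : ℝ))).sub this
    rw [integral_zero] at hlim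
    have hpos : (0 : ℝ) < 1 / ((H : ℝ) + 1) := by positivity
    obtain ⟨N, hN⟩ := ((hlim.eventually_lt_const hpos).and (eventually_ge_atTop (H + 1))).exists
    exact ⟨N, hN.2, hN.1⟩
  choose u hu using key
  exact ⟨u, fun H => (hu H).1, fun H => (hu H).2⟩

lemma tendsto_truncRatio {u : ℕ → ℕ} (hu : ∀ H, H + 1 ≤ u H) (z : ℝ) :
    Tendsto (fun H : ℕ => truncRatio H (u H) z) atTop (𝓝 (∫ h, gaussRatio h z)) := by
  have hut : Tendsto u atTop atTop :=
    tendsto_atTop_mono (fun H => (Nat.le_succ H).trans (hu H)) tendsto_id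
  simp_rw [truncRatio, ← integral_indicator measurableSet_Ioo]
  have hle : ∀ (H : ℕ) (h : ℝ), 0 ≤ min (gaussRatio h z) (u H) := fun H h =>
    le_min (gaussRatio_pos h z).le (Nat.cast_nonneg _)
  refine tendsto_integral_of_dominated_convergence (fun h => gaussRatio h z) (fun H => ?_)
    (integrable_gaussRatio z) (fun H => Eventually.of_forall fun h => ?_)
    (Eventually.of_forall fun h => ?_)
  · exact ((integrable_gaussRatio z).aestronglyMeasurable.inf
      aestronglyMeasurable_const).indicator measurableSet_Ioo
  · rw [Real.norm_of_nonneg (indicator_nonneg (fun h _ => hle H h) h)]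
    exact (indicator_le_self' (fun h _ => hle H h) h).trans (min_le_left _ _)
  · refine (tendsto_min_natCast _ hut).congr' ?_
    filter_upwards [tendsto_natCast_atTop_atTop.eventually_gt_atTop |h|] with H hH
    rw [indicator_of_mem]
    exact abs_lt.1 hH

lemma tendsto_integral_rpow_truncRatio {u : ℕ → ℕ} (hu : ∀ H, H + 1 ≤ u H) {α Q : ℝ}
    (h0 : 0 < α) (h1 : α < 1) (hQ : 0 ≤ Q) :
    Tendsto (fun H : ℕ => ∫ z, (Q * truncRatio H (u H) z) ^ α
      ∂(ProbabilityTheory.gaussianReal 0 1)) atTop (𝓝 (Q ^ α * limitConst α)) := by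
  have hu0 : ∀ H, (0 : ℝ) < u H := fun H => by
    have := hu H; exact_mod_cast (by omega : 0 < u H)
  have e : ∀ H : ℕ, ∫ z, (Q * truncRatio H (u H) z) ^ α ∂(ProbabilityTheory.gaussianReal 0 1) =
      Q ^ α * ∫ z, (truncRatio H (u H) z) ^ α ∂(ProbabilityTheory.gaussianReal 0 1) := by
    intro H
    rw [← integral_const_mul]
    congr 1; ext z
    rw [Real.mul_rpow hQ (truncRatio_nonneg (hu0 H) z)]
  simp_rw [e]
  refine Tendsto.const_mul _ ?_
  refine tendsto_integral_of_dominated_convergence (fun z => (∫ h, gaussRatio h z) ^ α)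
    (fun H => ?_) (integrable_rpow_integral_gaussRatio h1)
    (fun H => Eventually.of_forall fun z => ?_) (Eventually.of_forall fun z => ?_)
  · exact ((continuous_truncRatio (hu0 H)).measurable.pow_const α).aestronglyMeasurable
  · have hn := truncRatio_nonneg (H := H) (hu0 H) z
    rw [Real.norm_of_nonneg (by positivity)]
    refine Real.rpow_le_rpow hn ?_ h0.le
    calc truncRatio H (u H) z ≤ ∫ h in Ioo (-(H : ℝ)) H, gaussRatio h z :=
          integral_mono (integrable_min_window (hu0 H)) (integrable_gaussRatio z).integrableOn
            fun h => min_le_left _ _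
      _ ≤ _ := setIntegral_le_integral (integrable_gaussRatio z)
            (Eventually.of_forall fun h => (gaussRatio_pos h z).le)
  · exact (tendsto_truncRatio hu z).rpow_const (Or.inr h0.le)

/-- Convergence of fractional moments of integrated likelihood ratios under local asymptotic
normality: a central limit theorem for `Δ`, the pointwise expansion `L h ≈ exp (h Δ - h² / 2)`
for truncated ratios, and a moment bound for the contribution of large `h` suffice. -/
theorem tendsto_integral_rpow_of_locallyGaussian {Ω : ℕ → Type*} [∀ k, MeasurableSpace (Ω k)]
    {P : ∀ k, Measure (Ω k)} [∀ k, IsProbabilityMeasure (P k)] {L : ∀ k, ℝ → Ω k → ℝ}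
    {Δ : ∀ k, Ω k → ℝ} {q : ℕ → ℝ → ℝ} {Q B α : ℝ} (h0 : 0 < α) (h1 : α < 1)
    (hLm : ∀ k, Measurable fun p : ℝ × Ω k => L k p.1 p.2) (hL0 : ∀ k h ω, 0 ≤ L k h ω)
    (hLint : ∀ k, Integrable (fun p : ℝ × Ω k => L k p.1 p.2) (volume.prod (P k)))
    (hL1 : ∀ k h, Integrable (L k h) (P k) ∧ ∫ ω, L k h ω ∂(P k) ≤ 1)
    (hΔ : ∀ k, Measurable (Δ k))
    (hclt : ∀ Φ : ℝ → ℝ, Continuous Φ → (∃ M, ∀ x, |Φ x| ≤ M) →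
      Tendsto (fun k => ∫ ω, Φ (Δ k ω) ∂(P k)) atTop
        (𝓝 (∫ z, Φ z ∂(ProbabilityTheory.gaussianReal 0 1))))
    (hlan : ∀ h N, 0 < N → Tendsto (fun k => ∫ ω, |min (L k h ω) N -
      min (gaussRatio h (Δ k ω)) N| ∂(P k)) atTop (𝓝 0))
    {ε : ℕ → ℝ} (hε : Tendsto ε atTop (𝓝 0))
    (htail : ∀ H : ℕ, ∀ᶠ k in atTop,
      ∫ ω, (∫ h in (Ioo (-(H : ℝ)) H)ᶜ, L k h ω) ^ α ∂(P k) ≤ ε H)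
    (hqm : ∀ k, Measurable (q k)) (hq0 : ∀ k h, 0 ≤ q k h) (hqB : ∀ k h, q k h ≤ B)
    (hqQ : ∀ h, Tendsto (fun k => q k h) atTop (𝓝 Q)) :
    Tendsto (fun k => ∫ ω, (∫ h, q k h * L k h ω) ^ α ∂(P k)) atTop
      (𝓝 (Q ^ α * limitConst α)) := by
  have hQ0 : 0 ≤ Q := ge_of_tendsto' (hqQ 0) fun k => hq0 k 0
  have hQB : Q ≤ B := le_of_tendsto' (hqQ 0) fun k => hqB k 0
  have hB : 0 ≤ B := hQ0.trans hQB
  obtain ⟨u, hu, hδ⟩ := exists_truncation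
  have hu0 : ∀ H, (0 : ℝ) < u H := fun H => by
    have := hu H; exact_mod_cast (by omega : 0 < u H)
  -- the window error, for a fixed window
  have hwin : ∀ H : ℕ, Tendsto (fun k => ∫ h in Ioo (-(H : ℝ)) H,
      (B * (1 - ∫ ω, min (gaussRatio h (Δ k ω)) (u H) ∂(P k)) +
        2 * B * (∫ ω, |min (L k h ω) (u H) - min (gaussRatio h (Δ k ω)) (u H)| ∂(P k)) +
        u H * |q k h - Q|)) atTop (𝓝 (∫ h in Ioo (-(H : ℝ)) H,
          B * (1 - ∫ z, min (gaussRatio h z) (u H) ∂(ProbabilityTheory.gaussianReal 0 1)))) := by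
    intro H
    have hGm : ∀ k, Measurable fun p : ℝ × Ω k => min (gaussRatio p.1 (Δ k p.2)) (u H : ℝ) :=
      fun k => (continuous_gaussRatio.measurable.comp
        (measurable_fst.prodMk ((hΔ k).comp measurable_snd))).min measurable_const
    have hmin0 : ∀ h z, 0 ≤ min (gaussRatio h z) (u H : ℝ) := fun h z =>
      le_min (gaussRatio_pos h z).le (hu0 H).le
    have hle : ∀ k h, ‖∫ ω, min (gaussRatio h (Δ k ω)) (u H) ∂(P k)‖ ≤ u H := by
      intro k h
      have := norm_integral_le_of_norm_le_const (μ := P k) (C := (u H : ℝ))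
        (f := fun ω => min (gaussRatio h (Δ k ω)) (u H : ℝ)) (Eventually.of_forall fun ω => by
          rw [Real.norm_of_nonneg (hmin0 _ _)]; exact min_le_right _ _)
      simpa using this
    have hle2 : ∀ k h, ‖∫ ω, |min (L k h ω) (u H : ℝ) - min (gaussRatio h (Δ k ω)) (u H)|
        ∂(P k)‖ ≤ u H := by
      intro k h
      have := norm_integral_le_of_norm_le_const (μ := P k) (C := (u H : ℝ))
        (f := fun ω => |min (L k h ω) (u H : ℝ) - min (gaussRatio h (Δ k ω)) (u H : ℝ)|)
        (Eventually.of_forall fun ω => by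
          have a1 := hmin0 h (Δ k ω)
          have a2 : 0 ≤ min (L k h ω) (u H : ℝ) := le_min (hL0 k h ω) (hu0 H).le
          have a3 := min_le_right (gaussRatio h (Δ k ω)) (u H : ℝ)
          have a4 := min_le_right (L k h ω) (u H : ℝ)
          rw [Real.norm_eq_abs, abs_abs, abs_le]
          constructor <;> linarith)
      simpa using this
    refine tendsto_integral_of_dominated_convergence
      (fun _ => B * (1 + u H) + 2 * B * u H + u H * B) (fun k => ?_) (integrable_const _)
      (fun k => Eventually.of_forall fun h => ?_) (Eventually.of_forall fun h => ?_)
    · have m1 : Measurable fun h => ∫ ω, min (gaussRatio h (Δ k ω)) (u H : ℝ) ∂(P k) :=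
        ((hGm k).stronglyMeasurable.integral_prod_right').measurable
      have m2 : Measurable fun h =>
          ∫ ω, |min (L k h ω) (u H : ℝ) - min (gaussRatio h (Δ k ω)) (u H)| ∂(P k) :=
        ((measurable_norm.comp (((hLm k).min measurable_const).sub
          (hGm k))).stronglyMeasurable.integral_prod_right'
          (f := fun p : ℝ × Ω k => |min (L k p.1 p.2) (u H : ℝ) -
            min (gaussRatio p.1 (Δ k p.2)) (u H : ℝ)|)).measurable
      exact ((((measurable_const.sub m1).const_mul B).add (m2.const_mul _)).add
        ((measurable_norm.comp ((hqm k).sub_const Q)).const_mul _)).aestronglyMeasurable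
    · refine (norm_add_le _ _).trans (add_le_add ((norm_add_le _ _).trans (add_le_add ?_ ?_)) ?_)
      · rw [norm_mul, Real.norm_of_nonneg hB]
        refine mul_le_mul_of_nonneg_left ((norm_sub_le _ _).trans ?_) hB
        rw [norm_one]
        linarith [hle k h]
      · rw [norm_mul, Real.norm_of_nonneg (by positivity)]
        exact mul_le_mul_of_nonneg_left (hle2 k h) (by positivity)
      · rw [norm_mul, Real.norm_of_nonneg (hu0 H).le, Real.norm_eq_abs, abs_abs]
        refine mul_le_mul_of_nonneg_left ?_ (hu0 H).le
        rw [abs_le]; constructor <;> linarith [hq0 k h, hqB k h]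
    · have l1 := hclt (fun z => min (gaussRatio h z) (u H))
        ((continuous_gaussRatio.comp (by fun_prop : Continuous fun z : ℝ => (h, z))).min
          continuous_const) ⟨u H, fun x => by
            rw [abs_of_nonneg (hmin0 _ _)]; exact min_le_right _ _⟩
      have l2 := hlan h (u H) (hu0 H)
      have l3 := ((hqQ h).sub_const Q).abs
      have := (((tendsto_const_nhds (x := (1 : ℝ))).sub l1).const_mul B).add
        ((l2.const_mul (2 * B)).add (l3.const_mul (u H : ℝ)))
      simpa [add_assoc] using this
  rw [Metric.tendsto_atTop]
  intro η hη
  -- the window is fixed first, then `k` is large: each of five errors is less than `η / 5`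
  have hBε : Tendsto (fun H => B ^ α * ε H) atTop (𝓝 0) := by simpa using hε.const_mul (B ^ α)
  have hδlim : Tendsto (fun H : ℕ => (B * (1 / ((H : ℝ) + 1))) ^ α) atTop (𝓝 0) := by
    have := (tendsto_one_div_add_atTop_nhds_zero_nat.const_mul B).rpow_const
      (Or.inr h0.le : _ ∨ 0 ≤ α)
    simpa [Real.zero_rpow h0.ne'] using this
  have hlimc := tendsto_integral_rpow_truncRatio hu h0 h1 hQ0
  obtain ⟨H, hH1, hH2, hH3⟩ := ((hBε.eventually_lt_const (by positivity : 0 < η / 5)).and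
    ((hδlim.eventually_lt_const (by positivity : 0 < η / 5)).and
      ((Metric.tendsto_nhds.1 hlimc) (η / 5) (by positivity)))).exists
  have hwinα := (hwin H).rpow_const (Or.inr h0.le : _ ∨ 0 ≤ α)
  have hbd : (∫ h in Ioo (-(H : ℝ)) H,
      B * (1 - ∫ z, min (gaussRatio h z) (u H) ∂(ProbabilityTheory.gaussianReal 0 1))) ^ α <
      η / 5 := by
    refine lt_of_le_of_lt ?_ hH2
    have hnn : ∀ h, 0 ≤ 1 - ∫ z, min (gaussRatio h z) (u H)
        ∂(ProbabilityTheory.gaussianReal 0 1) := by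
      intro h
      rw [sub_nonneg, ← integral_gaussRatio_right h]
      exact integral_mono_of_nonneg (Eventually.of_forall fun z =>
        le_min (gaussRatio_pos h z).le (Nat.cast_nonneg _)) (integrable_gaussRatio_right h)
        (Eventually.of_forall fun z => min_le_left _ _)
    rw [integral_const_mul]
    refine Real.rpow_le_rpow (mul_nonneg hB (integral_nonneg hnn)) ?_ h0.le
    exact mul_le_mul_of_nonneg_left (hδ H).le hB
  have hΨ := hclt (fun z => (Q * truncRatio H (u H) z) ^ α)
    ((continuous_const.mul (continuous_truncRatio (hu0 H))).rpow_const fun _ => Or.inr h0.le)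
    ⟨(Q * (2 * H * u H)) ^ α, fun z => by
      have hn := truncRatio_nonneg (H := H) (hu0 H) z
      rw [abs_of_nonneg (by positivity)]
      exact Real.rpow_le_rpow (by positivity) (mul_le_mul_of_nonneg_left
        (truncRatio_le (Nat.cast_nonneg H) (hu0 H) z) hQ0) h0.le⟩
  have hev := ((hwinα.eventually_lt_const hbd).and ((htail H).and
    ((Metric.tendsto_nhds.1 hΨ) (η / 5) (by positivity))))
  obtain ⟨k₀, hk₀⟩ := eventually_atTop.1 hev
  refine ⟨k₀, fun k hk => ?_⟩
  obtain ⟨e1, e2, e3⟩ := hk₀ k hk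
  have hm := moment_diff_le (P := P k) (L := L k) (Δ := Δ k) (q := q k) h0 h1
    (Nat.cast_nonneg H) (hu0 H) (hLm k) (hL0 k) (hLint k) (hL1 k) (hΔ k) (hqm k) (hq0 k) (hqB k)
    hQ0 hQB
  have hm' : |∫ ω, (∫ h, q k h * L k h ω) ^ α ∂(P k) -
      ∫ ω, (Q * truncRatio H (u H) (Δ k ω)) ^ α ∂(P k)| < η / 5 + η / 5 :=
    hm.trans_lt (add_lt_add ((mul_le_mul_of_nonneg_left e2
      (Real.rpow_nonneg hB _)).trans_lt hH1) e1)
  rw [← Real.dist_eq] at hm'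
  calc _ ≤ dist (∫ ω, (∫ h, q k h * L k h ω) ^ α ∂(P k))
          (∫ ω, (Q * truncRatio H (u H) (Δ k ω)) ^ α ∂(P k)) +
        dist (∫ ω, (Q * truncRatio H (u H) (Δ k ω)) ^ α ∂(P k))
          (∫ z, (Q * truncRatio H (u H) z) ^ α ∂(ProbabilityTheory.gaussianReal 0 1)) +
        dist (∫ z, (Q * truncRatio H (u H) z) ^ α ∂(ProbabilityTheory.gaussianReal 0 1))
          (Q ^ α * limitConst α) := dist_triangle4 _ _ _ _
    _ < η := by linarith

section

variable {𝓨 : Type*} [MeasurableSpace 𝓨] {μ : Measure 𝓨} {ℓ : 𝓨 → ℝ → ℝ} {s t : ℝ}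
  {I : ℝ → ℝ} {sc : 𝓨 → ℝ → ℝ}

/-- Likelihood ratio of `k` observations between the parameters `x` and `θ`. -/
noncomputable def likRatio (ℓ : 𝓨 → ℝ → ℝ) (k : ℕ) (y : Fin k → 𝓨) (θ x : ℝ) : ℝ :=
  likelihood ℓ k y x / likelihood ℓ k y θ

lemma sqrt_mul_integral_gaussian_le {c : ℝ} (hc : 0 < c) (k : ℕ) (θ : ℝ) {a b : ℝ}
    (hab : a ≤ b) :
    √k * ∫ x in a..b, Real.exp (-(c * k * (x - θ) ^ 2)) ≤ √(Real.pi / c) := by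
  rcases Nat.eq_zero_or_pos k with rfl | hk
  · simp only [CharP.cast_eq_zero, Real.sqrt_zero, zero_mul]; positivity
  have hk' : (0 : ℝ) < k := by exact_mod_cast hk
  have hint : Integrable fun x : ℝ => Real.exp (-(c * k * (x - θ) ^ 2)) := by
    have := (integrable_exp_neg_mul_sq (by positivity : 0 < c * k)).comp_sub_right θ
    simpa only [neg_mul] using this
  calc √k * ∫ x in a..b, Real.exp (-(c * k * (x - θ) ^ 2))
      ≤ √k * ∫ x, Real.exp (-(c * k * (x - θ) ^ 2)) := by
        gcongr
        rw [intervalIntegral.integral_of_le hab]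
        exact setIntegral_le_integral hint (Eventually.of_forall fun x => (Real.exp_pos _).le)
    _ = √k * √(Real.pi / (c * k)) := by
        rw [integral_sub_right_eq_self (fun x => Real.exp (-(c * k * x ^ 2))) θ]
        congr 1
        simpa only [neg_mul] using integral_gaussian (c * k)
    _ = √(Real.pi / c) := by
        rw [← Real.sqrt_mul (by positivity)]
        congr 1
        field_simp

namespace SmoothFamily

lemma likRatio_pos (hF : SmoothFamily μ ℓ s t I sc) {k : ℕ} (y : Fin k → 𝓨) {θ x : ℝ}
    (hθ : θ ∈ Icc s t) (hx : x ∈ Icc s t) : 0 < likRatio ℓ k y θ x :=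
  div_pos (hF.likelihood_pos y hx) (hF.likelihood_pos y hθ)

lemma likRatio_measurable (hF : SmoothFamily μ ℓ s t I sc) (k : ℕ) (θ : ℝ) :
    Measurable fun p : (Fin k → 𝓨) × ℝ => likRatio ℓ k p.1 θ p.2 :=
  (hF.likelihood_measurable k).div
    ((hF.likelihood_measurable_left k θ).comp measurable_fst)

lemma likRatio_cont (hF : SmoothFamily μ ℓ s t I sc) {k : ℕ} (y : Fin k → 𝓨) (θ : ℝ) :
    ContinuousOn (likRatio ℓ k y θ) (Icc s t) :=
  (hF.likelihood_cont y).div_const _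

lemma integral_likRatio_measurable (hF : SmoothFamily μ ℓ s t I sc) (k : ℕ) (θ a b : ℝ) :
    Measurable fun y : Fin k → 𝓨 => ∫ x in a..b, likRatio ℓ k y θ x := by
  simp only [intervalIntegral]
  exact ((hF.likRatio_measurable k θ).stronglyMeasurable.integral_prod_right').measurable.sub
    ((hF.likRatio_measurable k θ).stronglyMeasurable.integral_prod_right').measurable

/-- Fractional moments of the likelihood ratio integrated over an interval at distance at least
`r` from the true parameter. -/
lemma exists_moment_bound (hF : SmoothFamily μ ℓ s t I sc) [SigmaFinite μ] {α : ℝ}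
    (h0 : 0 < α) (h1 : α < 1) :
    ∃ c > 0, ∃ D ≥ 0, ∀ θ ∈ Icc s t, ∀ a b r : ℝ, s ≤ a → a ≤ b → b ≤ t → 0 ≤ r →
      (∀ x ∈ Icc a b, r ≤ |x - θ|) → ∀ k : ℕ,
      Integrable (fun y => (√k * ∫ x in a..b, likRatio ℓ k y θ x) ^ α)
        (Measure.pi fun _ : Fin k => obsLaw μ ℓ θ) ∧
      ∫ y, (√k * ∫ x in a..b, likRatio ℓ k y θ x) ^ α
        ∂(Measure.pi fun _ : Fin k => obsLaw μ ℓ θ) ≤ D * Real.exp (-(c * k * r ^ 2)) := by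
  -- the tail bound needs an exponent above `1 / 2`; Jensen's inequality leads from `β` back to `α`
  obtain ⟨β, hβ1, hβ2⟩ : ∃ β, max α (1 / 2) < β ∧ β < 1 :=
    exists_between (max_lt h1 (by norm_num))
  have hαβ : α < β := (le_max_left _ _).trans_lt hβ1
  have hβhalf : 1 / 2 < β := (le_max_right _ _).trans_lt hβ1
  have hβ0 : 0 < β := h0.trans hαβ
  obtain ⟨c, hc, C, hC, htail⟩ := hF.exists_tail_bound hβhalf hβ2
  set E := 1 + C * √(Real.pi / (c / 2)) with hE
  have hE0 : 0 ≤ E := by positivity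
  refine ⟨c / 2 * (α / β), by positivity, E ^ (α / β), by positivity,
    fun θ hθ a b r hsa hab hbt hr hdist k => ?_⟩
  have := hF.isProbabilityMeasure_obsLaw hθ
  set P := Measure.pi fun _ : Fin k => obsLaw μ ℓ θ with hP
  set X : (Fin k → 𝓨) → ℝ := fun y => (√k * ∫ x in a..b, likRatio ℓ k y θ x) ^ β with hX
  have hsub : Icc a b ⊆ Icc s t := Icc_subset_Icc hsa hbt
  have hbase : ∀ y : Fin k → 𝓨, 0 ≤ √k * ∫ x in a..b, likRatio ℓ k y θ x := fun y =>
    mul_nonneg (Real.sqrt_nonneg _) (intervalIntegral.integral_nonneg hab fun x hx =>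
      (hF.likRatio_pos y hθ (hsub hx)).le)
  have hX0 : ∀ y, 0 ≤ X y := fun y => Real.rpow_nonneg (hbase y) _
  have hXm : Measurable X := ((hF.integral_likRatio_measurable k θ a b).const_mul _).pow_const β
  have hXl : ∫⁻ y, ENNReal.ofReal (X y) ∂P ≤
      ENNReal.ofReal (E * Real.exp (-(c / 2 * k * r ^ 2))) := by
    refine (htail θ hθ a b a hsa hab hbt (left_mem_Icc.2 hab) k).trans
      (ENNReal.ofReal_le_ofReal ?_)
    -- half of the Gaussian rate is spent on the distance `r`, the other half keeps integrability
    have hsplit : ∀ x ∈ Icc a b, Real.exp (-(c * k * (x - θ) ^ 2)) ≤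
        Real.exp (-(c / 2 * k * r ^ 2)) * Real.exp (-(c / 2 * k * (x - θ) ^ 2)) := by
      intro x hx
      rw [← Real.exp_add]
      apply Real.exp_le_exp.2
      have h2 : r ^ 2 ≤ (x - θ) ^ 2 := by
        rw [← sq_abs (x - θ)]; exact pow_le_pow_left₀ hr (hdist x hx) 2
      have h3 : c / 2 * k * r ^ 2 ≤ c / 2 * k * (x - θ) ^ 2 := by gcongr
      linarith
    have e1 : Real.exp (-(c * k * (a - θ) ^ 2)) ≤ Real.exp (-(c / 2 * k * r ^ 2)) := by
      refine (hsplit a (left_mem_Icc.2 hab)).trans (mul_le_of_le_one_right (Real.exp_pos _).le ?_)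
      rw [Real.exp_le_one_iff, neg_nonpos]
      positivity
    have e2 : √k * ∫ x in a..b, Real.exp (-(c * k * (x - θ) ^ 2)) ≤
        Real.exp (-(c / 2 * k * r ^ 2)) * √(Real.pi / (c / 2)) := by
      calc _ ≤ √k * ∫ x in a..b,
            Real.exp (-(c / 2 * k * r ^ 2)) * Real.exp (-(c / 2 * k * (x - θ) ^ 2)) := by
            gcongr
            exact intervalIntegral.integral_mono_on hab
              (Continuous.intervalIntegrable (by fun_prop) _ _)
              (Continuous.intervalIntegrable (by fun_prop) _ _) hsplit
        _ = Real.exp (-(c / 2 * k * r ^ 2)) *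
            (√k * ∫ x in a..b, Real.exp (-(c / 2 * k * (x - θ) ^ 2))) := by
            rw [intervalIntegral.integral_const_mul]; ring
        _ ≤ _ := by
            gcongr
            exact sqrt_mul_integral_gaussian_le (by positivity) k θ hab
    have := mul_le_mul_of_nonneg_left e2 hC
    rw [hE]
    linarith
  have hXi : Integrable X P := by
    refine ⟨hXm.aestronglyMeasurable, ?_⟩
    rw [hasFiniteIntegral_iff_ofReal (Eventually.of_forall hX0)]
    exact hXl.trans_lt ENNReal.ofReal_lt_top
  have hXint : ∫ y, X y ∂P ≤ E * Real.exp (-(c / 2 * k * r ^ 2)) := by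
    rw [integral_eq_lintegral_of_nonneg_ae (Eventually.of_forall hX0) hXm.aestronglyMeasurable]
    exact ENNReal.toReal_le_of_le_ofReal (by positivity) hXl
  have hp0 : 0 < α / β := by positivity
  have hp1 : α / β ≤ 1 := (div_le_one hβ0).2 hαβ.le
  have epow : ∀ y, X y ^ (α / β) = (√k * ∫ x in a..b, likRatio ℓ k y θ x) ^ α := by
    intro y
    rw [hX, ← Real.rpow_mul (hbase y), mul_div_cancel₀ _ hβ0.ne']
  have i1 := integrable_rpow_of_integrable hp0 hp1 hXi (Eventually.of_forall hX0)
  have i2 := integral_rpow_le_rpow_integral hp0 hp1 hXi (Eventually.of_forall hX0)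
  simp_rw [epow] at i1 i2
  refine ⟨i1, i2.trans ?_⟩
  calc (∫ y, X y ∂P) ^ (α / β) ≤ (E * Real.exp (-(c / 2 * k * r ^ 2))) ^ (α / β) :=
        Real.rpow_le_rpow (integral_nonneg hX0) hXint hp0.le
    _ = _ := by
        rw [Real.mul_rpow hE0 (Real.exp_pos _).le, ← Real.exp_mul]
        congr 2; ring

/-! ### Local asymptotic normality -/

lemma integrable_pi_obsLaw (hF : SmoothFamily μ ℓ s t I sc) [SigmaFinite μ] {θ : ℝ}
    (hθ : θ ∈ Icc s t) {k : ℕ} {f : (Fin k → 𝓨) → ℝ}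
    (hf : Integrable (fun y => f y * likelihood ℓ k y θ) (Measure.pi fun _ => μ)) :
    Integrable f (Measure.pi fun _ : Fin k => obsLaw μ ℓ θ) := by
  rw [hF.pi_obsLaw hθ, integrable_withDensity_iff
    (hF.likelihood_measurable_left k θ).ennreal_ofReal
    (Eventually.of_forall fun y => ENNReal.ofReal_lt_top)]
  simpa only [ENNReal.toReal_ofReal (hF.likelihood_pos _ hθ).le] using hf

lemma integral_pi_obsLaw (hF : SmoothFamily μ ℓ s t I sc) [SigmaFinite μ] {θ : ℝ}
    (hθ : θ ∈ Icc s t) {k : ℕ} (f : (Fin k → 𝓨) → ℝ) :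
    ∫ y, f y ∂(Measure.pi fun _ : Fin k => obsLaw μ ℓ θ) =
      ∫ y, f y * likelihood ℓ k y θ ∂(Measure.pi fun _ => μ) := by
  rw [hF.pi_obsLaw hθ, integral_withDensity_eq_integral_toReal_smul
    (hF.likelihood_measurable_left k θ).ennreal_ofReal
    (Eventually.of_forall fun y => ENNReal.ofReal_lt_top)]
  refine integral_congr_ae (Eventually.of_forall fun y => ?_)
  simp only [ENNReal.toReal_ofReal (hF.likelihood_pos _ hθ).le, smul_eq_mul, mul_comm]

lemma likelihood_integrable (hF : SmoothFamily μ ℓ s t I sc) [SigmaFinite μ] {θ : ℝ}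
    (hθ : θ ∈ Icc s t) (k : ℕ) :
    Integrable (fun y => likelihood ℓ k y θ) (Measure.pi fun _ => μ) :=
  Integrable.fintype_prod fun _ => hF.integrable hθ

lemma likelihood_integral (hF : SmoothFamily μ ℓ s t I sc) [SigmaFinite μ] {θ : ℝ}
    (hθ : θ ∈ Icc s t) (k : ℕ) :
    ∫ y, likelihood ℓ k y θ ∂(Measure.pi fun _ => μ) = 1 := by
  simp only [likelihood]
  rw [integral_fintype_prod_eq_pow (fun y => ℓ y θ), hF.integral_eq_one θ hθ, one_pow]

lemma likRatio_integrable (hF : SmoothFamily μ ℓ s t I sc) [SigmaFinite μ] {θ x : ℝ}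
    (hθ : θ ∈ Icc s t) (hx : x ∈ Icc s t) (k : ℕ) :
    Integrable (fun y => likRatio ℓ k y θ x) (Measure.pi fun _ : Fin k => obsLaw μ ℓ θ) ∧
      ∫ y, likRatio ℓ k y θ x ∂(Measure.pi fun _ : Fin k => obsLaw μ ℓ θ) = 1 := by
  have e : ∀ y : Fin k → 𝓨, likRatio ℓ k y θ x * likelihood ℓ k y θ = likelihood ℓ k y x :=
    fun y => div_mul_cancel₀ _ (hF.likelihood_pos y hθ).ne'
  constructor
  · refine hF.integrable_pi_obsLaw hθ ?_
    simp_rw [e]; exact hF.likelihood_integrable hx k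
  · rw [hF.integral_pi_obsLaw hθ]
    simp_rw [e]; exact hF.likelihood_integral hx k

end SmoothFamily

/-- Finite samples as initial segments of an infinite sequence of observations. -/
lemma integral_pi_eq_integral_infinitePi {P : Measure 𝓨} [IsProbabilityMeasure P] (k : ℕ)
    {f : (Fin k → 𝓨) → ℝ} (hf : AEStronglyMeasurable f (Measure.pi fun _ => P)) :
    ∫ y, f y ∂(Measure.pi fun _ : Fin k => P) =
      ∫ ω, f (fun j => ω j) ∂(Measure.infinitePi fun _ : ℕ => P) := by
  have h := Measure.map_infinitePi_infinitePi_of_inj (P := fun _ : ℕ => P)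
    (f := fun j : Fin k => (j : ℕ)) Fin.val_injective
  rw [Measure.infinitePi_eq_pi (μ := fun _ : Fin k => P)] at h
  rw [← h] at hf ⊢
  exact integral_map (measurable_pi_lambda _ fun j : Fin k =>
    measurable_pi_apply (j : ℕ)).aemeasurable hf

/-- Central limit theorem for samples of increasing size, tested on bounded continuous functions. -/
lemma tendsto_integral_bounded_continuous_sum {P : Measure 𝓨} [IsProbabilityMeasure P]
    {X : 𝓨 → ℝ} (hX : Measurable X) (hm : ∫ y, X y ∂P = 0) (hv : ∫ y, X y ^ 2 ∂P = 1)
    {Φ : ℝ → ℝ} (hΦ : Continuous Φ) (hb : ∃ M, ∀ x, |Φ x| ≤ M) :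
    Tendsto (fun k : ℕ => ∫ y, Φ ((√k)⁻¹ * ∑ j, X (y j)) ∂(Measure.pi fun _ : Fin k => P)) atTop
      (𝓝 (∫ z, Φ z ∂(ProbabilityTheory.gaussianReal 0 1))) := by
  obtain ⟨M, hM⟩ := hb
  set Pi := Measure.infinitePi fun _ : ℕ => P with hPi
  have hmap : ∀ i, Pi.map (fun ω => ω i) = P := fun i =>
    Measure.infinitePi_map_eval (fun _ : ℕ => P) i
  have hid : ∀ i, ProbabilityTheory.IdentDistrib (fun ω : ℕ → 𝓨 => X (ω i))
      (fun ω : ℕ → 𝓨 => X (ω 0)) Pi Pi := by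
    intro i
    have : ProbabilityTheory.IdentDistrib (fun ω : ℕ → 𝓨 => ω i) (fun ω : ℕ → 𝓨 => ω 0) Pi Pi :=
      ⟨(measurable_pi_apply i).aemeasurable, (measurable_pi_apply 0).aemeasurable,
        by rw [hmap, hmap]⟩
    exact this.comp hX
  have hind : ProbabilityTheory.iIndepFun (fun i (ω : ℕ → 𝓨) => X (ω i)) Pi :=
    ProbabilityTheory.iIndepFun_infinitePi (P := fun _ : ℕ => P) (X := fun _ => X) fun _ => hX
  have hI : ∀ {g : 𝓨 → ℝ}, Measurable g → ∫ ω : ℕ → 𝓨, g (ω 0) ∂Pi = ∫ y, g y ∂P := by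
    intro g hg
    rw [← hmap 0, integral_map (measurable_pi_apply 0).aemeasurable hg.aestronglyMeasurable]
  have hclt := ProbabilityTheory.tendstoInDistribution_inv_sqrt_mul_sum (P := Pi)
    (P' := ProbabilityTheory.gaussianReal 0 1) (Y := id) (X := fun i (ω : ℕ → 𝓨) => X (ω i))
    ⟨by fun_prop, by simp⟩ (by rw [hI hX, hm])
    (by
      have := hI (hX.pow_const 2)
      rw [hv] at this
      simpa using this) hind hid
  have h2 := (ProbabilityMeasure.tendsto_iff_forall_integral_tendsto.1 hclt.tendsto)
    (BoundedContinuousFunction.ofNormedAddCommGroup Φ hΦ M fun x => hM x)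
  simp only [ProbabilityMeasure.coe_mk, BoundedContinuousFunction.coe_ofNormedAddCommGroup] at h2
  rw [Measure.map_id] at h2
  refine h2.congr fun k => ?_
  have hsum : Measurable fun ω : ℕ → 𝓨 => (√k)⁻¹ * ∑ i ∈ Finset.range k, X (ω i) :=
    (Finset.measurable_fun_sum _ fun i _ => hX.comp (measurable_pi_apply i)).const_mul _
  rw [integral_map hsum.aemeasurable hΦ.aestronglyMeasurable, integral_pi_eq_integral_infinitePi]
  · refine integral_congr_ae (Eventually.of_forall fun ω => ?_)
    simp only
    rw [← Fin.sum_univ_eq_sum_range (fun i => X (ω i)) k]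
  · exact (hΦ.measurable.comp (by fun_prop)).aestronglyMeasurable

/-- Law of large numbers in mean for samples of increasing size. -/
lemma tendsto_integral_abs_mean_sub {P : Measure 𝓨} [IsProbabilityMeasure P] {X : 𝓨 → ℝ}
    (hX : Integrable X P) :
    Tendsto (fun k : ℕ => ∫ y, |(k : ℝ)⁻¹ * ∑ j, X (y j) - ∫ y, X y ∂P|
      ∂(Measure.pi fun _ : Fin k => P)) atTop (𝓝 0) := by
  set Pi := Measure.infinitePi fun _ : ℕ => P with hPi
  have hmp : ∀ i, MeasurePreserving (fun ω : ℕ → 𝓨 => ω i) Pi P := fun i =>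
    measurePreserving_eval_infinitePi (fun _ : ℕ => P) i
  have hid : ∀ i, ProbabilityTheory.IdentDistrib (fun ω : ℕ → 𝓨 => X (ω i))
      (fun ω : ℕ → 𝓨 => X (ω 0)) Pi Pi := by
    intro i
    have : ProbabilityTheory.IdentDistrib (fun ω : ℕ → 𝓨 => ω i) (fun ω : ℕ → 𝓨 => ω 0) Pi Pi :=
      ⟨(measurable_pi_apply i).aemeasurable, (measurable_pi_apply 0).aemeasurable,
        by rw [(hmp i).map_eq, (hmp 0).map_eq]⟩
    refine this.comp_of_aemeasurable ?_
    rw [(hmp i).map_eq]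
    exact hX.aestronglyMeasurable.aemeasurable
  have hind : Pairwise fun i j => ProbabilityTheory.IndepFun (fun ω : ℕ → 𝓨 => X (ω i))
      (fun ω : ℕ → 𝓨 => X (ω j)) Pi := by
    intro i j hij
    have h := (ProbabilityTheory.iIndepFun_infinitePi (P := fun _ : ℕ => P)
      (X := fun _ (y : 𝓨) => y) fun _ => measurable_id).indepFun hij
    refine h.comp₀ (measurable_pi_apply i).aemeasurable (measurable_pi_apply j).aemeasurable ?_ ?_
    · rw [(hmp i).map_eq]; exact hX.aestronglyMeasurable.aemeasurable
    · rw [(hmp j).map_eq]; exact hX.aestronglyMeasurable.aemeasurable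
  have hint0 : Integrable (fun ω : ℕ → 𝓨 => X (ω 0)) Pi := (hmp 0).integrable_comp_of_integrable hX
  have hmean : ∫ ω : ℕ → 𝓨, X (ω 0) ∂Pi = ∫ y, X y ∂P := by
    rw [← (hmp 0).map_eq, integral_map (measurable_pi_apply 0).aemeasurable
      (by rw [(hmp 0).map_eq]; exact hX.aestronglyMeasurable)]
  have hL := ProbabilityTheory.strong_law_Lp le_rfl ENNReal.one_ne_top
    (fun i (ω : ℕ → 𝓨) => X (ω i)) (memLp_one_iff_integrable.2 hint0) hind hid
  rw [hmean] at hL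
  have hL2 := (ENNReal.tendsto_toReal ENNReal.zero_ne_top).comp hL
  simp only [ENNReal.toReal_zero] at hL2
  have hev : ∀ k : ℕ, ∀ j : Fin k, AEStronglyMeasurable (fun y : Fin k → 𝓨 => X (y j))
      (Measure.pi fun _ : Fin k => P) := fun k j =>
    hX.aestronglyMeasurable.comp_measurePreserving (measurePreserving_eval (fun _ => P) j)
  refine hL2.congr fun k => ?_
  have hms : AEStronglyMeasurable (fun y : Fin k → 𝓨 => (k : ℝ)⁻¹ * ∑ j, X (y j) - ∫ y, X y ∂P)
      (Measure.pi fun _ : Fin k => P) :=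
    ((Finset.aestronglyMeasurable_fun_sum _ fun j _ => hev k j).const_mul _).sub
      aestronglyMeasurable_const
  have hpi := integral_pi_eq_integral_infinitePi k hms.norm
  simp only [Real.norm_eq_abs] at hpi
  rw [hpi, Function.comp_apply,
    eLpNorm_one_eq_lintegral_enorm, ← integral_norm_eq_lintegral_enorm]
  · refine integral_congr_ae (Eventually.of_forall fun ω => ?_)
    simp only [smul_eq_mul, Real.norm_eq_abs]
    rw [← Fin.sum_univ_eq_sum_range (fun i => X (ω i)) k]
  · simp only [smul_eq_mul]
    exact ((Finset.aestronglyMeasurable_fun_sum _ fun i _ =>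
      hX.aestronglyMeasurable.comp_measurePreserving (hmp i)).const_mul _).sub
      aestronglyMeasurable_const

lemma abs_exp_sub_exp_le {a b N : ℝ} (ha : Real.exp a ≤ N) (hb : Real.exp b ≤ N) :
    |Real.exp a - Real.exp b| ≤ N * |a - b| := by
  have key : ∀ {a b : ℝ}, Real.exp a ≤ N → b ≤ a →
      |Real.exp a - Real.exp b| ≤ N * |a - b| := by
    intro a b ha hba
    rw [abs_of_nonneg (sub_nonneg.2 (Real.exp_le_exp.2 hba)), abs_of_nonneg (sub_nonneg.2 hba)]
    have h1 := Real.add_one_le_exp (b - a)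
    have h2 : Real.exp b = Real.exp a * Real.exp (b - a) := by rw [← Real.exp_add]; congr 1; ring
    have h3 := Real.exp_pos a
    rw [h2]
    nlinarith
  rcases le_total b a with h | h
  · exact key ha h
  · rw [abs_sub_comm, abs_sub_comm a]; exact key hb h

lemma abs_min_exp_sub_le {x y N : ℝ} (hN : 0 < N) :
    |min (Real.exp x) N - min (Real.exp y) N| ≤ N * |x - y| := by
  have e : ∀ x, min (Real.exp x) N = Real.exp (min x (Real.log N)) := fun x => by
    rw [Real.exp_monotone.map_min, Real.exp_log hN]
  have hle : ∀ x, Real.exp (min x (Real.log N)) ≤ N := fun x => by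
    rw [← e]; exact min_le_right _ _
  rw [e, e]
  refine (abs_exp_sub_exp_le (hle x) (hle y)).trans ?_
  refine mul_le_mul_of_nonneg_left ((abs_min_sub_min_le_max _ _ _ _).trans ?_) hN.le
  simp

/-- Standardization `√(n I(θ))` of the local parameter, for samples of size `n = k + 1`. -/
noncomputable def localScale (I : ℝ → ℝ) (θ : ℝ) (k : ℕ) : ℝ := √(((k + 1 : ℕ) : ℝ) * I θ)

namespace SmoothFamily

lemma localScale_pos (hF : SmoothFamily μ ℓ s t I sc) {θ : ℝ} (hθ : θ ∈ Icc s t) (k : ℕ) :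
    0 < localScale I θ k :=
  Real.sqrt_pos.2 (mul_pos (by exact_mod_cast Nat.succ_pos k) (hF.info_pos θ hθ))

lemma tendsto_div_localScale (hF : SmoothFamily μ ℓ s t I sc) {θ : ℝ} (hθ : θ ∈ Icc s t)
    (h : ℝ) : Tendsto (fun k => h / localScale I θ k) atTop (𝓝 0) := by
  refine tendsto_const_nhds.div_atTop ?_
  refine Real.tendsto_sqrt_atTop.comp (Tendsto.atTop_mul_const (hF.info_pos θ hθ) ?_)
  exact tendsto_natCast_atTop_atTop.comp (tendsto_add_atTop_nat 1)

/-- Local asymptotic normality: at the local parameter `h`, the log-likelihood ratio is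
`h Δ - h² / 2` up to a remainder that vanishes in mean, `Δ` being the standardized score. -/
lemma exists_logLik_remainder (hF : SmoothFamily μ ℓ s t I sc) [SigmaFinite μ] {θ : ℝ}
    (hθ : θ ∈ Ioo s t) {h : ℝ} (hh : h ≠ 0) :
    ∃ R : ∀ k : ℕ, (Fin (k + 1) → 𝓨) → ℝ,
      (∀ᶠ k in atTop, Integrable (R k) (Measure.pi fun _ => obsLaw μ ℓ θ) ∧
        ∀ y, |Real.log (likRatio ℓ (k + 1) y θ (θ + h / localScale I θ k)) -
          (h * ((localScale I θ k)⁻¹ * sampleScore sc (k + 1) y θ) - h ^ 2 / 2)| ≤ R k y) ∧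
      Tendsto (fun k => ∫ y, R k y ∂(Measure.pi fun _ => obsLaw μ ℓ θ)) atTop (𝓝 0) := by
  have hθ' := Ioo_subset_Icc_self hθ
  have hprob := hF.isProbabilityMeasure_obsLaw hθ'
  have hI := hF.info_pos θ hθ'
  obtain ⟨hs, hsm, hsi, hsint, τ, hτ, H, hHi, hrem, hlim⟩ := hF.expansion θ hθ
  have hac : obsLaw μ ℓ θ ≪ μ := withDensity_absolutelyContinuous _ _
  set P := obsLaw μ ℓ θ with hP
  let rem : ℝ → 𝓨 → ℝ := fun x y =>
    Real.log (ℓ y (θ + x)) - Real.log (ℓ y θ) - x * sc y θ - x ^ 2 / 2 * hs y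
  have hremm : ∀ x, AEStronglyMeasurable (rem x) P := fun x =>
    ((((hF.measurable_left (θ + x)).log.sub (hF.measurable_left θ).log).sub
      ((hF.score_measurable_left θ).const_mul x)).aestronglyMeasurable).sub
      ((hsm.mono_ac hac).const_mul _)
  have hsiP : Integrable hs P := hF.integrable_obsLaw hθ' hsi
  have hHiP : Integrable H P := hF.integrable_obsLaw hθ' hHi
  have hmean : ∫ y, hs y ∂P = -I θ := by rw [hF.integral_obsLaw hθ', hsint]
  set σ := localScale I θ with hσ
  have hσpos : ∀ k, 0 < σ k := hF.localScale_pos hθ'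
  have hσsq : ∀ k : ℕ, σ k ^ 2 = ((k + 1 : ℕ) : ℝ) * I θ := fun k => Real.sq_sqrt (by positivity)
  have hx0 : Tendsto (fun k => h / σ k) atTop (𝓝 0) := hF.tendsto_div_localScale hθ' h
  have hxne : ∀ k, h / σ k ≠ 0 := fun k => div_ne_zero hh (hσpos k).ne'
  have hgood : ∀ᶠ k in atTop, |h / σ k| < τ ∧ θ + h / σ k ∈ Icc s t := by
    have h1 := hx0.abs
    rw [abs_zero] at h1
    have h2 : Tendsto (fun k => θ + h / σ k) atTop (𝓝 θ) := by simpa using hx0.const_add θ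
    exact (h1.eventually_lt_const hτ).and (h2.eventually (Icc_mem_nhds hθ.1 hθ.2))
  have hremi : ∀ᶠ k in atTop, Integrable (rem (h / σ k)) P := by
    filter_upwards [hgood] with k hk
    refine (hHiP.const_mul ((h / σ k) ^ 2)).mono' (hremm _) ?_
    filter_upwards [hac.ae_le hrem] with y hy
    exact hy _ hk.1 hk.2
  have hremlim : Tendsto (fun k => ∫ y, |rem (h / σ k) y / (h / σ k) ^ 2| ∂P) atTop (𝓝 0) := by
    have := tendsto_integral_filter_of_dominated_convergence (μ := P) (l := atTop)
      (F := fun k y => |rem (h / σ k) y / (h / σ k) ^ 2|) (f := fun _ => (0 : ℝ)) H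
      (Eventually.of_forall fun k => by
        have := ((hremm (h / σ k)).aemeasurable.div_const ((h / σ k) ^ 2)).aestronglyMeasurable
        exact this.norm) ?_ hHiP ?_
    · simpa using this
    · filter_upwards [hgood] with k hk
      filter_upwards [hac.ae_le hrem] with y hy
      have hp : 0 < (h / σ k) ^ 2 := by have := hxne k; positivity
      rw [Real.norm_eq_abs, abs_abs, abs_div, abs_of_pos hp, div_le_iff₀ hp, mul_comm]
      exact hy _ hk.1 hk.2
    · filter_upwards [hac.ae_le hlim] with y hy
      have := (hy.comp (tendsto_nhdsWithin_iff.2 ⟨hx0, Eventually.of_forall hxne⟩)).abs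
      simpa [Function.comp_def] using this
  -- `R` adds the error of the law of large numbers for the second derivative and the remainders of
  -- the second order expansion of the individual log-likelihoods
  let R : ∀ k : ℕ, (Fin (k + 1) → 𝓨) → ℝ := fun k y =>
    h ^ 2 / (2 * I θ) * |((k + 1 : ℕ) : ℝ)⁻¹ * ∑ j, hs (y j) - ∫ y, hs y ∂P| +
      ∑ j, |rem (h / σ k) (y j)|
  have hR1 : ∀ k : ℕ, Integrable (fun y : Fin (k + 1) → 𝓨 =>
      h ^ 2 / (2 * I θ) * |((k + 1 : ℕ) : ℝ)⁻¹ * ∑ j, hs (y j) - ∫ y, hs y ∂P|)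
      (Measure.pi fun _ => P) := fun k =>
    ((((integrable_finsetSum _ fun j _ => integrable_comp_eval (μ := fun _ => P)
      hsiP).const_mul _).sub (integrable_const _)).abs).const_mul _
  have hR2 : ∀ k : ℕ, Integrable (rem (h / σ k)) P → ∀ j : Fin (k + 1), Integrable
      (fun y : Fin (k + 1) → 𝓨 => |rem (h / σ k) (y j)|) (Measure.pi fun _ => P) :=
    fun k hk j => integrable_comp_eval (μ := fun _ => P) (f := fun y => |rem (h / σ k) y|) hk.abs
  refine ⟨R, ?_, ?_⟩
  · filter_upwards [hgood, hremi] with k hk hki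
    refine ⟨(hR1 k).add (integrable_finsetSum _ fun j _ => hR2 k hki j), fun y => ?_⟩
    have hlog : Real.log (likRatio ℓ (k + 1) y θ (θ + h / σ k)) =
        ∑ j, (Real.log (ℓ (y j) (θ + h / σ k)) - Real.log (ℓ (y j) θ)) := by
      rw [likRatio, Real.log_div (hF.likelihood_pos y hk.2).ne' (hF.likelihood_pos y hθ').ne',
        likelihood, likelihood, Real.log_prod fun j _ => (hF.pos (y j) _ hk.2).ne',
        Real.log_prod fun j _ => (hF.pos (y j) _ hθ').ne', Finset.sum_sub_distrib]
    have hx2 : (h / σ k) ^ 2 / 2 = h ^ 2 / (2 * I θ) * ((k + 1 : ℕ) : ℝ)⁻¹ := by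
      rw [div_pow, hσsq]; field_simp
    have e : Real.log (likRatio ℓ (k + 1) y θ (θ + h / σ k)) -
        (h * ((σ k)⁻¹ * sampleScore sc (k + 1) y θ) - h ^ 2 / 2) =
        h ^ 2 / (2 * I θ) * (((k + 1 : ℕ) : ℝ)⁻¹ * ∑ j, hs (y j) - ∫ y, hs y ∂P) +
          ∑ j, rem (h / σ k) (y j) := by
      have h1 : ∑ j, rem (h / σ k) (y j) =
          ∑ j, (Real.log (ℓ (y j) (θ + h / σ k)) - Real.log (ℓ (y j) θ)) -
          h / σ k * sampleScore sc (k + 1) y θ - (h / σ k) ^ 2 / 2 * ∑ j, hs (y j) := by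
        rw [sampleScore, Finset.mul_sum, Finset.mul_sum, ← Finset.sum_sub_distrib,
          ← Finset.sum_sub_distrib]
      rw [h1, hlog, hx2, hmean]
      field_simp
      ring
    rw [e]
    refine (abs_add_le _ _).trans (add_le_add (le_of_eq ?_) (Finset.abs_sum_le_sum_abs _ _))
    rw [abs_mul, abs_of_nonneg (by positivity)]
  · have hl1 := ((tendsto_integral_abs_mean_sub hsiP).comp (tendsto_add_atTop_nat 1)).const_mul
      (h ^ 2 / (2 * I θ))
    have hl2 := hremlim.const_mul (h ^ 2 / I θ)
    have := hl1.add hl2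
    simp only [mul_zero, add_zero] at this
    refine this.congr' ?_
    filter_upwards [hremi] with k hki
    rw [integral_add (hR1 k) (integrable_finsetSum _ fun j _ => hR2 k hki j),
      integral_finsetSum _ fun j _ => hR2 k hki j, integral_const_mul]
    congr 1
    have e1 : ∀ j : Fin (k + 1), ∫ y : Fin (k + 1) → 𝓨, |rem (h / σ k) (y j)|
        ∂(Measure.pi fun _ => P) = ∫ y, |rem (h / σ k) y| ∂P := fun j =>
      integral_comp_eval (μ := fun _ => P) (f := fun y => |rem (h / σ k) y|)
        (hremm _).norm
    have hp : 0 < (h / σ k) ^ 2 := by have := hxne k; positivity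
    have e2 : ∫ y, |rem (h / σ k) y / (h / σ k) ^ 2| ∂P =
        (∫ y, |rem (h / σ k) y| ∂P) / (h / σ k) ^ 2 := by
      rw [← integral_div]
      congr 1; ext y
      rw [abs_div, abs_of_pos hp]
    simp_rw [e1]
    rw [Finset.sum_const, Finset.card_univ, Fintype.card_fin, nsmul_eq_mul, e2, div_pow, hσsq]
    field_simp

end SmoothFamily

lemma integral_comp_add_div (f : ℝ → ℝ) (θ : ℝ) {σ : ℝ} (hσ : 0 < σ) :
    ∫ h, f (θ + h / σ) = σ * ∫ x, f x := by
  rw [Measure.integral_comp_div (fun x => f (θ + x)) σ, abs_of_pos hσ,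
    integral_add_left_eq_self f θ, smul_eq_mul]

/-- The localized likelihood ratio, extended by zero outside the parameter interval. -/
noncomputable def localRatio (ℓ : 𝓨 → ℝ → ℝ) (s t : ℝ) (I : ℝ → ℝ) (θ : ℝ) (k : ℕ) (h : ℝ)
    (y : Fin (k + 1) → 𝓨) : ℝ :=
  (Icc s t).indicator (likRatio ℓ (k + 1) y θ) (θ + h / localScale I θ k)

namespace SmoothFamily

/-- The moment bound for a set integral over a possibly empty interval. -/
lemma exists_moment_bound_setIntegral (hF : SmoothFamily μ ℓ s t I sc) [SigmaFinite μ] {α : ℝ}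
    (h0 : 0 < α) (h1 : α < 1) :
    ∃ c > 0, ∃ D ≥ 0, ∀ θ ∈ Icc s t, ∀ a b r : ℝ, s ≤ a → b ≤ t → 0 ≤ r →
      (∀ x ∈ Icc a b, r ≤ |x - θ|) → ∀ k : ℕ,
      Integrable (fun y => (√k * ∫ x in Icc a b, likRatio ℓ k y θ x) ^ α)
        (Measure.pi fun _ : Fin k => obsLaw μ ℓ θ) ∧
      ∫ y, (√k * ∫ x in Icc a b, likRatio ℓ k y θ x) ^ α
        ∂(Measure.pi fun _ : Fin k => obsLaw μ ℓ θ) ≤ D * Real.exp (-(c * k * r ^ 2)) := by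
  obtain ⟨c, hc, D, hD, hbd⟩ := hF.exists_moment_bound h0 h1
  refine ⟨c, hc, D, hD, fun θ hθ a b r hsa hbt hr hdist k => ?_⟩
  rcases le_or_gt a b with hab | hab
  · have := hbd θ hθ a b r hsa hab hbt hr hdist k
    simpa only [intervalIntegral.integral_of_le hab, ← integral_Icc_eq_integral_Ioc] using this
  · simp only [Icc_eq_empty hab.not_ge, Measure.restrict_empty, integral_zero_measure, mul_zero,
      Real.zero_rpow h0.ne', integral_zero]
    exact ⟨integrable_zero _ _ _, by positivity⟩

lemma localRatio_measurable (hF : SmoothFamily μ ℓ s t I sc) (θ : ℝ) (k : ℕ) :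
    Measurable fun p : ℝ × (Fin (k + 1) → 𝓨) => localRatio ℓ s t I θ k p.1 p.2 := by
  have h1 : Measurable fun p : ℝ × (Fin (k + 1) → 𝓨) =>
      likRatio ℓ (k + 1) p.2 θ (θ + p.1 / localScale I θ k) :=
    (hF.likRatio_measurable (k + 1) θ).comp (by fun_prop :
      Measurable fun p : ℝ × (Fin (k + 1) → 𝓨) => (p.2, θ + p.1 / localScale I θ k))
  have hS : MeasurableSet {p : ℝ × (Fin (k + 1) → 𝓨) | θ + p.1 / localScale I θ k ∈ Icc s t} :=
    (by fun_prop : Measurable fun p : ℝ × (Fin (k + 1) → 𝓨) =>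
      θ + p.1 / localScale I θ k) measurableSet_Icc
  convert h1.indicator hS using 1
  ext p
  simp only [localRatio, indicator]
  congr

lemma localRatio_nonneg (hF : SmoothFamily μ ℓ s t I sc) {θ : ℝ} (hθ : θ ∈ Icc s t) (k : ℕ)
    (h : ℝ) (y : Fin (k + 1) → 𝓨) : 0 ≤ localRatio ℓ s t I θ k h y :=
  indicator_nonneg (fun _ hx => (hF.likRatio_pos y hθ hx).le) _

lemma localRatio_integral (hF : SmoothFamily μ ℓ s t I sc) [SigmaFinite μ] {θ : ℝ}
    (hθ : θ ∈ Icc s t) (k : ℕ) (h : ℝ) :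
    Integrable (localRatio ℓ s t I θ k h) (Measure.pi fun _ => obsLaw μ ℓ θ) ∧
      ∫ y, localRatio ℓ s t I θ k h y ∂(Measure.pi fun _ => obsLaw μ ℓ θ) =
        (Icc s t).indicator 1 (θ + h / localScale I θ k) := by
  unfold localRatio
  by_cases hx : θ + h / localScale I θ k ∈ Icc s t
  · simp only [indicator_of_mem hx]
    exact hF.likRatio_integrable hθ hx (k + 1)
  · simp only [indicator_of_notMem hx, integral_zero, and_true]
    exact integrable_zero _ _ _

lemma localRatio_integrable (hF : SmoothFamily μ ℓ s t I sc) [SigmaFinite μ] {θ : ℝ}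
    (hθ : θ ∈ Icc s t) (k : ℕ) :
    Integrable (fun p : ℝ × (Fin (k + 1) → 𝓨) => localRatio ℓ s t I θ k p.1 p.2)
      (volume.prod (Measure.pi fun _ => obsLaw μ ℓ θ)) := by
  have := hF.isProbabilityMeasure_obsLaw hθ
  rw [integrable_prod_iff (hF.localRatio_measurable θ k).aestronglyMeasurable]
  refine ⟨Eventually.of_forall fun h => (hF.localRatio_integral hθ k h).1, ?_⟩
  have e : ∀ h, ∫ y, ‖localRatio ℓ s t I θ k h y‖ ∂(Measure.pi fun _ => obsLaw μ ℓ θ) =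
      (Icc s t).indicator 1 (θ + h / localScale I θ k) := fun h => by
    rw [← (hF.localRatio_integral hθ k h).2]
    congr 1; ext y
    exact Real.norm_of_nonneg (hF.localRatio_nonneg hθ k h y)
  simp_rw [e]
  have hi : Integrable ((Icc s t).indicator (1 : ℝ → ℝ)) :=
    (integrable_indicator_iff measurableSet_Icc).2 (integrableOn_const (by simp))
  have := (hi.comp_add_left θ).comp_div (hF.localScale_pos hθ k).ne'
  exact this

/-- Integrals against localized likelihood ratios, in the original parametrization. -/
lemma integral_localRatio_eq (hF : SmoothFamily μ ℓ s t I sc) {θ : ℝ} (hθ : θ ∈ Icc s t) (k : ℕ)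
    (f : ℝ → ℝ) (y : Fin (k + 1) → 𝓨) :
    ∫ h, f (θ + h / localScale I θ k) * localRatio ℓ s t I θ k h y =
      localScale I θ k * ∫ x in Icc s t, f x * likRatio ℓ (k + 1) y θ x := by
  rw [← integral_indicator measurableSet_Icc, ← integral_comp_add_div _ θ (hF.localScale_pos hθ k)]
  congr 1; ext h
  simp only [localRatio, indicator]
  split_ifs <;> simp

/-- The contribution of parameters outside the local window is uniformly small. -/
lemma exists_window_tail (hF : SmoothFamily μ ℓ s t I sc) [SigmaFinite μ] {α : ℝ}
    (h0 : 0 < α) (h1 : α < 1) {θ : ℝ} (hθ : θ ∈ Icc s t) :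
    ∃ ε : ℕ → ℝ, Tendsto ε atTop (𝓝 0) ∧ ∀ (H k : ℕ),
      ∫ y, (∫ h in (Ioo (-(H : ℝ)) H)ᶜ, localRatio ℓ s t I θ k h y) ^ α
        ∂(Measure.pi fun _ => obsLaw μ ℓ θ) ≤ ε H := by
  have hprob := hF.isProbabilityMeasure_obsLaw hθ
  obtain ⟨c, hc, D, hD, hbd⟩ := hF.exists_moment_bound_setIntegral h0 h1
  have hI := hF.info_pos θ hθ
  refine ⟨fun H => √(I θ) ^ α * (D * Real.exp (-(c / I θ * (H : ℝ) ^ 2)) +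
    D * Real.exp (-(c / I θ * (H : ℝ) ^ 2))), ?_, fun H k => ?_⟩
  · have h2 : Tendsto (fun H : ℕ => Real.exp (-(c / I θ * (H : ℝ) ^ 2))) atTop (𝓝 0) := by
      refine Real.tendsto_exp_neg_atTop_nhds_zero.comp (Tendsto.const_mul_atTop (by positivity) ?_)
      exact (tendsto_pow_atTop two_ne_zero).comp tendsto_natCast_atTop_atTop
    have := ((h2.const_mul D).add (h2.const_mul D)).const_mul (√(I θ) ^ α)
    simpa using this
  set σ := localScale I θ k with hσ
  have hσpos : 0 < σ := hF.localScale_pos hθ k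
  have hσeq : σ = √(I θ) * √((k + 1 : ℕ) : ℝ) := by
    rw [hσ, localScale, Real.sqrt_mul (by positivity), mul_comm]
  set r := (H : ℝ) / σ with hr
  have hr0 : 0 ≤ r := by positivity
  have hrexp : c * ((k + 1 : ℕ) : ℝ) * r ^ 2 = c / I θ * (H : ℝ) ^ 2 := by
    rw [hr, div_pow, hσ, localScale, Real.sq_sqrt (by positivity)]
    field_simp
  obtain ⟨i1, b1⟩ := hbd θ hθ s (θ - r) r le_rfl (by linarith [hθ.2]) hr0 (fun x hx => by
    rw [abs_sub_comm]; exact (by linarith [hx.2] : r ≤ θ - x).trans (le_abs_self _)) (k + 1)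
  obtain ⟨i2, b2⟩ := hbd θ hθ (θ + r) t r (by linarith [hθ.1]) le_rfl hr0 (fun x hx =>
    (by linarith [hx.1] : r ≤ x - θ).trans (le_abs_self _)) (k + 1)
  rw [hrexp] at b1 b2
  have hpt : ∀ y : Fin (k + 1) → 𝓨,
      (∫ h in (Ioo (-(H : ℝ)) H)ᶜ, localRatio ℓ s t I θ k h y) ^ α ≤
      √(I θ) ^ α * ((√((k + 1 : ℕ) : ℝ) * ∫ x in Icc s (θ - r), likRatio ℓ (k + 1) y θ x) ^ α +
        (√((k + 1 : ℕ) : ℝ) * ∫ x in Icc (θ + r) t, likRatio ℓ (k + 1) y θ x) ^ α) := by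
    intro y
    have hint : IntegrableOn (likRatio ℓ (k + 1) y θ) (Icc s t) :=
      (hF.likRatio_cont y θ).integrableOn_Icc
    have hpos : ∀ x ∈ Icc s t, 0 ≤ likRatio ℓ (k + 1) y θ x := fun x hx =>
      (hF.likRatio_pos y hθ hx).le
    have hs1 : Icc s (θ - r) ⊆ Icc s t := Icc_subset_Icc_right (by linarith [hθ.2])
    have hs2 : Icc (θ + r) t ⊆ Icc s t := Icc_subset_Icc_left (by linarith [hθ.1])
    have e : ∫ h in (Ioo (-(H : ℝ)) H)ᶜ, localRatio ℓ s t I θ k h y ≤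
        σ * ((∫ x in Icc s (θ - r), likRatio ℓ (k + 1) y θ x) +
          ∫ x in Icc (θ + r) t, likRatio ℓ (k + 1) y θ x) := by
      set f : ℝ → ℝ := (Ioo (θ - r) (θ + r))ᶜ.indicator 1 with hf
      have e1 : ∫ h in (Ioo (-(H : ℝ)) H)ᶜ, localRatio ℓ s t I θ k h y =
          ∫ h, f (θ + h / σ) * localRatio ℓ s t I θ k h y := by
        rw [← integral_indicator measurableSet_Ioo.compl]
        congr 1; ext h
        have hiff : h ∈ (Ioo (-(H : ℝ)) H)ᶜ ↔ θ + h / σ ∈ (Ioo (θ - r) (θ + r))ᶜ := by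
          rw [mem_compl_iff, mem_compl_iff, not_iff_not, mem_Ioo, mem_Ioo, hr, sub_eq_add_neg,
            add_lt_add_iff_left, add_lt_add_iff_left, ← neg_div, div_lt_div_iff_of_pos_right hσpos,
            div_lt_div_iff_of_pos_right hσpos]
        simp only [hf, indicator, hiff]
        split_ifs <;> simp
      rw [e1, hF.integral_localRatio_eq hθ]
      refine mul_le_mul_of_nonneg_left ?_ hσpos.le
      rw [← integral_indicator measurableSet_Icc, ← integral_indicator measurableSet_Icc,
        ← integral_indicator measurableSet_Icc,
        ← integral_add ((hint.mono_set hs1).integrable_indicator measurableSet_Icc)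
        ((hint.mono_set hs2).integrable_indicator measurableSet_Icc)]
      refine integral_mono_of_nonneg (Eventually.of_forall fun x => ?_)
        (((hint.mono_set hs1).integrable_indicator measurableSet_Icc).add
        ((hint.mono_set hs2).integrable_indicator measurableSet_Icc))
        (Eventually.of_forall fun x => ?_)
      · refine indicator_nonneg (fun x hx => mul_nonneg ?_ (hpos x hx)) x
        exact indicator_nonneg (fun _ _ => zero_le_one) x
      · simp only [hf]
        by_cases hx : x ∈ Icc s t
        · rw [indicator_of_mem hx]
          have hp := hpos x hx
          have p1 : 0 ≤ (Icc s (θ - r)).indicator (likRatio ℓ (k + 1) y θ) x :=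
            indicator_nonneg (fun x hx => hpos x (hs1 hx)) x
          have p2 : 0 ≤ (Icc (θ + r) t).indicator (likRatio ℓ (k + 1) y θ) x :=
            indicator_nonneg (fun x hx => hpos x (hs2 hx)) x
          by_cases hx2 : x ∈ (Ioo (θ - r) (θ + r))ᶜ
          · rw [indicator_of_mem hx2, Pi.one_apply, one_mul]
            rw [mem_compl_iff, mem_Ioo, not_and_or, not_lt, not_lt] at hx2
            rcases hx2 with hx2 | hx2
            · rw [indicator_of_mem (show x ∈ Icc s (θ - r) from ⟨hx.1, hx2⟩)]
              linarith
            · rw [indicator_of_mem (show x ∈ Icc (θ + r) t from ⟨hx2, hx.2⟩)]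
              linarith
          · rw [indicator_of_notMem hx2, zero_mul]
            linarith
        · rw [indicator_of_notMem hx, indicator_of_notMem (fun h => hx (hs1 h)),
            indicator_of_notMem (fun h => hx (hs2 h)), add_zero]
    have n1 : 0 ≤ ∫ x in Icc s (θ - r), likRatio ℓ (k + 1) y θ x :=
      setIntegral_nonneg measurableSet_Icc fun x hx => hpos x (hs1 hx)
    have n2 : 0 ≤ ∫ x in Icc (θ + r) t, likRatio ℓ (k + 1) y θ x :=
      setIntegral_nonneg measurableSet_Icc fun x hx => hpos x (hs2 hx)
    have n0 : 0 ≤ ∫ h in (Ioo (-(H : ℝ)) H)ᶜ, localRatio ℓ s t I θ k h y :=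
      integral_nonneg fun h => hF.localRatio_nonneg hθ k h y
    calc _ ≤ _ := Real.rpow_le_rpow n0 e h0.le
      _ = √(I θ) ^ α * (√((k + 1 : ℕ) : ℝ) * (∫ x in Icc s (θ - r), likRatio ℓ (k + 1) y θ x) +
          √((k + 1 : ℕ) : ℝ) * ∫ x in Icc (θ + r) t, likRatio ℓ (k + 1) y θ x) ^ α := by
          rw [← Real.mul_rpow (by positivity) (by positivity), hσeq]
          congr 1; ring
      _ ≤ _ := by
          gcongr
          exact Real.rpow_add_le_add_rpow (by positivity) (by positivity) h0.le h1.le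
  refine (integral_mono_of_nonneg (Eventually.of_forall fun y => Real.rpow_nonneg
    (integral_nonneg fun h => hF.localRatio_nonneg hθ k h y) _) ((i1.add i2).const_mul _)
    (Eventually.of_forall hpt)).trans ?_
  rw [integral_const_mul]
  refine mul_le_mul_of_nonneg_left ?_ (by positivity)
  simp only [Pi.add_apply]
  rw [integral_add i1 i2]
  exact add_le_add b1 b2

/-- The moments of the integrated likelihood ratio at an interior point: the limit depends on the
prior density and on the information at that point only. -/
theorem tendsto_moment_at (hF : SmoothFamily μ ℓ s t I sc) [SigmaFinite μ] {α : ℝ}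
    (h0 : 0 < α) (h1 : α < 1) {θ : ℝ} (hθ : θ ∈ Ioo s t) {q : ℝ → ℝ} {B : ℝ}
    (hqm : Measurable q) (hq0 : ∀ x, 0 ≤ q x) (hqB : ∀ x ∈ Icc s t, q x ≤ B)
    (hqc : ContinuousOn q (Icc s t)) :
    Tendsto (fun k : ℕ => ∫ y, (√k * ∫ x in Icc s t, q x * likRatio ℓ k y θ x) ^ α
      ∂(Measure.pi fun _ : Fin k => obsLaw μ ℓ θ)) atTop
      (𝓝 (q θ ^ α * limitConst α * (√(I θ) ^ α)⁻¹)) := by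
  have hθ' := Ioo_subset_Icc_self hθ
  have hprob := hF.isProbabilityMeasure_obsLaw hθ'
  have hI := hF.info_pos θ hθ'
  have hB : 0 ≤ B := (hq0 θ).trans (hqB θ hθ')
  obtain ⟨ε, hε, htail⟩ := hF.exists_window_tail h0 h1 hθ'
  set σ := localScale I θ with hσ
  have hσpos : ∀ k, 0 < σ k := hF.localScale_pos hθ'
  have hlocal : ∀ h : ℝ, Tendsto (fun k => θ + h / σ k) atTop (𝓝 θ) := fun h => by
    simpa using (hF.tendsto_div_localScale hθ' h).const_add θ
  have hin : ∀ h : ℝ, ∀ᶠ k in atTop, θ + h / σ k ∈ Icc s t := fun h =>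
    (hlocal h).eventually (Icc_mem_nhds hθ.1 hθ.2)
  -- samples of size `k + 1` are used, so that the local scale never vanishes
  have hmain := tendsto_integral_rpow_of_locallyGaussian (Ω := fun k => Fin (k + 1) → 𝓨)
    (P := fun k => Measure.pi fun _ : Fin (k + 1) => obsLaw μ ℓ θ)
    (L := localRatio ℓ s t I θ) (Δ := fun k y => (σ k)⁻¹ * sampleScore sc (k + 1) y θ)
    (q := fun k h => (Icc s t).indicator q (θ + h / σ k)) (Q := q θ) (B := B) (ε := ε) h0 h1
    (hF.localRatio_measurable θ) (hF.localRatio_nonneg hθ') (hF.localRatio_integrable hθ')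
    (fun k h => ⟨(hF.localRatio_integral hθ' k h).1, by
      rw [(hF.localRatio_integral hθ' k h).2]
      exact indicator_apply_le' (fun _ => le_rfl) fun _ => zero_le_one⟩)
    (fun k => (hF.sampleScore_measurable_left (k + 1) θ).const_mul _)
    (fun Φ hΦ hb => by
      have hclt := (tendsto_integral_bounded_continuous_sum (P := obsLaw μ ℓ θ)
        (X := fun y => (√(I θ))⁻¹ * sc y θ) ((hF.score_measurable_left θ).const_mul _)
        (by rw [integral_const_mul, hF.integral_obsLaw hθ', hF.score_integral θ hθ', mul_zero])
        (by
          simp_rw [mul_pow]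
          rw [integral_const_mul, hF.integral_obsLaw hθ', hF.sq_integral θ hθ', inv_pow,
            Real.sq_sqrt hI.le, inv_mul_cancel₀ hI.ne']) hΦ hb).comp (tendsto_add_atTop_nat 1)
      refine hclt.congr fun k => ?_
      refine integral_congr_ae (Eventually.of_forall fun y => ?_)
      simp only
      congr 1
      rw [← Finset.mul_sum, ← mul_assoc, hσ, localScale, Real.sqrt_mul (by positivity), mul_inv,
        sampleScore])
    -- truncation makes the exponential Lipschitz, so that the remainder in mean is enough
    (fun h N hN => by
      rcases eq_or_ne h 0 with rfl | hh
      · refine tendsto_const_nhds.congr fun k => ?_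
        have e : ∀ y, localRatio ℓ s t I θ k 0 y = 1 := fun y => by
          rw [localRatio, zero_div, add_zero, indicator_of_mem hθ', likRatio,
            div_self (hF.likelihood_pos y hθ').ne']
        simp [e, gaussRatio]
      · obtain ⟨R, hR, hRl⟩ := hF.exists_logLik_remainder hθ hh
        have hRl' := hRl.const_mul N
        rw [mul_zero] at hRl'
        refine tendsto_of_tendsto_of_tendsto_of_le_of_le' tendsto_const_nhds hRl'
          (Eventually.of_forall fun k => integral_nonneg fun y => abs_nonneg _) ?_
        filter_upwards [hR, hin h] with k hk hk2
        rw [← integral_const_mul]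
        refine integral_mono_of_nonneg (Eventually.of_forall fun y => abs_nonneg _)
          (hk.1.const_mul N) (Eventually.of_forall fun y => ?_)
        have hp := hF.likRatio_pos y hθ' hk2
        have e : localRatio ℓ s t I θ k h y = Real.exp (Real.log
            (likRatio ℓ (k + 1) y θ (θ + h / σ k))) := by
          rw [Real.exp_log hp]; exact indicator_of_mem hk2 _
        simp only [e, gaussRatio]
        refine (abs_min_exp_sub_le hN).trans (mul_le_mul_of_nonneg_left ?_ hN.le)
        exact hk.2 y)
    hε (fun H => Eventually.of_forall fun k => htail H k)
    (fun k => (hqm.indicator measurableSet_Icc).comp (by fun_prop))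
    (fun k h => indicator_nonneg (fun x _ => hq0 x) _)
    (fun k h => indicator_apply_le' (fun hx => hqB _ hx) fun _ => hB)
    (fun h => by
      have h2 : Tendsto (fun k => q (θ + h / σ k)) atTop (𝓝 (q θ)) :=
        ((hqc.continuousAt (Icc_mem_nhds hθ.1 hθ.2)).tendsto).comp (hlocal h)
      refine h2.congr' ?_
      filter_upwards [hin h] with k hk
      rw [indicator_of_mem hk])
  rw [← tendsto_add_atTop_iff_nat 1]
  refine (hmain.mul_const (√(I θ) ^ α)⁻¹).congr fun k => ?_
  rw [← integral_mul_const]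
  refine integral_congr_ae (Eventually.of_forall fun y => ?_)
  simp only
  rw [hF.integral_localRatio_eq hθ' k ((Icc s t).indicator q) y]
  have e : ∫ x in Icc s t, (Icc s t).indicator q x * likRatio ℓ (k + 1) y θ x =
      ∫ x in Icc s t, q x * likRatio ℓ (k + 1) y θ x :=
    setIntegral_congr_fun measurableSet_Icc fun x hx => by simp only [indicator_of_mem hx]
  have hn : 0 ≤ ∫ x in Icc s t, q x * likRatio ℓ (k + 1) y θ x :=
    setIntegral_nonneg measurableSet_Icc fun x hx =>
      mul_nonneg (hq0 x) (hF.likRatio_pos y hθ' hx).le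
  rw [e, localScale, Real.sqrt_mul (by positivity), mul_assoc, mul_left_comm,
    Real.mul_rpow (Real.sqrt_nonneg _) (by positivity), mul_comm, ← mul_assoc,
    inv_mul_cancel₀ (Real.rpow_pos_of_pos (Real.sqrt_pos.2 hI) _).ne', one_mul]

end SmoothFamily

/-! ### Asymptotic expansion of the mutual information -/

/-- The measure on `[s, t]` with density `q`. -/
noncomputable def densityOn (s t : ℝ) (q : ℝ → ℝ) : Measure ℝ :=
  (volume.restrict (Icc s t)).withDensity fun x => ENNReal.ofReal (q x)

lemma integral_densityOn {q : ℝ → ℝ} (hqm : Measurable q) (hq0 : ∀ x, 0 ≤ q x) (f : ℝ → ℝ) :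
    ∫ x, f x ∂(densityOn s t q) = ∫ x in Icc s t, q x * f x := by
  rw [densityOn, integral_withDensity_eq_integral_toReal_smul hqm.ennreal_ofReal
    (Eventually.of_forall fun y => ENNReal.ofReal_lt_top)]
  refine integral_congr_ae (Eventually.of_forall fun y => ?_)
  simp only [ENNReal.toReal_ofReal (hq0 y), smul_eq_mul]

lemma marginal_div_likelihood {𝓧 : Type*} {ℓ : 𝓧 → ℝ → ℝ} {q : ℝ → ℝ} (hqm : Measurable q)
    (hq0 : ∀ x, 0 ≤ q x) {k : ℕ} (y : Fin k → 𝓧) (θ : ℝ) :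
    marginal ℓ (densityOn s t q) k y / likelihood ℓ k y θ =
      ∫ x in Icc s t, q x * likRatio ℓ k y θ x := by
  rw [marginal, integral_densityOn hqm hq0, ← integral_div]
  simp only [likRatio, mul_div_assoc]

/-- The `α`-affinity between the marginal distribution and the `k`-sample distribution of the
parameter `θ`. -/
noncomputable def mixtureAffinity (μ : Measure 𝓨) (ℓ : 𝓨 → ℝ → ℝ) (s t α : ℝ) (q : ℝ → ℝ) (k : ℕ)
    (θ : ℝ) : ℝ :=
  ∫ y, (∫ x in Icc s t, q x * likRatio ℓ k y θ x) ^ α * likelihood ℓ k y θ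
    ∂(Measure.pi fun _ : Fin k => μ)

namespace SmoothFamily

lemma mixture_integrable (hF : SmoothFamily μ ℓ s t I sc) [SigmaFinite μ] {q : ℝ → ℝ}
    (hqm : Measurable q) (hq0 : ∀ x, 0 ≤ q x) (hqi : IntegrableOn q (Icc s t))
    (hq1 : ∫ x in Icc s t, q x = 1) {θ : ℝ} (hθ : θ ∈ Icc s t) (k : ℕ) :
    Integrable (fun y => ∫ x in Icc s t, q x * likRatio ℓ k y θ x)
        (Measure.pi fun _ : Fin k => obsLaw μ ℓ θ) ∧
      ∫ y, (∫ x in Icc s t, q x * likRatio ℓ k y θ x)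
        ∂(Measure.pi fun _ : Fin k => obsLaw μ ℓ θ) = 1 := by
  have hprob := hF.isProbabilityMeasure_obsLaw hθ
  set P := Measure.pi fun _ : Fin k => obsLaw μ ℓ θ with hP
  have hm : Measurable fun p : ℝ × (Fin k → 𝓨) => q p.1 * likRatio ℓ k p.2 θ p.1 :=
    (hqm.comp measurable_fst).mul ((hF.likRatio_measurable k θ).comp measurable_swap)
  have hsec : ∀ x ∈ Icc s t, ∫ y, q x * likRatio ℓ k y θ x ∂P = q x := fun x hx => by
    rw [integral_const_mul, (hF.likRatio_integrable hθ hx k).2, mul_one]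
  have hi : Integrable (fun p : ℝ × (Fin k → 𝓨) => q p.1 * likRatio ℓ k p.2 θ p.1)
      ((volume.restrict (Icc s t)).prod P) := by
    rw [integrable_prod_iff hm.aestronglyMeasurable]
    constructor
    · exact (ae_restrict_iff' measurableSet_Icc).2 (Eventually.of_forall fun x hx =>
        (hF.likRatio_integrable hθ hx k).1.const_mul (q x))
    · refine Integrable.congr hqi ((ae_restrict_iff' measurableSet_Icc).2
        (Eventually.of_forall fun x hx => ?_))
      simp only
      rw [← hsec x hx]
      congr 1; ext y
      rw [hsec x hx]
      exact (Real.norm_of_nonneg (mul_nonneg (hq0 x) (hF.likRatio_pos y hθ hx).le)).symm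
  refine ⟨hi.integral_prod_right, ?_⟩
  rw [← integral_integral_swap (f := fun x y => q x * likRatio ℓ k y θ x) hi,
    setIntegral_congr_fun measurableSet_Icc hsec, hq1]

lemma mixtureAffinity_eq (hF : SmoothFamily μ ℓ s t I sc) [SigmaFinite μ] {q : ℝ → ℝ} {α θ : ℝ}
    (hθ : θ ∈ Icc s t) (k : ℕ) :
    mixtureAffinity μ ℓ s t α q k θ = ∫ y, (∫ x in Icc s t, q x * likRatio ℓ k y θ x) ^ α
      ∂(Measure.pi fun _ : Fin k => obsLaw μ ℓ θ) :=
  (hF.integral_pi_obsLaw hθ _).symm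

lemma mixtureAffinity_measurable (hF : SmoothFamily μ ℓ s t I sc) [SigmaFinite μ] {q : ℝ → ℝ}
    (hqm : Measurable q) (α : ℝ) (k : ℕ) : Measurable (mixtureAffinity μ ℓ s t α q k) := by
  have h1 : Measurable fun p : ℝ × (Fin k → 𝓨) =>
      ∫ x in Icc s t, q x * likRatio ℓ k p.2 p.1 x := by
    have : Measurable fun r : (ℝ × (Fin k → 𝓨)) × ℝ => q r.2 * likRatio ℓ k r.1.2 r.1.1 r.2 := by
      refine (hqm.comp measurable_snd).mul (Measurable.div ?_ ?_)
      · exact (hF.likelihood_measurable k).comp (by fun_prop :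
          Measurable fun r : (ℝ × (Fin k → 𝓨)) × ℝ => (r.1.2, r.2))
      · exact (hF.likelihood_measurable k).comp (by fun_prop :
          Measurable fun r : (ℝ × (Fin k → 𝓨)) × ℝ => (r.1.2, r.1.1))
    exact this.stronglyMeasurable.integral_prod_right'.measurable
  have h2 : Measurable fun p : ℝ × (Fin k → 𝓨) =>
      (∫ x in Icc s t, q x * likRatio ℓ k p.2 p.1 x) ^ α * likelihood ℓ k p.2 p.1 :=
    (h1.pow_const α).mul ((hF.likelihood_measurable k).comp measurable_swap)
  exact h2.stronglyMeasurable.integral_prod_right'.measurable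

lemma mixture_nonneg (hF : SmoothFamily μ ℓ s t I sc) {q : ℝ → ℝ} (hq0 : ∀ x, 0 ≤ q x) {θ : ℝ}
    (hθ : θ ∈ Icc s t) {k : ℕ} (y : Fin k → 𝓨) : 0 ≤ ∫ x in Icc s t, q x * likRatio ℓ k y θ x :=
  setIntegral_nonneg measurableSet_Icc fun x hx => mul_nonneg (hq0 x) (hF.likRatio_pos y hθ hx).le

/-- The `α`-divergence is an affine function of the `α`-affinity. -/
lemma divergence_eq (hF : SmoothFamily μ ℓ s t I sc) [SigmaFinite μ] {q : ℝ → ℝ}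
    (hqm : Measurable q) (hq0 : ∀ x, 0 ≤ q x) (hqi : IntegrableOn q (Icc s t))
    (hq1 : ∫ x in Icc s t, q x = 1) {α : ℝ} (h0 : 0 < α) (h1 : α < 1) {θ : ℝ}
    (hθ : θ ∈ Icc s t) (k : ℕ) :
    divergence μ ℓ α (densityOn s t q) k θ =
      (mixtureAffinity μ ℓ s t α q k θ - 1) / (α * (α - 1)) := by
  have hprob := hF.isProbabilityMeasure_obsLaw hθ
  obtain ⟨i1, e1⟩ := hF.mixture_integrable hqm hq0 hqi hq1 hθ k
  have i2 := integrable_rpow_of_integrable h0 h1.le i1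
    (Eventually.of_forall fun y => hF.mixture_nonneg hq0 hθ y)
  simp only [divergence, marginal_div_likelihood hqm hq0]
  rw [← hF.integral_pi_obsLaw hθ, hF.mixtureAffinity_eq hθ]
  simp only [fAlpha]
  rw [integral_div]
  congr 1
  have i3 : Integrable (fun y => (∫ x in Icc s t, q x * likRatio ℓ k y θ x) ^ α -
      α * ∫ x in Icc s t, q x * likRatio ℓ k y θ x)
      (Measure.pi fun _ : Fin k => obsLaw μ ℓ θ) := i2.sub (i1.const_mul α)
  rw [integral_sub i3 (integrable_const _), integral_sub i2 (i1.const_mul α), integral_const_mul,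
    e1, integral_const]
  simp

lemma mixtureAffinity_mem (hF : SmoothFamily μ ℓ s t I sc) [SigmaFinite μ] {q : ℝ → ℝ}
    (hqm : Measurable q) (hq0 : ∀ x, 0 ≤ q x) (hqi : IntegrableOn q (Icc s t))
    (hq1 : ∫ x in Icc s t, q x = 1) {α : ℝ} (h0 : 0 < α) (h1 : α < 1) {θ : ℝ}
    (hθ : θ ∈ Icc s t) (k : ℕ) : mixtureAffinity μ ℓ s t α q k θ ∈ Icc 0 1 := by
  have hprob := hF.isProbabilityMeasure_obsLaw hθ
  obtain ⟨i1, e1⟩ := hF.mixture_integrable hqm hq0 hqi hq1 hθ k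
  rw [hF.mixtureAffinity_eq hθ]
  refine ⟨integral_nonneg fun y => Real.rpow_nonneg (hF.mixture_nonneg hq0 hθ y) _, ?_⟩
  refine (integral_rpow_le_rpow_integral h0 h1.le i1
    (Eventually.of_forall fun y => hF.mixture_nonneg hq0 hθ y)).trans ?_
  rw [e1, Real.one_rpow]

lemma mutualInfo_eq (hF : SmoothFamily μ ℓ s t I sc) [SigmaFinite μ] {q : ℝ → ℝ}
    (hqm : Measurable q) (hq0 : ∀ x, 0 ≤ q x) (hqi : IntegrableOn q (Icc s t))
    (hq1 : ∫ x in Icc s t, q x = 1) {α : ℝ} (h0 : 0 < α) (h1 : α < 1) (k : ℕ) :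
    mutualInfo μ ℓ α (densityOn s t q) k =
      ((∫ θ in Icc s t, q θ * mixtureAffinity μ ℓ s t α q k θ) - 1) / (α * (α - 1)) := by
  rw [mutualInfo, integral_densityOn hqm hq0]
  have e : ∀ θ ∈ Icc s t, q θ * divergence μ ℓ α (densityOn s t q) k θ =
      (q θ * mixtureAffinity μ ℓ s t α q k θ - q θ) / (α * (α - 1)) := fun θ hθ => by
    rw [hF.divergence_eq hqm hq0 hqi hq1 h0 h1 hθ]; ring
  rw [setIntegral_congr_fun measurableSet_Icc e, integral_div, integral_sub, hq1]
  · refine Integrable.mono' hqi (hqm.mul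
      (hF.mixtureAffinity_measurable hqm α k)).aestronglyMeasurable
      ((ae_restrict_iff' measurableSet_Icc).2 (Eventually.of_forall fun θ hθ => ?_))
    obtain ⟨b0, b1⟩ := hF.mixtureAffinity_mem hqm hq0 hqi hq1 h0 h1 hθ k
    rw [Real.norm_of_nonneg (mul_nonneg (hq0 θ) b0)]
    exact mul_le_of_le_one_right (hq0 θ) b1
  · exact hqi

/-- First order expansion of the `α`-mutual information of a prior with a continuous density. The
endpoints, where the local limit is different, form a null set. -/
theorem tendsto_mutualInfo (hF : SmoothFamily μ ℓ s t I sc) [SigmaFinite μ] {q : ℝ → ℝ}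
    (hqm : Measurable q) (hq0 : ∀ x, 0 ≤ q x) (hqc : ContinuousOn q (Icc s t))
    (hq1 : ∫ x in Icc s t, q x = 1) {α : ℝ} (h0 : 0 < α) (h1 : α < 1) :
    Tendsto (fun k : ℕ => (k : ℝ) ^ (α / 2) *
      (mutualInfo μ ℓ α (densityOn s t q) k + 1 / (α * (α - 1)))) atTop
      (𝓝 (limitConst α * (∫ x in Icc s t, q x * (q x ^ α * (√(I x) ^ α)⁻¹)) /
        (α * (α - 1)))) := by
  have hqi : IntegrableOn q (Icc s t) := hqc.integrableOn_Icc
  obtain ⟨B, hB⟩ := isCompact_Icc.bddAbove_image hqc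
  have hqB : ∀ x ∈ Icc s t, q x ≤ B := fun x hx => hB (mem_image_of_mem _ hx)
  have hB0 : 0 ≤ B := (hq0 s).trans (hqB s (left_mem_Icc.2 hF.lt.le))
  obtain ⟨c, -, D, hD, hbd⟩ := hF.exists_moment_bound_setIntegral h0 h1
  have hscale : ∀ θ ∈ Icc s t, ∀ k : ℕ, (k : ℝ) ^ (α / 2) * mixtureAffinity μ ℓ s t α q k θ =
      ∫ y, (√k * ∫ x in Icc s t, q x * likRatio ℓ k y θ x) ^ α
        ∂(Measure.pi fun _ : Fin k => obsLaw μ ℓ θ) := by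
    intro θ hθ k
    rw [hF.mixtureAffinity_eq hθ, ← integral_const_mul]
    congr 1; ext y
    rw [Real.mul_rpow (Real.sqrt_nonneg _) (hF.mixture_nonneg hq0 hθ y), Real.sqrt_eq_rpow,
      ← Real.rpow_mul (Nat.cast_nonneg k)]
    congr 2; ring
  have hbound : ∀ θ ∈ Icc s t, ∀ k : ℕ,
      ∫ y, (√k * ∫ x in Icc s t, q x * likRatio ℓ k y θ x) ^ α
        ∂(Measure.pi fun _ : Fin k => obsLaw μ ℓ θ) ≤ B ^ α * D := by
    intro θ hθ k
    obtain ⟨i, b⟩ := hbd θ hθ s t 0 le_rfl le_rfl le_rfl (fun x _ => abs_nonneg _) k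
    refine (integral_mono_of_nonneg (Eventually.of_forall fun y => Real.rpow_nonneg
      (mul_nonneg (Real.sqrt_nonneg _) (hF.mixture_nonneg hq0 hθ y)) _) (i.const_mul (B ^ α))
      (Eventually.of_forall fun y => ?_)).trans ?_
    · have hn : 0 ≤ ∫ x in Icc s t, likRatio ℓ k y θ x :=
        setIntegral_nonneg measurableSet_Icc fun x hx => (hF.likRatio_pos y hθ hx).le
      simp only
      rw [← Real.mul_rpow hB0 (mul_nonneg (Real.sqrt_nonneg _) hn)]
      refine Real.rpow_le_rpow (mul_nonneg (Real.sqrt_nonneg _) (hF.mixture_nonneg hq0 hθ y)) ?_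
        h0.le
      rw [mul_left_comm]
      refine mul_le_mul_of_nonneg_left ?_ (Real.sqrt_nonneg _)
      rw [← integral_const_mul]
      refine setIntegral_mono_on ?_ ?_ measurableSet_Icc fun x hx =>
        mul_le_mul_of_nonneg_right (hqB x hx) (hF.likRatio_pos y hθ hx).le
      · exact (hqc.mul (hF.likRatio_cont y θ)).integrableOn_Icc
      · exact ((hF.likRatio_cont y θ).integrableOn_Icc).const_mul B
    · rw [integral_const_mul]
      refine mul_le_mul_of_nonneg_left (b.trans_eq ?_) (Real.rpow_nonneg hB0 _)
      simp
  have hlim : Tendsto (fun k : ℕ => ∫ θ in Icc s t,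
      q θ * ((k : ℝ) ^ (α / 2) * mixtureAffinity μ ℓ s t α q k θ)) atTop
      (𝓝 (∫ θ in Icc s t, q θ * (q θ ^ α * limitConst α * (√(I θ) ^ α)⁻¹))) := by
    refine tendsto_integral_of_dominated_convergence (fun θ => q θ * (B ^ α * D)) (fun k => ?_)
      (hqi.mul_const _) (fun k => ?_) ?_
    · exact (hqm.mul ((hF.mixtureAffinity_measurable hqm α k).const_mul _)).aestronglyMeasurable
    · refine (ae_restrict_iff' measurableSet_Icc).2 (Eventually.of_forall fun θ hθ => ?_)
      obtain ⟨b0, -⟩ := hF.mixtureAffinity_mem hqm hq0 hqi hq1 h0 h1 hθ k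
      rw [Real.norm_of_nonneg (mul_nonneg (hq0 θ) (by positivity)), hscale θ hθ]
      exact mul_le_mul_of_nonneg_left (hbound θ hθ k) (hq0 θ)
    · rw [← restrict_Ioo_eq_restrict_Icc]
      refine (ae_restrict_iff' measurableSet_Ioo).2 (Eventually.of_forall fun θ hθ => ?_)
      refine Tendsto.const_mul _ ?_
      simp_rw [hscale θ (Ioo_subset_Icc_self hθ)]
      exact hF.tendsto_moment_at h0 h1 hθ hqm hq0 hqB hqc
  have e2 : ∫ θ in Icc s t, q θ * (q θ ^ α * limitConst α * (√(I θ) ^ α)⁻¹) =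
      limitConst α * ∫ x in Icc s t, q x * (q x ^ α * (√(I x) ^ α)⁻¹) := by
    rw [← integral_const_mul]
    congr 1; ext x; ring
  rw [e2] at hlim
  refine (hlim.div_const (α * (α - 1))).congr fun k => ?_
  rw [hF.mutualInfo_eq hqm hq0 hqi hq1 h0 h1]
  have e3 : ∫ θ in Icc s t, q θ * ((k : ℝ) ^ (α / 2) * mixtureAffinity μ ℓ s t α q k θ) =
      (k : ℝ) ^ (α / 2) * ∫ θ in Icc s t, q θ * mixtureAffinity μ ℓ s t α q k θ := by
    rw [← integral_const_mul]
    congr 1; ext x; ring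
  rw [e3]
  ring

end SmoothFamily

end

/-! ### Regular models as smooth families -/

section

variable {𝓨 : Type*} [MeasurableSpace 𝓨] {μ : Measure 𝓨} {ℓ ℓ₁ : 𝓨 → ℝ → ℝ} {Θ : Set ℝ} {s t : ℝ}

lemma fisherInfo_congr (he : ∀ᵐ y ∂μ, ℓ y = ℓ₁ y) : fisherInfo μ ℓ Θ = fisherInfo μ ℓ₁ Θ := by
  ext θ
  rw [fisherInfo, fisherInfo]
  congr 1
  refine integral_congr_ae ?_
  filter_upwards [he] with y hy
  simp only [hy]

lemma mutualInfo_congr [SigmaFinite μ] (he : ∀ᵐ y ∂μ, ℓ y = ℓ₁ y) (α : ℝ) (π : Measure ℝ)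
    (k : ℕ) : mutualInfo μ ℓ α π k = mutualInfo μ ℓ₁ α π k := by
  have h : ∀ᵐ y ∂(Measure.pi fun _ : Fin k => μ), ∀ j, ℓ (y j) = ℓ₁ (y j) :=
    ae_all_iff.2 fun j =>
      (Measure.tendsto_eval_ae_ae (μ := fun _ : Fin k => μ) (i := j)).eventually he
  rw [mutualInfo, mutualInfo]
  congr 1; ext θ
  rw [divergence, divergence]
  refine integral_congr_ae ?_
  filter_upwards [h] with y hy
  simp only [marginal, likelihood, hy]

lemma RegularModel.congr (h : RegularModel μ ℓ Θ) (hm : Measurable (Function.uncurry ℓ₁))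
    (he : ∀ᵐ y ∂μ, ℓ y = ℓ₁ y) : RegularModel μ ℓ₁ Θ where
  measurable := hm
  integral_eq_one θ hθ := by
    rw [← h.integral_eq_one θ hθ]
    exact integral_congr_ae (he.mono fun y hy => by simp only [hy])
  pos := by filter_upwards [h.pos, he] with y h1 h2; rwa [← h2]
  contDiffOn := by filter_upwards [h.contDiffOn, he] with y h1 h2; rwa [← h2]
  identifiable θ hθ θ' hθ' hh := h.identifiable θ hθ θ' hθ' (by
    filter_upwards [hh, he] with y h1 h2; rw [h2]; exact h1)
  integrable_deriv θ hθ := (h.integrable_deriv θ hθ).congr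
    (he.mono fun y hy => by simp only [hy])
  integral_deriv θ hθ := by
    rw [← h.integral_deriv θ hθ]
    exact integral_congr_ae (he.mono fun y hy => by simp only [hy])
  integrable_deriv2 θ hθ := (h.integrable_deriv2 θ hθ).congr
    (he.mono fun y hy => by simp only [hy])
  integral_deriv2 θ hθ := by
    rw [← h.integral_deriv2 θ hθ]
    exact integral_congr_ae (he.mono fun y hy => by simp only [hy])
  dominated θ hθ := by
    obtain ⟨τ, hτ, H, hi, hb⟩ := h.dominated θ hθ
    refine ⟨τ, hτ, H, hi.congr (he.mono fun y hy => by simp only [hy]), ?_⟩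
    filter_upwards [hb, he] with y h1 h2
    rwa [← h2]
  fisher_pos θ hθ := by rw [← fisherInfo_congr he]; exact h.fisher_pos θ hθ
  fisher_continuousOn := by rw [← fisherInfo_congr he]; exact h.fisher_continuousOn

/-- After a modification on a null set of observations, the regularity of the likelihood holds for
every observation. -/
lemma RegularModel.exists_regular_version (h : RegularModel μ ℓ Θ) :
    ∃ ℓ₁ : 𝓨 → ℝ → ℝ, RegularModel μ ℓ₁ Θ ∧ (∀ᵐ y ∂μ, ℓ y = ℓ₁ y) ∧
      (∀ y, ∀ θ ∈ Θ, 0 < ℓ₁ y θ) ∧ ∀ y, ContDiffOn ℝ 2 (ℓ₁ y) Θ := by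
  obtain ⟨N, hN, hNm, hN0⟩ := exists_measurable_superset_of_null
    (ae_iff.1 (h.pos.and h.contDiffOn))
  have hgood : ∀ y ∉ N, (∀ θ ∈ Θ, 0 < ℓ y θ) ∧ ContDiffOn ℝ 2 (ℓ y) Θ := fun y hy => by
    by_contra hc
    exact hy (hN hc)
  classical
  let ℓ₁ : 𝓨 → ℝ → ℝ := fun y θ => if y ∈ N then 1 else ℓ y θ
  have he : ∀ᵐ y ∂μ, ℓ y = ℓ₁ y := by
    filter_upwards [measure_eq_zero_iff_ae_notMem.1 hN0] with y hy
    ext θ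
    simp only [ℓ₁, hy, if_false]
  have hm : Measurable (Function.uncurry ℓ₁) :=
    Measurable.ite (measurable_fst hNm) measurable_const h.measurable
  refine ⟨ℓ₁, h.congr hm he, he, fun y θ hθ => ?_, fun y => ?_⟩
  · by_cases hy : y ∈ N
    · simp [ℓ₁, hy]
    · simpa [ℓ₁, hy] using (hgood y hy).1 θ hθ
  · by_cases hy : y ∈ N
    · simpa [ℓ₁, hy] using contDiffOn_const
    · simpa [ℓ₁, hy] using (hgood y hy).2

/-- Second order Taylor bound: the remainder is controlled by the oscillation of the second
derivative. -/
lemma abs_taylor_remainder_le {g g' g'' : ℝ → ℝ} {S : Set ℝ} (hS : Convex ℝ S)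
    (hg : ∀ x ∈ S, HasDerivWithinAt g (g' x) S x) (hg' : ∀ x ∈ S, HasDerivWithinAt g' (g'' x) S x)
    {θ M : ℝ} (hθ : θ ∈ S) (hM : ∀ x ∈ S, |g'' x - g'' θ| ≤ M) {x : ℝ} (hx : x ∈ S) :
    |g x - g θ - (x - θ) * g' θ - (x - θ) ^ 2 / 2 * g'' θ| ≤ (x - θ) ^ 2 * M := by
  have hM0 : 0 ≤ M := (abs_nonneg _).trans (hM θ hθ)
  have h1 : ∀ z ∈ S, |g' z - g' θ - (z - θ) * g'' θ| ≤ M * |z - θ| := by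
    intro z hz
    have := hS.norm_image_sub_le_of_norm_hasDerivWithin_le (f := fun z => g' z - z * g'' θ)
      (f' := fun z => g'' z - g'' θ) (C := M)
      (fun w hw => by
        simpa using (hg' w hw).fun_sub ((hasDerivAt_id' w).hasDerivWithinAt.mul_const (g'' θ)))
      (fun w hw => hM w hw) hθ hz
    simp only [Real.norm_eq_abs] at this
    convert this using 2
    ring
  have hS' : Convex ℝ (S ∩ Metric.closedBall θ |x - θ|) := hS.inter (convex_closedBall _ _)
  have := hS'.norm_image_sub_le_of_norm_hasDerivWithin_le
      (f := fun z => g z - z * g' θ - (z - θ) ^ 2 / 2 * g'' θ)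
      (f' := fun z => g' z - g' θ - (z - θ) * g'' θ) (C := M * |x - θ|)
      (fun w hw => by
        have e1 := ((hg w hw.1).mono (inter_subset_left (t := Metric.closedBall θ |x - θ|))).sub
          ((hasDerivWithinAt_id w _).mul_const (g' θ))
        have e2 := ((((hasDerivWithinAt_id w (S ∩ Metric.closedBall θ |x - θ|)).sub_const θ).pow
          2).div_const 2).mul_const (g'' θ)
        refine (e1.sub e2).congr_deriv ?_
        simp)
      (fun w hw => by
        refine (h1 w hw.1).trans (mul_le_mul_of_nonneg_left ?_ hM0)
        simpa [Real.dist_eq] using hw.2)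
      ⟨hθ, by simp⟩ ⟨hx, by simp [Real.dist_eq]⟩
  simp only [Real.norm_eq_abs] at this
  rw [mul_assoc, ← sq, sq_abs] at this
  rw [mul_comm _ M]
  convert this using 2
  ring

/-- The derivative at `p` is a limit of difference quotients along points of `[s, t]`. -/
lemma measurable_derivWithin_of_Icc_subset (hm : Measurable (Function.uncurry ℓ))
    (hd : ∀ y, DifferentiableOn ℝ (ℓ y) Θ) (hst : s < t) (hsub : Icc s t ⊆ Θ) {p : ℝ}
    (hp : p ∈ Icc s t) : Measurable fun y => derivWithin (ℓ y) Θ p := by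
  obtain ⟨p', hp', hne⟩ : ∃ p' ∈ Icc s t, p' ≠ p := by
    by_cases h : p = s
    · exact ⟨t, right_mem_Icc.2 hst.le, by rw [h]; exact hst.ne'⟩
    · exact ⟨s, left_mem_Icc.2 hst.le, fun h' => h h'.symm⟩
  have hu : Tendsto (fun n : ℕ => p + (1 / ((n : ℝ) + 1)) * (p' - p)) atTop (𝓝[Θ \ {p}] p) := by
    refine tendsto_nhdsWithin_iff.2 ⟨?_, Eventually.of_forall fun n => ⟨hsub ?_, ?_⟩⟩
    · have := (tendsto_one_div_add_atTop_nhds_zero_nat (𝕜 := ℝ)).mul_const (p' - p)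
      simpa using this.const_add p
    · have h1 : (1 : ℝ) / ((n : ℝ) + 1) ≤ 1 := by
        rw [div_le_one (by positivity)]; linarith [Nat.cast_nonneg (α := ℝ) n]
      have := (convex_Icc s t) hp hp' (a := 1 - 1 / ((n : ℝ) + 1)) (b := 1 / ((n : ℝ) + 1))
        (by linarith) (by positivity) (by ring)
      simp only [smul_eq_mul] at this
      convert this using 1
      ring
    · simp only [mem_singleton_iff, add_eq_left, mul_eq_zero, not_or]
      exact ⟨by positivity, sub_ne_zero.2 hne⟩
  have hlim : ∀ y, Tendsto (fun n : ℕ => slope (ℓ y) p (p + (1 / ((n : ℝ) + 1)) * (p' - p))) atTop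
      (𝓝 (derivWithin (ℓ y) Θ p)) := fun y =>
    (hasDerivWithinAt_iff_tendsto_slope.1 ((hd y) p (hsub hp)).hasDerivWithinAt).comp hu
  refine measurable_of_tendsto_metrizable (fun n => ?_) (tendsto_pi_nhds.2 hlim)
  simp only [slope_def_field]
  exact ((hm.of_uncurry_right).sub (hm.of_uncurry_right)).div_const _

/-- The score `∂_θ log ℓ(y|θ)` on `[s, t]`, extended to the real line by constants. -/
noncomputable def score {𝓧 : Type*} (ℓ : 𝓧 → ℝ → ℝ) (Θ : Set ℝ) {s t : ℝ} (h : s ≤ t) (y : 𝓧)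
    (θ : ℝ) : ℝ :=
  derivWithin (ℓ y) Θ (projIcc s t h θ) / ℓ y (projIcc s t h θ)

lemma score_of_mem {𝓧 : Type*} {ℓ : 𝓧 → ℝ → ℝ} (h : s ≤ t) {θ : ℝ} (hθ : θ ∈ Icc s t) (y : 𝓧) :
    score ℓ Θ h y θ = derivWithin (ℓ y) Θ θ / ℓ y θ := by
  rw [score, projIcc_of_mem h hθ]

lemma hasDerivWithinAt_log_likelihood {f : ℝ → ℝ} (hf : ContDiffOn ℝ 2 f Θ)
    (h0 : ∀ θ ∈ Θ, 0 < f θ) {x : ℝ} (hx : x ∈ Θ) :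
    HasDerivWithinAt (fun t => Real.log (f t)) (derivWithin f Θ x / f x) Θ x :=
  ((hf.differentiableOn (by norm_num)) x hx).hasDerivWithinAt.log (h0 x hx).ne'

lemma iteratedDerivWithin_two_log {f : ℝ → ℝ} (hf : ContDiffOn ℝ 2 f Θ) (h0 : ∀ θ ∈ Θ, 0 < f θ)
    (hΘ : UniqueDiffOn ℝ Θ) {x : ℝ} (hx : x ∈ Θ) :
    HasDerivWithinAt (fun t => derivWithin f Θ t / f t)
      (iteratedDerivWithin 2 (fun t => Real.log (f t)) Θ x) Θ x ∧
    iteratedDerivWithin 2 (fun t => Real.log (f t)) Θ x =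
      iteratedDerivWithin 2 f Θ x / f x - (derivWithin f Θ x / f x) ^ 2 := by
  have hD : ContDiffOn ℝ 1 (derivWithin f Θ) Θ := hf.derivWithin hΘ (by norm_num)
  have two : ∀ g : ℝ → ℝ, iteratedDerivWithin 2 g Θ x = derivWithin (derivWithin g Θ) Θ x := by
    intro g
    rw [iteratedDerivWithin_succ]
    exact derivWithin_congr (fun z _ => congrFun iteratedDerivWithin_one z)
      (congrFun iteratedDerivWithin_one x)
  have e1 := ((hD.differentiableOn (by norm_num)) x hx).hasDerivWithinAt
  have e2 := ((hf.differentiableOn (by norm_num)) x hx).hasDerivWithinAt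
  have e3 := e1.fun_div e2 (h0 x hx).ne'
  have e4 : iteratedDerivWithin 2 (fun t => Real.log (f t)) Θ x =
      (derivWithin (derivWithin f Θ) Θ x * f x - derivWithin f Θ x * derivWithin f Θ x) /
        f x ^ 2 := by
    rw [two, ← e3.derivWithin (hΘ x hx)]
    exact derivWithin_congr (fun z hz =>
      (hasDerivWithinAt_log_likelihood hf h0 hz).derivWithin (hΘ z hz))
      ((hasDerivWithinAt_log_likelihood hf h0 hx).derivWithin (hΘ x hx))
  refine ⟨by rw [e4]; exact e3, ?_⟩
  rw [e4, two]
  have := (h0 x hx).ne'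
  field_simp

/-- A regular model, restricted to a compact interval of parameters, is a smooth family. The
identity `∫ (∂ log ℓ)² ℓ = I` comes from `∂² log ℓ = ∂² ℓ / ℓ - (∂ log ℓ)²` and `∫ ∂² ℓ = 0`. -/
lemma RegularModel.smoothFamily (h : RegularModel μ ℓ Θ) (hpos : ∀ y, ∀ θ ∈ Θ, 0 < ℓ y θ)
    (hC : ∀ y, ContDiffOn ℝ 2 (ℓ y) Θ) (hΘ : UniqueDiffOn ℝ Θ) (hst : s < t)
    (hsub : Icc s t ⊆ Θ) :
    SmoothFamily μ ℓ s t (fisherInfo μ ℓ Θ) (score ℓ Θ hst.le) := by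
  have hdiff : ∀ y, DifferentiableOn ℝ (ℓ y) Θ := fun y => (hC y).differentiableOn (by norm_num)
  have hDc : ∀ y, ContinuousOn (derivWithin (ℓ y) Θ) Θ := fun y =>
    (hC y).continuousOn_derivWithin hΘ (by norm_num)
  have hscl : ∀ θ ∈ Icc s t, ∀ y, score ℓ Θ hst.le y θ * ℓ y θ = derivWithin (ℓ y) Θ θ := by
    intro θ hθ y
    rw [score_of_mem hst.le hθ, div_mul_cancel₀ _ (hpos y θ (hsub hθ)).ne']
  have hscc : ∀ y, Continuous (score ℓ Θ hst.le y) := by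
    intro y
    have hp : ∀ θ, ((projIcc s t hst.le θ : Icc s t) : ℝ) ∈ Θ := fun θ => hsub (projIcc s t _ θ).2
    have hpc : Continuous fun θ => ((projIcc s t hst.le θ : Icc s t) : ℝ) :=
      continuous_subtype_val.comp continuous_projIcc
    exact ((hDc y).comp_continuous hpc hp).div ((hC y).continuousOn.comp_continuous hpc hp)
      fun θ => (hpos y _ (hp θ)).ne'
  have hℓm : ∀ θ, Measurable fun y => ℓ y θ := fun θ => h.measurable.of_uncurry_right
  have hscm : ∀ θ, Measurable fun y => score ℓ Θ hst.le y θ := fun θ =>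
    (measurable_derivWithin_of_Icc_subset h.measurable hdiff hst hsub
      (projIcc s t hst.le θ).2).div (hℓm _)
  set hs : ℝ → 𝓨 → ℝ := fun θ y => iteratedDerivWithin 2 (fun t => Real.log (ℓ y t)) Θ θ with hhs
  have hs_eq : ∀ θ ∈ Icc s t, ∀ y,
      hs θ y = iteratedDerivWithin 2 (ℓ y) Θ θ / ℓ y θ - score ℓ Θ hst.le y θ ^ 2 := by
    intro θ hθ y
    rw [score_of_mem hst.le hθ]
    exact (iteratedDerivWithin_two_log (hC y) (hpos y) hΘ (hsub hθ)).2
  have hs_aesm : ∀ θ ∈ Icc s t, AEStronglyMeasurable (hs θ) μ := by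
    intro θ hθ
    have : hs θ = fun y => iteratedDerivWithin 2 (ℓ y) Θ θ / ℓ y θ - score ℓ Θ hst.le y θ ^ 2 :=
      funext (hs_eq θ hθ)
    rw [this]
    have h1 := (h.integrable_deriv2 θ (hsub hθ)).aestronglyMeasurable.aemeasurable
    exact ((h1.div (hℓm θ).aemeasurable).sub
      ((hscm θ).pow_const 2).aemeasurable).aestronglyMeasurable
  have hs_int : ∀ θ ∈ Icc s t, Integrable (fun y => hs θ y * ℓ y θ) μ := by
    intro θ hθ
    obtain ⟨τ, hτ, H, hi, hb⟩ := h.dominated θ (hsub hθ)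
    refine hi.mono' ((hs_aesm θ hθ).mul (hℓm θ).aestronglyMeasurable) ?_
    filter_upwards [hb] with y hy
    rw [norm_mul, Real.norm_eq_abs, Real.norm_of_nonneg (hpos y θ (hsub hθ)).le]
    exact mul_le_mul_of_nonneg_right (hy θ (hsub hθ) (by simpa using hτ)) (hpos y θ (hsub hθ)).le
  have hs_val : ∀ θ, ∫ y, hs θ y * ℓ y θ ∂μ = -fisherInfo μ ℓ Θ θ := fun θ => by
    rw [fisherInfo, neg_neg]
  have hsq : ∀ θ ∈ Icc s t, ∀ y, score ℓ Θ hst.le y θ ^ 2 * ℓ y θ =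
      iteratedDerivWithin 2 (ℓ y) Θ θ - hs θ y * ℓ y θ := by
    intro θ hθ y
    rw [hs_eq θ hθ, sub_mul, div_mul_cancel₀ _ (hpos y θ (hsub hθ)).ne']
    ring
  have hsq_fun : ∀ θ ∈ Icc s t, (fun y => score ℓ Θ hst.le y θ ^ 2 * ℓ y θ) =
      fun y => iteratedDerivWithin 2 (ℓ y) Θ θ - hs θ y * ℓ y θ := fun θ hθ => funext (hsq θ hθ)
  refine
    { lt := hst
      measurable := h.measurable
      pos := fun y θ hθ => hpos y θ (hsub hθ)
      cont := fun y => (hC y).continuousOn.mono hsub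
      score_measurable := ?_
      score_cont := fun y => (hscc y).continuousOn
      hasDerivAt := ?_
      integral_eq_one := fun θ hθ => h.integral_eq_one θ (hsub hθ)
      identifiable := fun θ hθ θ' hθ' => h.identifiable θ (hsub hθ) θ' (hsub hθ')
      score_integral := ?_
      sq_integrable := ?_
      sq_integral := ?_
      info_pos := fun θ hθ => h.fisher_pos θ (hsub hθ)
      info_cont := h.fisher_continuousOn.mono hsub
      expansion := ?_ }
  · exact (measurable_uncurry_of_continuous_of_measurable (u := fun θ y => score ℓ Θ hst.le y θ)
      hscc hscm).comp measurable_swap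
  · intro y θ hθ
    have hθ' := Ioo_subset_Icc_self hθ
    rw [hscl θ hθ']
    exact ((hdiff y) θ (hsub hθ')).hasDerivWithinAt.hasDerivAt
      (mem_of_superset (Icc_mem_nhds hθ.1 hθ.2) hsub)
  · intro θ hθ
    simp only [hscl θ hθ]
    exact h.integral_deriv θ (hsub hθ)
  · intro θ hθ
    rw [hsq_fun θ hθ]
    exact (h.integrable_deriv2 θ (hsub hθ)).sub (hs_int θ hθ)
  · intro θ hθ
    rw [hsq_fun θ hθ, integral_sub (h.integrable_deriv2 θ (hsub hθ)) (hs_int θ hθ),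
      h.integral_deriv2 θ (hsub hθ), hs_val]
    ring
  · intro θ hθ
    have hθ' := Ioo_subset_Icc_self hθ
    have hd1 : ∀ y, ∀ x ∈ Icc s t, HasDerivWithinAt (fun t => Real.log (ℓ y t))
        (derivWithin (ℓ y) Θ x / ℓ y x) (Icc s t) x := fun y x hx =>
      (hasDerivWithinAt_log_likelihood (hC y) (hpos y) (hsub hx)).mono hsub
    have hd2 : ∀ y, ∀ x ∈ Icc s t, HasDerivWithinAt (fun t => derivWithin (ℓ y) Θ t / ℓ y t)
        (hs x y) (Icc s t) x := fun y x hx =>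
      (iteratedDerivWithin_two_log (hC y) (hpos y) hΘ (hsub hx)).1.mono hsub
    obtain ⟨τ, hτ, H, hi, hb⟩ := h.dominated θ (hsub hθ')
    refine ⟨hs θ, hs_aesm θ hθ', hs_int θ hθ', hs_val θ, τ, hτ, fun y => 2 * H y, ?_, ?_, ?_⟩
    · simpa only [mul_assoc] using hi.const_mul 2
    · filter_upwards [hb] with y hy x hx hxm
      have hS : Icc s t ∩ Metric.ball θ τ ⊆ Icc s t := inter_subset_left
      have := abs_taylor_remainder_le (S := Icc s t ∩ Metric.ball θ τ) (θ := θ) (M := 2 * H y)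
        ((convex_Icc s t).inter (convex_ball θ τ))
        (fun z hz => (hd1 y z hz.1).mono hS) (fun z hz => (hd2 y z hz.1).mono hS)
        ⟨hθ', by simpa using hτ⟩ (fun z hz => by
          have b1 := hy z (hsub hz.1) (by simpa [Real.dist_eq] using hz.2)
          have b2 := hy θ (hsub hθ') (by simpa using hτ)
          have b3 := abs_sub (hs z y) (hs θ y)
          simp only [hhs] at b3 ⊢
          linarith) (x := θ + x) ⟨hxm, by simpa [Real.dist_eq] using hx⟩
      simpa [score_of_mem hst.le hθ'] using this
    · refine Eventually.of_forall fun y => ?_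
      have hcont : ContinuousWithinAt (fun x => hs x y) (Icc s t) θ := by
        have : ContDiffOn ℝ 2 (fun t => Real.log (ℓ y t)) Θ :=
          (hC y).log fun x hx => (hpos y x hx).ne'
        exact ((this.continuousOn_iteratedDerivWithin (m := 2) le_rfl hΘ).mono hsub) θ hθ'
      rw [Metric.tendsto_nhds]
      intro ε hε
      have h1 : ∀ᶠ x in 𝓝 θ, |hs x y - hs θ y| ≤ ε / 2 := by
        have := hcont.continuousAt (Icc_mem_nhds hθ.1 hθ.2)
        filter_upwards [Metric.tendsto_nhds.1 this (ε / 2) (by positivity)] with x hx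
        rw [Real.dist_eq] at hx
        exact hx.le
      obtain ⟨δ, hδ, hball⟩ := Metric.eventually_nhds_iff_ball.1
        (h1.and (Icc_mem_nhds hθ.1 hθ.2))
      have h2 : ∀ᶠ x in 𝓝[≠] (0 : ℝ), |x| < δ := by
        refine nhdsWithin_le_nhds ?_
        filter_upwards [Metric.ball_mem_nhds (0 : ℝ) hδ] with x hx
        simpa using hx
      filter_upwards [h2, self_mem_nhdsWithin] with x hx hx0
      have hSs : Metric.ball θ δ ⊆ Icc s t := fun z hz => (hball z hz).2
      have := abs_taylor_remainder_le (S := Metric.ball θ δ) (θ := θ) (M := ε / 2)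
        (convex_ball θ δ)
        (fun z hz => (hd1 y z (hSs hz)).mono hSs) (fun z hz => (hd2 y z (hSs hz)).mono hSs)
        (by simpa using hδ) (fun z hz => (hball z hz).1) (x := θ + x)
        (by simpa [Real.dist_eq] using hx)
      have hx2 : 0 < x ^ 2 := by have : x ≠ 0 := hx0; positivity
      rw [score_of_mem hst.le hθ', Real.dist_eq, sub_zero, abs_div, abs_of_pos hx2,
        div_lt_iff₀ hx2]
      simp only [add_sub_cancel_left] at this
      refine this.trans_lt ?_
      nlinarith

end

/-! ### The asymptotically optimal exponent -/

/-- The functional of the prior with density proportional to `g ^ u` on `K` that governs the first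
order of the mutual information; `w` is the density of the Jeffreys prior. -/
noncomputable def priorObjective (g w : ℝ → ℝ) (α : ℝ) (K : Set ℝ) (u : ℝ) : ℝ :=
  (∫ x in K, g x ^ (u * (1 + α)) * (w x ^ α)⁻¹) / (∫ x in K, g x ^ u) ^ (1 + α)

lemma continuousOn_rpow_Icc {m M : ℝ} (hm : 0 < m) (v : ℝ) :
    ContinuousOn (fun x : ℝ => x ^ v) (Icc m M) :=
  continuousOn_id.rpow_const fun _ hx => Or.inl (hm.trans_le hx.1).ne'

lemma setIntegral_rpow_pos {m M : ℝ} (hm : 0 < m) (hmM : m < M) (v : ℝ) :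
    0 < ∫ x in Icc m M, x ^ v := by
  rw [integral_Icc_eq_integral_Ioc, ← intervalIntegral.integral_of_le hmM.le]
  refine intervalIntegral.intervalIntegral_pos_of_pos_on ?_
    (fun x hx => Real.rpow_pos_of_pos (hm.trans hx.1) _) hmM
  exact ((continuousOn_rpow_Icc hm v).intervalIntegrable_of_Icc hmM.le)

lemma continuous_setIntegral_rpow_mul {m M : ℝ} (hm : 0 < m) (hmM : m < M) {h : ℝ → ℝ}
    (hh : ContinuousOn h (Icc m M)) (c : ℝ) :
    Continuous fun u : ℝ => ∫ x in Icc m M, x ^ (u * c) * h x := by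
  have hp : Continuous fun x : ℝ => h (projIcc m M hmM.le x) :=
    hh.comp_continuous (continuous_subtype_val.comp continuous_projIcc)
      fun x => (projIcc m M hmM.le x).2
  have hl : Continuous fun x : ℝ => Real.log (max x m) :=
    (continuous_id.max continuous_const).log fun x => (hm.trans_le (le_max_right _ _)).ne'
  have hc : Continuous (Function.uncurry fun (u x : ℝ) =>
      Real.exp (Real.log (max x m) * (u * c)) * h (projIcc m M hmM.le x)) := by
    simp only [Function.uncurry_def]
    exact (Real.continuous_exp.comp ((hl.comp continuous_snd).mul
      (continuous_fst.mul continuous_const))).mul (hp.comp continuous_snd)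
  refine (continuous_parametric_integral_of_continuous (μ := volume) hc
    (isCompact_Icc (a := m) (b := M))).congr fun u => ?_
  refine setIntegral_congr_fun measurableSet_Icc fun x hx => ?_
  rw [projIcc_of_mem hmM.le hx, max_eq_left hx.1, Real.rpow_def_of_pos (hm.trans_le hx.1)]

lemma priorObjective_continuous {m M α : ℝ} {w : ℝ → ℝ} (hm : 0 < m) (hmM : m < M)
    (hw : ContinuousOn w (Icc m M)) (hw0 : ∀ x ∈ Icc m M, 0 < w x) :
    Continuous (priorObjective id w α (Icc m M)) := by
  have h1 : ContinuousOn (fun x => (w x ^ α)⁻¹) (Icc m M) :=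
    (hw.rpow_const fun x hx => Or.inl (hw0 x hx).ne').inv₀
      fun x hx => (Real.rpow_pos_of_pos (hw0 x hx) _).ne'
  refine (continuous_setIntegral_rpow_mul hm hmM h1 (1 + α)).div ?_ ?_
  · refine Continuous.rpow_const ?_ fun u => Or.inl (setIntegral_rpow_pos hm hmM u).ne'
    simpa using continuous_setIntegral_rpow_mul hm hmM (h := fun _ => 1) continuousOn_const 1
  · exact fun u => (Real.rpow_pos_of_pos (setIntegral_rpow_pos hm hmM u) _).ne'

lemma setIntegral_rpow_eq {m M : ℝ} (hm : 0 < m) (hmM : m < M) {v : ℝ} (hv : v ≠ -1) :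
    ∫ x in Icc m M, x ^ v = (M ^ (v + 1) - m ^ (v + 1)) / (v + 1) := by
  rw [integral_Icc_eq_integral_Ioc, ← intervalIntegral.integral_of_le hmM.le, integral_rpow]
  refine Or.inr ⟨hv, ?_⟩
  rw [uIcc_of_le hmM.le]
  exact fun h => absurd h.1 (not_le.2 hm)

/-- For large `|u|` the density proportional to `x ^ u` concentrates at an endpoint, which makes
the integral of its power `1 + α` large. -/
lemma exists_le_rpow_integral_ratio {m M α : ℝ} (hm : 0 < m) (hmM : m < M) (h0 : 0 < α)
    (h1 : α < 1) : ∃ c > 0, ∀ u : ℝ, 3 ≤ |u| →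
      c * (|u| - 1) ^ α ≤
        (∫ x in Icc m M, x ^ (u * (1 + α))) / (∫ x in Icc m M, x ^ u) ^ (1 + α) := by
  have hM : 0 < M := hm.trans hmM
  set r := m / M with hr
  have hr0 : 0 < r := div_pos hm hM
  have hr1 : r < 1 := (div_lt_one hM).2 hmM
  have hmr : m = r * M := by rw [hr]; field_simp
  -- `A` is the endpoint where the mass concentrates
  have key : ∀ A d v p : ℝ, 0 < A → 2 ≤ v → 1 ≤ p → p ≤ 4 * v →
      A ^ (-α) * (1 - r) / 4 * v ^ α ≤
        (A ^ (d * (1 + α) - α) * (1 - r ^ p) / p) / (A ^ d * (1 - r ^ v) / v) ^ (1 + α) := by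
    intro A d v p hA hv hp hpv
    have a1 : r ^ v < 1 := Real.rpow_lt_one hr0.le hr1 (by linarith)
    have a2 : 0 < r ^ v := Real.rpow_pos_of_pos hr0 _
    have a3 : r ^ p ≤ r := by
      simpa using Real.rpow_le_rpow_of_exponent_ge hr0 hr1.le hp
    have hAd := Real.rpow_pos_of_pos hA d
    have hAn := Real.rpow_pos_of_pos hA (d * (1 + α) - α)
    have hDp : 0 < A ^ d * (1 - r ^ v) / v :=
      div_pos (mul_pos hAd (by linarith)) (by linarith)
    have hDle : A ^ d * (1 - r ^ v) / v ≤ A ^ d / v := by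
      gcongr; nlinarith
    have hNge : A ^ (d * (1 + α) - α) * (1 - r) / (4 * v) ≤
        A ^ (d * (1 + α) - α) * (1 - r ^ p) / p := by
      have : 0 ≤ A ^ (d * (1 + α) - α) * (1 - r ^ p) := mul_nonneg hAn.le (by linarith)
      gcongr
    rw [le_div_iff₀ (Real.rpow_pos_of_pos hDp _)]
    calc A ^ (-α) * (1 - r) / 4 * v ^ α * (A ^ d * (1 - r ^ v) / v) ^ (1 + α)
        ≤ A ^ (-α) * (1 - r) / 4 * v ^ α * (A ^ d / v) ^ (1 + α) := by
          have : 0 ≤ A ^ (-α) * (1 - r) / 4 * v ^ α := by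
            have : 0 ≤ 1 - r := by linarith
            positivity
          gcongr
      _ = A ^ (d * (1 + α) - α) * (1 - r) / (4 * v) := by
          rw [Real.div_rpow hAd.le (by linarith), ← Real.rpow_mul hA.le,
            sub_eq_add_neg (d * (1 + α)),
            Real.rpow_add hA, Real.rpow_add (show 0 < v by linarith), Real.rpow_one]
          have := (Real.rpow_pos_of_pos (show 0 < v by linarith) α).ne'
          have : v ≠ 0 := by positivity
          field_simp
      _ ≤ _ := hNge
  have hr1' : 0 < 1 - r := by linarith
  refine ⟨min (M ^ (-α) * (1 - r) / 4) (m ^ (-α) * (1 - r) / 4), lt_min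
    (by positivity) (by positivity), fun u hu => ?_⟩
  have hu0 : 0 ≤ |u| - 1 := by linarith
  rcases le_total 0 u with hu' | hu'
  · rw [abs_of_nonneg hu'] at hu hu0 ⊢
    have b := key M (u + 1) (u + 1) (u * (1 + α) + 1) hM (by linarith) (by nlinarith)
      (by nlinarith)
    have e : ∀ p : ℝ, M ^ p - m ^ p = M ^ p * (1 - r ^ p) := fun p => by
      rw [hmr, Real.mul_rpow hr0.le hM.le]; ring
    rw [setIntegral_rpow_eq hm hmM (by linarith : u ≠ -1),
      setIntegral_rpow_eq hm hmM (by nlinarith : u * (1 + α) ≠ -1), e, e]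
    rw [show (u + 1) * (1 + α) - α = u * (1 + α) + 1 by ring] at b
    refine le_trans (mul_le_mul (min_le_left _ _) ?_ (Real.rpow_nonneg hu0 _) (by positivity)) b
    exact Real.rpow_le_rpow hu0 (by linarith) h0.le
  · rw [abs_of_nonpos hu'] at hu hu0 ⊢
    have b := key m (u + 1) (-(u + 1)) (-(u * (1 + α) + 1)) hm (by linarith) (by nlinarith)
      (by nlinarith)
    have hMr : M = m / r := by rw [hmr]; field_simp
    have e : ∀ p : ℝ, (M ^ p - m ^ p) / p = m ^ p * (1 - r ^ (-p)) / -p := fun p => by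
      rw [hMr, Real.div_rpow hm.le hr0.le, Real.rpow_neg hr0.le, div_neg, ← neg_div]
      congr 1; ring
    rw [setIntegral_rpow_eq hm hmM (by linarith : u ≠ -1),
      setIntegral_rpow_eq hm hmM (by nlinarith : u * (1 + α) ≠ -1), e, e]
    rw [show (u + 1) * (1 + α) - α = u * (1 + α) + 1 by ring] at b
    refine le_trans (mul_le_mul (min_le_right _ _) ?_ (Real.rpow_nonneg hu0 _) (by positivity)) b
    exact Real.rpow_le_rpow hu0 (by linarith) h0.le

/-- The functional has a minimiser on every compact interval of positive numbers. -/
lemma exists_forall_priorObjective_le {m M α : ℝ} {w : ℝ → ℝ} (hm : 0 < m) (hmM : m < M)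
    (hw : ContinuousOn w (Icc m M)) (hw0 : ∀ x ∈ Icc m M, 0 < w x) (h0 : 0 < α) (h1 : α < 1) :
    ∃ u, ∀ v, priorObjective id w α (Icc m M) u ≤ priorObjective id w α (Icc m M) v := by
  obtain ⟨c, hc, hbd⟩ := exists_le_rpow_integral_ratio hm hmM h0 h1
  obtain ⟨B, hB⟩ := isCompact_Icc.bddAbove_image hw
  have hwB : ∀ x ∈ Icc m M, w x ≤ B := fun x hx => hB (mem_image_of_mem _ hx)
  have hB0 : 0 < B := (hw0 m (left_mem_Icc.2 hmM.le)).trans_le (hwB m (left_mem_Icc.2 hmM.le))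
  have hinv : ContinuousOn (fun x => (w x ^ α)⁻¹) (Icc m M) :=
    (hw.rpow_const fun x hx => Or.inl (hw0 x hx).ne').inv₀
      fun x hx => (Real.rpow_pos_of_pos (hw0 x hx) _).ne'
  have hlow : ∀ u : ℝ, 3 ≤ |u| →
      (B ^ α)⁻¹ * (c * (|u| - 1) ^ α) ≤ priorObjective id w α (Icc m M) u := by
    intro u hu
    refine (mul_le_mul_of_nonneg_left (hbd u hu) (by positivity)).trans ?_
    rw [priorObjective, ← mul_div_assoc]
    refine div_le_div_of_nonneg_right ?_
      (Real.rpow_nonneg (setIntegral_rpow_pos hm hmM u).le _)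
    rw [← integral_const_mul]
    refine setIntegral_mono_on ?_ ?_ measurableSet_Icc fun x hx => ?_
    · exact ((continuousOn_rpow_Icc hm _).integrableOn_Icc).const_mul _
    · exact ((continuousOn_rpow_Icc hm _).mul hinv).integrableOn_Icc
    · rw [mul_comm]
      have hx0 : 0 < x := hm.trans_le hx.1
      have := Real.rpow_pos_of_pos (hw0 x hx) α
      have := Real.rpow_le_rpow (hw0 x hx).le (hwB x hx) h0.le
      simp only [id]
      gcongr
  have hgrow : Tendsto (fun u : ℝ => (B ^ α)⁻¹ * (c * (|u| - 1) ^ α)) (cocompact ℝ) atTop := by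
    refine Tendsto.const_mul_atTop (by positivity) (Tendsto.const_mul_atTop hc ?_)
    refine (tendsto_rpow_atTop h0).comp ?_
    refine tendsto_atTop_add_const_right _ (-1) ?_
    exact tendsto_norm_cocompact_atTop
  refine (priorObjective_continuous hm hmM hw hw0).exists_forall_le (tendsto_atTop_mono' _ ?_ hgrow)
  filter_upwards [(tendsto_norm_cocompact_atTop (E := ℝ)).eventually_ge_atTop 3] with u hu
  exact hlow u hu

/-! ### Stability of Hölder's inequality -/

/-- Strict form of Bernoulli's inequality away from `z = 1`. -/
lemma exists_bernoulli_gap {p η : ℝ} (hp : 1 < p) (h0 : 0 < η) (h1 : η < 1) :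
    ∃ c > 0, ∀ z : ℝ, 0 ≤ z → η ≤ |z - 1| → c ≤ z ^ p - 1 - p * (z - 1) := by
  have hpos : ∀ s : ℝ, -1 ≤ s → s ≠ 0 → 0 < (1 + s) ^ p - 1 - p * s := fun s hs hs0 => by
    have := one_add_mul_self_lt_rpow_one_add hs hs0 hp
    linarith
  -- by convexity the gap at `z` dominates the gap at the point at distance `η` from `1`
  have key : ∀ z s : ℝ, 0 ≤ z → -1 ≤ s → s ≠ 0 → (∃ l : ℝ, 0 < l ∧ l ≤ 1 ∧ s = l * (z - 1)) →
      (1 + s) ^ p - 1 - p * s ≤ z ^ p - 1 - p * (z - 1) := by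
    rintro z s hz hs hs0 ⟨l, hl0, hl1, rfl⟩
    have hcv := (convexOn_rpow hp.le).2 (x := z) (y := 1) hz (by simp) hl0.le
      (show 0 ≤ 1 - l by linarith) (by ring)
    simp only [smul_eq_mul, Real.one_rpow] at hcv
    rw [show l * z + (1 - l) * 1 = 1 + l * (z - 1) by ring] at hcv
    have h3 : 0 ≤ z ^ p - 1 - p * (z - 1) := by
      by_cases h : z = 1
      · simp [h]
      · have := hpos (z - 1) (by linarith) (sub_ne_zero.2 h)
        rw [add_sub_cancel] at this
        exact this.le
    nlinarith
  refine ⟨min ((1 + η) ^ p - 1 - p * η) ((1 + -η) ^ p - 1 - p * -η),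
    lt_min (hpos _ (by linarith) h0.ne') (hpos _ (by linarith) (by linarith)), fun z hz hη => ?_⟩
  rcases le_total 1 z with h | h
  · rw [abs_of_nonneg (by linarith)] at hη
    refine (min_le_left _ _).trans (key z η hz (by linarith) h0.ne' ⟨η / (z - 1), by
      apply div_pos h0; linarith, (div_le_one (by linarith)).2 hη, ?_⟩)
    rw [div_mul_cancel₀]; linarith
  · rw [abs_of_nonpos (by linarith)] at hη
    refine (min_le_right _ _).trans (key z (-η) hz (by linarith) (by linarith) ⟨η / (1 - z), by
      apply div_pos h0; linarith, (div_le_one (by linarith)).2 (by linarith), ?_⟩)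
    rw [show z - 1 = -(1 - z) by ring, mul_neg, div_mul_cancel₀]; linarith

/-- Stability of Hölder's inequality: if `Z` has mean `1` with respect to the weight `w` and the
mean of `Z ^ p` is almost `1`, then `Z` is close to `1` on most of the mass. -/
lemma setIntegral_deviation_le {K : Set ℝ} (hK : MeasurableSet K) {w Z : ℝ → ℝ} {p η c δ W : ℝ}
    (hw0 : ∀ x ∈ K, 0 ≤ w x) (hZ0 : ∀ x ∈ K, 0 ≤ Z x) (hZm : Measurable Z)
    (hc : ∀ z : ℝ, 0 ≤ z → η ≤ |z - 1| → c ≤ z ^ p - 1 - p * (z - 1)) (hp : 1 ≤ p)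
    (hwi : IntegrableOn w K) (hZi : IntegrableOn (fun x => w x * Z x) K)
    (hZp : IntegrableOn (fun x => w x * Z x ^ p) K)
    (hW : ∫ x in K, w x = W) (hZ1 : ∫ x in K, w x * Z x = W)
    (hZ2 : ∫ x in K, w x * Z x ^ p ≤ (1 + δ) * W) :
    c * ∫ x in K ∩ {x | η ≤ |Z x - 1|}, w x ≤ δ * W := by
  have hbad : MeasurableSet {x | η ≤ |Z x - 1|} :=
    measurableSet_le measurable_const (measurable_norm.comp (hZm.sub_const 1))
  have hnn : ∀ z : ℝ, 0 ≤ z → 0 ≤ z ^ p - 1 - p * (z - 1) := fun z hz => by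
    have := one_add_mul_self_le_rpow_one_add (s := z - 1) (by linarith) hp
    rw [add_sub_cancel] at this
    linarith
  have hi : IntegrableOn (fun x => w x * Z x ^ p - w x - (p * (w x * Z x) - p * w x)) K :=
    (hZp.sub hwi).sub ((hZi.const_mul p).sub (hwi.const_mul p))
  have e1 : ∫ x in K, (w x * Z x ^ p - w x - (p * (w x * Z x) - p * w x)) ≤ δ * W := by
    have i1 : IntegrableOn (fun x => w x * Z x ^ p - w x) K := hZp.sub hwi
    have i2 : IntegrableOn (fun x => p * (w x * Z x) - p * w x) K :=
      (hZi.const_mul p).sub (hwi.const_mul p)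
    rw [integral_sub i1 i2, integral_sub hZp hwi,
      integral_sub (hZi.const_mul p) (hwi.const_mul p), integral_const_mul,
      integral_const_mul, hW, hZ1]
    linarith
  refine le_trans ?_ e1
  rw [← integral_const_mul, ← setIntegral_indicator hbad]
  refine setIntegral_mono_on ((hwi.const_mul c).indicator hbad) hi hK fun x hx => ?_
  have e2 : w x * Z x ^ p - w x - (p * (w x * Z x) - p * w x) =
      w x * (Z x ^ p - 1 - p * (Z x - 1)) := by ring
  rw [e2]
  by_cases hb : x ∈ {x | η ≤ |Z x - 1|}
  · rw [indicator_of_mem hb, mul_comm]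
    exact mul_le_mul_of_nonneg_left (hc _ (hZ0 x hx) hb) (hw0 x hx)
  · rw [indicator_of_notMem hb]
    exact mul_nonneg (hw0 x hx) (hnn _ (hZ0 x hx))

/-- Integrals of functions that are asymptotically proportional to `g`, over sets along which the
integral of `g` diverges. -/
lemma tendsto_setIntegral_div {K : ℕ → Set ℝ} {X : Set ℝ} {f g : ℝ → ℝ} {γ C : ℝ}
    (hK : ∀ i, MeasurableSet (K i)) (hKX : ∀ i, K i ⊆ X) (hg0 : ∀ x ∈ X, 0 ≤ g x)
    (hfC : ∀ x ∈ X, |f x - γ * g x| ≤ C * g x)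
    (hf : ∀ ε > 0, ∃ T, MeasurableSet T ∧ IntegrableOn g (T ∩ X) ∧ ∀ x ∈ X \ T,
      |f x - γ * g x| ≤ ε * g x)
    (hX : MeasurableSet X)
    (hfi : ∀ i, IntegrableOn f (K i)) (hgi : ∀ i, IntegrableOn g (K i))
    (hdiv : Tendsto (fun i => ∫ x in K i, g x) atTop atTop) :
    Tendsto (fun i => (∫ x in K i, f x) / ∫ x in K i, g x) atTop (𝓝 γ) := by
  rw [Metric.tendsto_nhds]
  intro ε hε
  obtain ⟨T, hT, hTi, hTb⟩ := hf (ε / 2) (by positivity)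
  filter_upwards [hdiv.eventually_gt_atTop 0,
    hdiv.eventually_gt_atTop (|C| * (∫ x in T ∩ X, g x) / (ε / 2))] with i hi0 hi
  have h1 : |∫ x in K i, (f x - γ * g x)| ≤
      ∫ x in K i, (ε / 2 * g x + T.indicator (fun x => |C| * g x) x) := by
    refine (norm_integral_le_integral_norm (fun x => f x - γ * g x)).trans ?_
    refine setIntegral_mono_on ((hfi i).sub ((hgi i).const_mul γ)).norm
      (((hgi i).const_mul _).add (((hgi i).const_mul _).indicator hT)) (hK i) fun x hx => ?_
    have hxX := hKX i hx
    have hgx := hg0 x hxX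
    by_cases hxT : x ∈ T
    · rw [indicator_of_mem hxT]
      have := hfC x hxX
      have := mul_le_mul_of_nonneg_right (le_abs_self C) hgx
      rw [Real.norm_eq_abs]
      nlinarith [mul_nonneg hε.le hgx]
    · rw [indicator_of_notMem hxT, add_zero]
      exact hTb x ⟨hxX, hxT⟩
  have h2 : ∫ x in K i, T.indicator (fun x => |C| * g x) x ≤ |C| * ∫ x in T ∩ X, g x := by
    rw [setIntegral_indicator hT, integral_const_mul]
    refine mul_le_mul_of_nonneg_left (setIntegral_mono_set hTi ?_ ?_) (abs_nonneg _)
    · exact (ae_restrict_iff' (hT.inter hX)).2 (Eventually.of_forall fun x hx => hg0 x hx.2)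
    · exact LE.le.eventuallyLE (show K i ∩ T ⊆ T ∩ X from fun x hx => ⟨hx.2, hKX i hx.1⟩)
  rw [integral_sub (hfi i) ((hgi i).const_mul γ), integral_const_mul,
    integral_add ((hgi i).const_mul _) (((hgi i).const_mul _).indicator hT),
    integral_const_mul] at h1
  rw [div_lt_iff₀ (by positivity)] at hi
  rw [Real.dist_eq, show (∫ x in K i, f x) / (∫ x in K i, g x) - γ =
    ((∫ x in K i, f x) - γ * ∫ x in K i, g x) / ∫ x in K i, g x by field_simp, abs_div,
    abs_of_pos hi0, div_lt_iff₀ hi0]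
  linarith

/-- A weight comparable to `x ^ a` puts at most a fixed proportion of its mass in `[y, 2y]`. -/
lemma exists_window_le {a c₁ c₂ : ℝ} (h1 : 0 < c₁) (h2 : 0 < c₂) : ∃ q > 0,
    ∀ (m M : ℝ) (w : ℝ → ℝ), 0 < m → 8 * m ≤ M → IntegrableOn w (Icc m M) →
      (∀ x ∈ Icc m M, c₁ * x ^ a ≤ w x ∧ w x ≤ c₂ * x ^ a) → ∀ y : ℝ,
      q * ∫ x in Icc m M ∩ Icc y (2 * y), w x ≤ ∫ x in Icc m M \ Icc y (2 * y), w x := by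
  have h4 : (0 : ℝ) < 4 ^ |a| := by positivity
  -- on `[y / 2, 4 y]` the power `x ^ a` is comparable to `y ^ a`
  have hcomp : ∀ x y : ℝ, 0 < y → y / 2 ≤ x → x ≤ 4 * y →
      y ^ a / 4 ^ |a| ≤ x ^ a ∧ x ^ a ≤ y ^ a * 4 ^ |a| := by
    have : ∀ x y : ℝ, 0 < y → 0 < x → x / 4 ≤ y → y ≤ 4 * x → x ^ a ≤ y ^ a * 4 ^ |a| := by
      intro x y hy hx hxy hyx
      rcases le_total 0 a with ha | ha
      · rw [abs_of_nonneg ha, ← Real.mul_rpow hy.le (by norm_num)]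
        exact Real.rpow_le_rpow hx.le (by linarith) ha
      · rw [abs_of_nonpos ha, Real.rpow_neg (by norm_num), ← div_eq_mul_inv, ← Real.div_rpow hy.le
          (by norm_num)]
        exact Real.rpow_le_rpow_of_nonpos (by linarith) (by linarith) ha
    intro x y hy hx1 hx2
    have hx : 0 < x := by linarith
    exact ⟨(div_le_iff₀ h4).2 (this y x hx hy (by linarith) (by linarith)),
      this x y hy hx (by linarith) (by linarith)⟩
  refine ⟨c₁ / 4 ^ |a| / 2 / (c₂ * 4 ^ |a|), by positivity, fun m M w hm hmM hwi hw y => ?_⟩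
  have hw0 : ∀ x ∈ Icc m M, 0 ≤ w x := fun x hx =>
    (mul_nonneg h1.le (Real.rpow_nonneg (hm.le.trans hx.1) _)).trans (hw x hx).1
  by_cases hdis : 2 * y < m ∨ M < y
  · have : Icc m M ∩ Icc y (2 * y) = ∅ := by
      ext x
      simp only [mem_inter_iff, mem_Icc, mem_empty_iff_false, iff_false]
      rintro ⟨⟨a1, a2⟩, a3, a4⟩
      rcases hdis with h | h <;> linarith
    rw [this]
    simp only [Measure.restrict_empty, integral_zero_measure, mul_zero]
    exact setIntegral_nonneg (measurableSet_Icc.diff measurableSet_Icc) fun x hx => hw0 x hx.1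
  push Not at hdis
  have hy : 0 < y := by linarith
  have hya := Real.rpow_pos_of_pos hy a
  have hup : ∫ x in Icc m M ∩ Icc y (2 * y), w x ≤ c₂ * 4 ^ |a| * y ^ a * y := by
    have hsub : volume.real (Icc m M ∩ Icc y (2 * y)) ≤ y := by
      refine (measureReal_mono inter_subset_right (by simp)).trans ?_
      rw [Real.volume_real_Icc_of_le (by linarith)]; linarith
    have := norm_setIntegral_le_of_norm_le_const (μ := volume) (f := w)
      (s := Icc m M ∩ Icc y (2 * y)) (C := c₂ * (y ^ a * 4 ^ |a|))
      ((measure_mono inter_subset_left).trans_lt (by simp)) (fun x hx => by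
        rw [Real.norm_of_nonneg (hw0 x hx.1)]
        exact (hw x hx.1).2.trans (mul_le_mul_of_nonneg_left
          (hcomp x y hy (by linarith [hx.2.1]) (by linarith [hx.2.2])).2 h2.le))
    refine (Real.le_norm_self _).trans (this.trans ?_)
    calc _ ≤ c₂ * (y ^ a * 4 ^ |a|) * y := mul_le_mul_of_nonneg_left hsub (by positivity)
      _ = _ := by ring
  -- one of the two neighbouring blocks is contained in `[m, M]`
  obtain ⟨B, hBm, hB, hBy, hBv⟩ : ∃ B : Set ℝ, MeasurableSet B ∧ B ⊆ Icc m M \ Icc y (2 * y) ∧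
      B ⊆ Icc (y / 2) (4 * y) ∧ y / 2 ≤ volume.real B := by
    by_cases h : 4 * y ≤ M
    · refine ⟨Ioc (2 * y) (4 * y), measurableSet_Ioc,
        fun x hx => ⟨⟨?_, hx.2.trans h⟩, fun h' => ?_⟩, fun x hx => ⟨by linarith [hx.1], hx.2⟩, ?_⟩
      · linarith [hx.1]
      · linarith [hx.1, h'.2]
      · rw [Real.volume_real_Ioc_of_le (by linarith)]; linarith
    · refine ⟨Ico (y / 2) y, measurableSet_Ico, fun x hx => ⟨⟨?_, by linarith [hx.2]⟩,
        fun h' => ?_⟩, fun x hx => ⟨hx.1, by linarith [hx.2]⟩, ?_⟩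
      · linarith [hx.1]
      · linarith [hx.2, h'.1]
      · rw [Real.volume_real_Ico_of_le (by linarith)]; linarith
  have hwD : IntegrableOn w (Icc m M \ Icc y (2 * y)) := hwi.mono_set sdiff_subset
  have hlow : c₁ / 4 ^ |a| * y ^ a * (y / 2) ≤ ∫ x in Icc m M \ Icc y (2 * y), w x := by
    have b1 : ∫ x in B, w x ≤ ∫ x in Icc m M \ Icc y (2 * y), w x :=
      setIntegral_mono_set hwD ((ae_restrict_iff' (measurableSet_Icc.diff measurableSet_Icc)).2
        (Eventually.of_forall fun x hx => hw0 x hx.1)) (LE.le.eventuallyLE hB)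
    have hBfin : volume B ≠ ⊤ := ((measure_mono hBy).trans_lt (by simp)).ne
    have b2 := setIntegral_ge_of_const_le_real (μ := volume) (c := c₁ * (y ^ a / 4 ^ |a|)) hBm
      hBfin (fun x hx => (mul_le_mul_of_nonneg_left
        (hcomp x y hy (hBy hx).1 (hBy hx).2).1 h1.le).trans (hw x (hB hx).1).1)
      (hwD.mono_set hB)
    refine le_trans ?_ (b2.trans b1)
    calc c₁ / 4 ^ |a| * y ^ a * (y / 2) = c₁ * (y ^ a / 4 ^ |a|) * (y / 2) := by ring
      _ ≤ _ := mul_le_mul_of_nonneg_left hBv (by positivity)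
  refine le_trans (mul_le_mul_of_nonneg_left hup (by positivity)) (le_trans (le_of_eq ?_) hlow)
  field_simp

/-- If `x ^ v`, up to a constant factor, lies in a short interval at two points of ratio at least
`2`, then `v` is small. -/
lemma abs_lt_of_rpow_bounds {x x' v k η ε : ℝ} (hxp : 0 < x) (hxx' : 2 * x ≤ x') (hk0 : 0 < k)
    (hηε : (1 + η) ^ 2 < (1 - η) ^ 2 * 2 ^ ε) (hε : 0 < ε) (g1 : (1 - η) ^ 2 < x ^ v * k)
    (g2 : x ^ v * k < (1 + η) ^ 2) (g3 : (1 - η) ^ 2 < x' ^ v * k)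
    (g4 : x' ^ v * k < (1 + η) ^ 2) : |v| < ε := by
  have hr : 2 ≤ x' / x := (le_div_iff₀ hxp).2 hxx'
  have hmul : x' ^ v = x ^ v * (x' / x) ^ v := by
    rw [← Real.mul_rpow hxp.le (by linarith)]
    congr 1; field_simp
  rw [abs_lt]
  by_contra hcon
  have hxv := mul_pos (Real.rpow_pos_of_pos hxp v) hk0
  have h2ε : (0 : ℝ) < 2 ^ ε := by positivity
  rw [hmul, mul_right_comm] at g3 g4
  by_cases hs : v < ε
  · have hs' : v ≤ -ε := by
      by_contra h'; exact hcon ⟨by linarith, hs⟩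
    have : (x' / x) ^ v ≤ 2 ^ (-ε) :=
      (Real.rpow_le_rpow_of_nonpos (by norm_num) hr (by linarith)).trans
        (Real.rpow_le_rpow_of_exponent_le (by norm_num) hs')
    rw [Real.rpow_neg (by norm_num)] at this
    have h3 : x ^ v * k * (x' / x) ^ v ≤ x ^ v * k * (2 ^ ε)⁻¹ :=
      mul_le_mul_of_nonneg_left this hxv.le
    have h4 : (1 - η) ^ 2 * 2 ^ ε < x ^ v * k := by
      have := g3.trans_le h3
      rwa [← div_eq_mul_inv, lt_div_iff₀ h2ε] at this
    linarith
  · have : (2 : ℝ) ^ ε ≤ (x' / x) ^ v :=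
      (Real.rpow_le_rpow_of_exponent_le (by norm_num) (not_lt.1 hs)).trans
        (Real.rpow_le_rpow (by norm_num) hr (by linarith))
    have h3 := mul_le_mul_of_nonneg_left this hxv.le
    have h4 := mul_lt_mul_of_pos_right g1 h2ε
    linarith

/-- A set that carries most of the mass of `w` contains two points of ratio at least `2`. -/
lemma exists_two_mul_le {K B₁ B₂ : Set ℝ} {w : ℝ → ℝ} {l q W : ℝ} (hKm : MeasurableSet K)
    (hb1 : MeasurableSet B₁) (hb2 : MeasurableSet B₂) (hwi : IntegrableOn w K)
    (hw0 : ∀ x ∈ K, 0 < w x) (hKl : ∀ x ∈ K, l ≤ x) (hq : 0 < q) (hW : 0 < W)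
    (hWd : ∫ x in K, w x = W)
    (hwin : ∀ y : ℝ, q * ∫ x in K ∩ Icc y (2 * y), w x ≤ ∫ x in K \ Icc y (2 * y), w x)
    (hbad1 : ∫ x in K ∩ B₁, w x ≤ q / (4 * (1 + q)) * W)
    (hbad2 : ∫ x in K ∩ B₂, w x ≤ q / (4 * (1 + q)) * W) :
    ∃ x ∈ K \ (B₁ ∪ B₂), ∃ x' ∈ K \ (B₁ ∪ B₂), 2 * x ≤ x' := by
  -- otherwise the complement `G` of the exceptional sets lies in the window `[y, 2y]`, `y = inf G`
  by_contra! hcon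
  set G := K \ (B₁ ∪ B₂) with hG
  have hGb : BddBelow G := ⟨l, fun z hz => hKl z hz.1⟩
  have hGsub : G ⊆ Icc (sInf G) (2 * sInf G) := fun z hz => by
    refine ⟨csInf_le hGb hz, ?_⟩
    have : z / 2 ≤ sInf G := le_csInf ⟨z, hz⟩ fun b hb => by linarith [hcon b hb z hz]
    linarith
  have hW' := hwin (sInf G)
  have hsplit := integral_inter_add_sdiff (μ := volume)
    (measurableSet_Icc (a := sInf G) (b := 2 * sInf G)) hwi
  have hle : ∫ x in K \ Icc (sInf G) (2 * sInf G), w x ≤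
      (∫ x in K ∩ B₁, w x) + ∫ x in K ∩ B₂, w x := by
    have hA := (measurableSet_Icc (a := sInf G) (b := 2 * sInf G)).compl
    rw [sdiff_eq, ← setIntegral_indicator hA, ← setIntegral_indicator hb1,
      ← setIntegral_indicator hb2, ← integral_add (hwi.indicator hb1) (hwi.indicator hb2)]
    refine setIntegral_mono_on (hwi.indicator hA)
      ((hwi.indicator hb1).add (hwi.indicator hb2)) hKm fun z hz => ?_
    have hnn : ∀ B : Set ℝ, 0 ≤ B.indicator w z := fun B => by
      by_cases hzB : z ∈ B
      · rw [indicator_of_mem hzB]; exact (hw0 z hz).le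
      · rw [indicator_of_notMem hzB]
    by_cases hzA : z ∈ (Icc (sInf G) (2 * sInf G))ᶜ
    · rw [indicator_of_mem hzA]
      have hzG : z ∈ B₁ ∪ B₂ := by
        by_contra hzb
        exact hzA (hGsub ⟨hz, hzb⟩)
      rcases hzG with hz1 | hz2
      · rw [indicator_of_mem hz1]
        linarith [hnn B₂]
      · rw [indicator_of_mem hz2]
        linarith [hnn B₁]
    · rw [indicator_of_notMem hzA]
      exact add_nonneg (hnn _) (hnn _)
  have h2 : (1 + q) * (2 * (q / (4 * (1 + q)) * W)) = q / 2 * W := by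
    field_simp; norm_num
  have h3 : q * W ≤ (1 + q) * ∫ x in K \ Icc (sInf G) (2 * sInf G), w x := by
    rw [← hWd, ← hsplit]; linarith
  have h4 := mul_le_mul_of_nonneg_left (hle.trans (add_le_add hbad1 hbad2))
    (show 0 ≤ 1 + q by linarith)
  nlinarith [mul_pos hq hW]

/-! ### Weights with a power tail -/

/-- The weight `w` on the set `X` of positive numbers is asymptotic to `C x ^ a` outside compact
subsets of `X`, the set `X` contains points of arbitrarily large ratio, and `x ^ (a + 1)` is bounded
below, so that `w` is not integrable. The two relevant cases are `X = (0, R]` with `a ≤ -1` and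
`X = [R, ∞)` with `a ≥ -1`. -/
structure PowerTail (X : Set ℝ) (w : ℝ → ℝ) (a C : ℝ) : Prop where
  measurableSet : MeasurableSet X
  subset : ∀ x ∈ X, 0 < x
  cont : ContinuousOn w X
  pos : ∀ x ∈ X, 0 < w x
  const_pos : 0 < C
  tail : ∀ ε > 0, ∃ T ⊆ X, IsCompact T ∧ ∀ x ∈ X \ T, |w x - C * x ^ a| ≤ ε * x ^ a
  lower : ∃ κ > 0, ∀ x ∈ X, κ ≤ x ^ (a + 1)
  wide : ∀ A : ℝ, ∃ x ∈ X, ∃ x' ∈ X, A * x ≤ x'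

/-- The intervals `[m i, M i]` eventually contain every point of `X`. -/
structure Exhausts (X : Set ℝ) (m M : ℕ → ℝ) : Prop where
  lt : ∀ i, m i < M i
  sub : ∀ i, Icc (m i) (M i) ⊆ X
  cover : ∀ x ∈ X, ∀ᶠ i in atTop, x ∈ Icc (m i) (M i)

namespace PowerTail

variable {X : Set ℝ} {w : ℝ → ℝ} {a C α : ℝ} {m M : ℕ → ℝ}

lemma left_pos (h : PowerTail X w a C) (hE : Exhausts X m M) (i : ℕ) : 0 < m i :=
  h.subset _ (hE.sub i (left_mem_Icc.2 (hE.lt i).le))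

lemma cont_rpow (h : PowerTail X w a C) (v : ℝ) : ContinuousOn (fun x : ℝ => x ^ v) X :=
  continuousOn_id.rpow_const fun x hx => Or.inl (h.subset x hx).ne'

lemma cont_inv_rpow (h : PowerTail X w a C) (v : ℝ) : ContinuousOn (fun x : ℝ => (w x ^ v)⁻¹) X :=
  (h.cont.rpow_const fun x hx => Or.inl (h.pos x hx).ne').inv₀
    fun x hx => (Real.rpow_pos_of_pos (h.pos x hx) _).ne'

lemma exists_bounds (h : PowerTail X w a C) : ∃ c₁ > 0, ∃ c₂ > 0, ∀ x ∈ X,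
    c₁ * x ^ a ≤ w x ∧ w x ≤ c₂ * x ^ a := by
  have hC := h.const_pos
  obtain ⟨T, hTX, hT, hb⟩ := h.tail (C / 2) (by positivity)
  have hpow : ∀ x ∈ X, 0 < x ^ a := fun x hx => Real.rpow_pos_of_pos (h.subset x hx) _
  obtain ⟨B, hB⟩ := hT.bddAbove_image ((h.cont.mono hTX).div ((h.cont_rpow a).mono hTX)
    fun x hx => (hpow x (hTX hx)).ne')
  obtain ⟨B', hB'⟩ := hT.bddAbove_image (((h.cont_rpow a).mono hTX).div (h.cont.mono hTX)
    fun x hx => (h.pos x (hTX hx)).ne')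
  refine ⟨min (C / 2) (max B' 1)⁻¹, lt_min (by positivity) (by positivity), max (2 * C) B,
    lt_max_of_lt_left (by positivity), fun x hx => ?_⟩
  by_cases hxT : x ∈ T
  · have h1 : w x / x ^ a ≤ B := hB (mem_image_of_mem _ hxT)
    have h2 : x ^ a / w x ≤ B' := hB' (mem_image_of_mem _ hxT)
    constructor
    · refine (mul_le_mul_of_nonneg_right (min_le_right _ _) (hpow x hx).le).trans ?_
      rw [inv_mul_le_iff₀ (by positivity)]
      rw [div_le_iff₀ (h.pos x hx)] at h2
      exact h2.trans (mul_le_mul_of_nonneg_right (le_max_left _ _) (h.pos x hx).le)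
    · rw [div_le_iff₀ (hpow x hx)] at h1
      exact h1.trans (mul_le_mul_of_nonneg_right (le_max_right _ _) (hpow x hx).le)
  · have := abs_le.1 (hb x ⟨hx, hxT⟩)
    constructor
    · refine (mul_le_mul_of_nonneg_right (min_le_left _ _) (hpow x hx).le).trans ?_
      linarith
    · refine le_trans ?_ (mul_le_mul_of_nonneg_right (le_max_left _ _) (hpow x hx).le)
      have := mul_pos hC (hpow x hx)
      linarith

lemma tendsto_ratio (h : PowerTail X w a C) (hE : Exhausts X m M) :
    Tendsto (fun i => M i / m i) atTop atTop := by
  refine tendsto_atTop.2 fun A => ?_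
  obtain ⟨x, hx, x', hx', hA⟩ := h.wide (max A 0)
  filter_upwards [hE.cover x hx, hE.cover x' hx'] with i h1 h2
  rw [le_div_iff₀ (h.left_pos hE i)]
  calc A * m i ≤ max A 0 * m i :=
        mul_le_mul_of_nonneg_right (le_max_left _ _) (h.left_pos hE i).le
    _ ≤ max A 0 * x := mul_le_mul_of_nonneg_left h1.1 (le_max_right _ _)
    _ ≤ M i := hA.trans h2.2

/-- `x ^ a` is bounded below by a multiple of `1 / x`, so its integral diverges with
`log (M i / m i)`. -/
lemma tendsto_integral_rpow (h : PowerTail X w a C) (hE : Exhausts X m M) :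
    Tendsto (fun i => ∫ x in Icc (m i) (M i), x ^ a) atTop atTop := by
  obtain ⟨κ, hκ, hb⟩ := h.lower
  refine tendsto_atTop_mono (fun i => ?_)
    ((Real.tendsto_log_atTop.comp (h.tendsto_ratio hE)).const_mul_atTop hκ)
  have hm := h.left_pos hE i
  have hM := hm.trans (hE.lt i)
  have e : κ * Real.log (M i / m i) = ∫ x in Icc (m i) (M i), κ * x⁻¹ := by
    rw [integral_const_mul, integral_Icc_eq_integral_Ioc,
      ← intervalIntegral.integral_of_le (hE.lt i).le, integral_inv_of_pos hm hM]
  rw [Function.comp_apply, e]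
  refine setIntegral_mono_on ?_ ((h.cont_rpow a).mono (hE.sub i)).integrableOn_Icc
    measurableSet_Icc fun x hx => ?_
  · refine ContinuousOn.integrableOn_Icc (continuousOn_const.mul (continuousOn_inv₀.mono ?_))
    exact fun x hx => (hm.trans_le hx.1).ne'
  · have hx0 := h.subset x (hE.sub i hx)
    have := hb x (hE.sub i hx)
    rw [Real.rpow_add hx0, Real.rpow_one] at this
    rw [← div_eq_mul_inv, div_le_iff₀ hx0]
    exact this

/-- The integral of `f` relative to that of `x ^ a` tends to `γ` if `f` is close to `γ x ^ a`
wherever `w` is close to `C x ^ a`. -/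
lemma tendsto_integral_div (h : PowerTail X w a C) (hE : Exhausts X m M) {f : ℝ → ℝ} {γ B : ℝ}
    (hfC : ∀ x ∈ X, |f x - γ * x ^ a| ≤ B * x ^ a)
    (hf : ∀ ε > 0, ∃ δ > 0, ∀ x ∈ X, |w x - C * x ^ a| ≤ δ * x ^ a →
      |f x - γ * x ^ a| ≤ ε * x ^ a)
    (hfi : ∀ i, IntegrableOn f (Icc (m i) (M i))) :
    Tendsto (fun i => (∫ x in Icc (m i) (M i), f x) / ∫ x in Icc (m i) (M i), x ^ a) atTop
      (𝓝 γ) := by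
  refine tendsto_setIntegral_div (fun i => measurableSet_Icc) hE.sub
    (fun x hx => Real.rpow_nonneg (h.subset x hx).le _) hfC (fun ε hε => ?_) h.measurableSet hfi
    (fun i => ((h.cont_rpow a).mono (hE.sub i)).integrableOn_Icc) (h.tendsto_integral_rpow hE)
  obtain ⟨δ, hδ, hb⟩ := hf ε hε
  obtain ⟨T, hTX, hT, hTb⟩ := h.tail δ hδ
  refine ⟨T, hT.measurableSet, ?_, fun x hx => hb x hx.1 (hTb x hx)⟩
  rw [inter_eq_left.2 hTX]
  exact ((h.cont_rpow a).mono hTX).integrableOn_compact hT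

lemma tendsto_integral_weight_div (h : PowerTail X w a C) (hE : Exhausts X m M) :
    Tendsto (fun i => (∫ x in Icc (m i) (M i), w x) / ∫ x in Icc (m i) (M i), x ^ a) atTop
      (𝓝 C) := by
  obtain ⟨c₁, hc₁, c₂, hc₂, hb⟩ := h.exists_bounds
  refine h.tendsto_integral_div hE (B := c₂ + C) (fun x hx => ?_) (fun ε hε => ⟨ε, hε,
    fun x _ hx => hx⟩) fun i => (h.cont.mono (hE.sub i)).integrableOn_Icc
  have hp := Real.rpow_pos_of_pos (h.subset x hx) a
  have := mul_pos h.const_pos hp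
  have := mul_pos hc₂ hp
  have := h.pos x hx
  rw [abs_le]
  constructor <;> linarith [(hb x hx).2]

lemma rpow_mul_inv_eq (h : PowerTail X w a C) {x : ℝ} (hx : x ∈ X) :
    x ^ (a * (1 + α)) * (w x ^ α)⁻¹ = ((w x / x ^ a) ^ α)⁻¹ * x ^ a := by
  have hx0 := h.subset x hx
  rw [Real.div_rpow (h.pos x hx).le (Real.rpow_nonneg hx0.le _), ← Real.rpow_mul hx0.le, mul_add,
    mul_one, Real.rpow_add hx0, inv_div]
  ring

lemma tendsto_integral_inv_div (h : PowerTail X w a C) (hE : Exhausts X m M) (h0 : 0 < α) :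
    Tendsto (fun i => (∫ x in Icc (m i) (M i), x ^ (a * (1 + α)) * (w x ^ α)⁻¹) /
      ∫ x in Icc (m i) (M i), x ^ a) atTop (𝓝 (C ^ α)⁻¹) := by
  obtain ⟨c₁, hc₁, c₂, hc₂, hb⟩ := h.exists_bounds
  have hC := h.const_pos
  refine h.tendsto_integral_div hE (B := (c₁ ^ α)⁻¹ + (C ^ α)⁻¹) (fun x hx => ?_)
    (fun ε hε => ?_) fun i =>
    (((h.cont_rpow _).mul (h.cont_inv_rpow α)).mono (hE.sub i)).integrableOn_Icc
  · have hp := Real.rpow_pos_of_pos (h.subset x hx) a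
    have h1 : c₁ ≤ w x / x ^ a := (le_div_iff₀ hp).2 (hb x hx).1
    rw [h.rpow_mul_inv_eq hx, ← sub_mul, abs_mul, abs_of_pos hp]
    refine mul_le_mul_of_nonneg_right ?_ hp.le
    have h2 : ((w x / x ^ a) ^ α)⁻¹ ≤ (c₁ ^ α)⁻¹ :=
      inv_anti₀ (by positivity) (Real.rpow_le_rpow hc₁.le h1 h0.le)
    have h3 : 0 ≤ ((w x / x ^ a) ^ α)⁻¹ :=
      inv_nonneg.2 (Real.rpow_nonneg (hc₁.le.trans h1) _)
    have h4 : 0 ≤ (C ^ α)⁻¹ := by positivity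
    rw [abs_le]
    constructor <;> linarith
  · have hcont : ContinuousAt (fun r : ℝ => (r ^ α)⁻¹) C :=
      (continuousAt_id.rpow_const (Or.inl hC.ne')).inv₀ (Real.rpow_pos_of_pos hC α).ne'
    obtain ⟨δ, hδ, hball⟩ := Metric.continuousAt_iff.1 hcont ε hε
    refine ⟨δ / 2, by positivity, fun x hx hxd => ?_⟩
    have hp := Real.rpow_pos_of_pos (h.subset x hx) a
    have hd : dist (w x / x ^ a) C < δ := by
      rw [Real.dist_eq, show w x / x ^ a - C = (w x - C * x ^ a) / x ^ a by field_simp, abs_div,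
        abs_of_pos hp, div_lt_iff₀ hp]
      nlinarith
    have := hball hd
    rw [Real.dist_eq] at this
    rw [h.rpow_mul_inv_eq hx, ← sub_mul, abs_mul, abs_of_pos hp]
    exact mul_le_mul_of_nonneg_right this.le hp.le

/-- The exponent `a` is asymptotically optimal: the functional approaches its Hölder lower
bound. -/
lemma tendsto_priorObjective (h : PowerTail X w a C) (hE : Exhausts X m M) (h0 : 0 < α) :
    Tendsto (fun i => (∫ x in Icc (m i) (M i), w x) ^ α *
      priorObjective id w α (Icc (m i) (M i)) a) atTop (𝓝 1) := by
  have hC := h.const_pos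
  have h1 := ((h.tendsto_integral_weight_div hE).rpow_const (p := α) (Or.inl hC.ne')).mul
    (h.tendsto_integral_inv_div hE h0)
  rw [mul_inv_cancel₀ (Real.rpow_pos_of_pos hC α).ne'] at h1
  refine h1.congr fun i => ?_
  have hS := setIntegral_rpow_pos (h.left_pos hE i) (hE.lt i) a
  have hW : 0 ≤ ∫ x in Icc (m i) (M i), w x :=
    setIntegral_nonneg measurableSet_Icc fun x hx => (h.pos x (hE.sub i hx)).le
  rw [Real.div_rpow hW hS.le, priorObjective]
  simp only [id]
  rw [Real.rpow_add hS, Real.rpow_one]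
  have := (Real.rpow_pos_of_pos hS α).ne'
  field_simp

/-- The points where `w` is not close to `C x ^ a` carry a negligible part of the mass. -/
lemma tendsto_integral_deviation (h : PowerTail X w a C) (hwm : Measurable w)
    (hE : Exhausts X m M) {η : ℝ} (hη : 0 < η) :
    Tendsto (fun i => (∫ x in Icc (m i) (M i) ∩ {x | η * x ^ a ≤ |w x - C * x ^ a|}, w x) /
      ∫ x in Icc (m i) (M i), x ^ a) atTop (𝓝 0) := by
  obtain ⟨c₁, hc₁, c₂, hc₂, hb⟩ := h.exists_bounds
  have hbad : MeasurableSet {x : ℝ | η * x ^ a ≤ |w x - C * x ^ a|} :=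
    measurableSet_le (by fun_prop) (measurable_norm.comp (by fun_prop :
      Measurable fun x : ℝ => w x - C * x ^ a))
  simp_rw [← setIntegral_indicator hbad]
  refine h.tendsto_integral_div hE (B := c₂) (fun x hx => ?_) (fun ε hε =>
    ⟨η / 2, by positivity, fun x hx hxd => ?_⟩) fun i =>
      ((h.cont.mono (hE.sub i)).integrableOn_Icc).indicator hbad
  · rw [zero_mul, sub_zero, ← Real.norm_eq_abs]
    refine (norm_indicator_le_norm_self _ _).trans ?_
    rw [Real.norm_of_nonneg (h.pos x hx).le]
    exact (hb x hx).2
  · have hp := Real.rpow_pos_of_pos (h.subset x hx) a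
    rw [indicator_of_notMem]
    · simpa using by positivity
    · simp only [mem_ofPred_eq, not_le]
      nlinarith

/-- The minimisers of the functional converge to `a`. Near-equality in Hölder's inequality forces
`x ^ (u - a)` to be almost constant on most of the mass of `w`, which is not contained in any window
`[y, 2y]`. -/
lemma tendsto_minimiser_of_measurable (h : PowerTail X w a C) (hwm : Measurable w)
    (hE : Exhausts X m M) (h0 : 0 < α) {u : ℕ → ℝ}
    (hu : ∀ i, priorObjective id w α (Icc (m i) (M i)) (u i) ≤
      priorObjective id w α (Icc (m i) (M i)) a) : Tendsto u atTop (𝓝 a) := by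
  have hC := h.const_pos
  obtain ⟨c₁, hc₁, c₂, hc₂, hb⟩ := h.exists_bounds
  obtain ⟨q, hq, hwin⟩ := exists_window_le (a := a) hc₁ hc₂
  rw [Metric.tendsto_nhds]
  intro ε hε
  -- the tolerance `η` is chosen so that `x ^ (u - a)` varies by a factor less than `2 ^ ε`
  obtain ⟨η, hη0, hη1, hηε⟩ : ∃ η : ℝ, 0 < η ∧ η < 1 ∧ (1 + η) ^ 2 < (1 - η) ^ 2 * 2 ^ ε := by
    have hcont : Continuous fun η : ℝ => (1 - η) ^ 2 * 2 ^ ε - (1 + η) ^ 2 := by fun_prop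
    have hev : ∀ᶠ η in 𝓝 (0 : ℝ), 0 < (1 - η) ^ 2 * 2 ^ ε - (1 + η) ^ 2 := by
      refine (hcont.tendsto 0).eventually_const_lt ?_
      have := Real.one_lt_rpow (x := 2) (by norm_num) hε
      norm_num
      exact this
    obtain ⟨η, ⟨h1, h2⟩, h3⟩ := ((hev.filter_mono nhdsWithin_le_nhds).and
      (nhdsWithin_le_nhds (Iio_mem_nhds one_pos) : ∀ᶠ η in 𝓝[>] (0 : ℝ), η < 1)).and
        self_mem_nhdsWithin |>.exists
    exact ⟨η, h3, h2, by linarith⟩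
  obtain ⟨c, hc, hgap⟩ := exists_bernoulli_gap (p := 1 + α) (by linarith) hη0 hη1
  set q' := q / (4 * (1 + q)) with hq'
  have hq'0 : 0 < q' := by positivity
  have hδ : 0 < c * q' := by positivity
  have hCη : 0 < C * η := by positivity
  filter_upwards [(h.tendsto_priorObjective hE h0).eventually_lt_const
      (show (1 : ℝ) < 1 + c * q' by linarith),
    (h.tendsto_integral_deviation hwm hE hCη).eventually_lt_const
      (show (0 : ℝ) < c₁ * q' by positivity),
    (h.tendsto_ratio hE).eventually_ge_atTop 8] with i e1 e2 e3
  have hm := h.left_pos hE i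
  have hKX := hE.sub i
  set K := Icc (m i) (M i) with hK
  have hKm : MeasurableSet K := measurableSet_Icc
  set W := ∫ x in K, w x with hWdef
  have hwi : IntegrableOn w K := (h.cont.mono hKX).integrableOn_Icc
  have hw0 : ∀ x ∈ K, 0 < w x := fun x hx => h.pos x (hKX hx)
  have hS := setIntegral_rpow_pos hm (hE.lt i) a
  have hD := setIntegral_rpow_pos hm (hE.lt i) (u i)
  rw [← hK] at hS hD
  have hWS : c₁ * ∫ x in K, x ^ a ≤ W := by
    rw [hWdef, ← integral_const_mul]
    exact setIntegral_mono_on (((h.cont_rpow a).mono hKX).integrableOn_Icc.const_mul _) hwi hKm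
      fun x hx => (hb x (hKX hx)).1
  have hW : 0 < W := (mul_pos hc₁ hS).trans_le hWS
  set D := ∫ x in K, x ^ u i with hDdef
  -- `Z` is the density of the restricted prior relative to the normalised weight
  set Z : ℝ → ℝ := fun x => x ^ u i / w x * (W / D) with hZ
  have hWD : 0 < W / D := div_pos hW hD
  have hx0 : ∀ x ∈ K, 0 < x := fun x hx => h.subset x (hKX hx)
  have hZ0 : ∀ x ∈ K, 0 < Z x := fun x hx =>
    mul_pos (div_pos (Real.rpow_pos_of_pos (hx0 x hx) _) (hw0 x hx)) hWD
  have hwZ : ∀ x ∈ K, w x * Z x = x ^ u i * (W / D) := fun x hx => by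
    have := (hw0 x hx).ne'
    simp only [hZ]; field_simp
  have hwZp : ∀ x ∈ K, w x * Z x ^ (1 + α) =
      x ^ (u i * (1 + α)) * (w x ^ α)⁻¹ * (W / D) ^ (1 + α) := fun x hx => by
    have hxu := Real.rpow_pos_of_pos (hx0 x hx) (u i)
    have hwx := hw0 x hx
    simp only [hZ]
    rw [Real.mul_rpow (div_pos hxu hwx).le hWD.le, Real.div_rpow hxu.le hwx.le,
      ← Real.rpow_mul (hx0 x hx).le, Real.rpow_add hwx, Real.rpow_one]
    have := (Real.rpow_pos_of_pos hwx α).ne'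
    field_simp
  have hbad1 : c * ∫ x in K ∩ {x | η ≤ |Z x - 1|}, w x ≤ c * q' * W := by
    refine setIntegral_deviation_le hKm (fun x hx => (hw0 x hx).le) (fun x hx => (hZ0 x hx).le)
      (by fun_prop) hgap (by linarith) hwi ?_ ?_ rfl ?_ ?_
    · exact IntegrableOn.congr_fun (((h.cont_rpow _).mono hKX).integrableOn_Icc.mul_const _)
        (fun x hx => (hwZ x hx).symm) hKm
    · exact IntegrableOn.congr_fun ((((h.cont_rpow _).mul
        (h.cont_inv_rpow α)).mono hKX).integrableOn_Icc.mul_const _)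
        (fun x hx => (hwZp x hx).symm) hKm
    · rw [setIntegral_congr_fun hKm hwZ, integral_mul_const, ← hDdef]
      field_simp
    · rw [setIntegral_congr_fun hKm hwZp, integral_mul_const]
      have e4 := mul_le_mul_of_nonneg_left (hu i) (mul_nonneg hW.le (Real.rpow_nonneg hW.le α))
      have e5 := mul_le_mul_of_nonneg_left e1.le hW.le
      have e6 : (∫ x in K, x ^ (u i * (1 + α)) * (w x ^ α)⁻¹) * (W / D) ^ (1 + α) =
          W * W ^ α * priorObjective id w α K (u i) := by
        rw [priorObjective, Real.div_rpow hW.le hD.le, Real.rpow_add hW, Real.rpow_one]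
        simp only [id]
        ring
      rw [e6]
      linarith
  have hbad1' := le_of_mul_le_mul_left (by linarith : _ ≤ c * (q' * W)) hc
  have hbad2 : ∫ x in K ∩ {x | C * η * x ^ a ≤ |w x - C * x ^ a|}, w x ≤ q' * W := by
    rw [div_lt_iff₀ hS] at e2
    nlinarith
  -- some pair of points of ratio at least `2` lies in the good set
  obtain ⟨x, hx, x', hx', hxx'⟩ : ∃ x ∈ K \ ({x | η ≤ |Z x - 1|} ∪
      {x | C * η * x ^ a ≤ |w x - C * x ^ a|}), ∃ x' ∈ K \ ({x | η ≤ |Z x - 1|} ∪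
      {x | C * η * x ^ a ≤ |w x - C * x ^ a|}), 2 * x ≤ x' := by
    refine exists_two_mul_le hKm ?_ ?_ hwi hw0 (fun x hx => hx.1) hq hW rfl
      (hwin (m i) (M i) w hm ((le_div_iff₀ hm).1 e3) hwi fun x hx => hb x (hKX hx)) hbad1' hbad2
    · exact measurableSet_le measurable_const (measurable_norm.comp (by fun_prop :
          Measurable fun x => Z x - 1))
    · exact measurableSet_le (by fun_prop) (measurable_norm.comp (by fun_prop :
          Measurable fun x : ℝ => w x - C * x ^ a))
  obtain ⟨hxK, hxb⟩ := hx
  obtain ⟨hxK', hxb'⟩ := hx'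
  -- `x ^ (u - a)` is, up to a constant factor, between `(1 - η) ^ 2` and `(1 + η) ^ 2`
  have hgood : ∀ z ∈ K, z ∉ ({x | η ≤ |Z x - 1|} ∪ {x | C * η * x ^ a ≤ |w x - C * x ^ a|}) →
      (1 - η) ^ 2 < z ^ (u i - a) * (W / D / C) ∧ z ^ (u i - a) * (W / D / C) < (1 + η) ^ 2 := by
    intro z hz hzb
    simp only [mem_union, mem_ofPred_eq, not_or, not_le] at hzb
    obtain ⟨b1, b2⟩ := hzb
    rw [abs_lt] at b1 b2
    have hza := Real.rpow_pos_of_pos (hx0 z hz) a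
    have e : z ^ (u i - a) * (W / D / C) = Z z * (w z / (C * z ^ a)) := by
      have := (hw0 z hz).ne'
      rw [Real.rpow_sub (hx0 z hz)]
      simp only [hZ]; field_simp
    have b3 : 1 - η < w z / (C * z ^ a) := by
      rw [lt_div_iff₀ (by positivity)]; linarith
    have b4 : w z / (C * z ^ a) < 1 + η := by
      rw [div_lt_iff₀ (by positivity)]; linarith
    rw [e, sq, sq]
    exact ⟨mul_lt_mul'' (by linarith) b3 (by linarith) (by linarith),
      mul_lt_mul'' (by linarith) b4 (hZ0 z hz).le (by linarith)⟩
  obtain ⟨g1, g2⟩ := hgood x hxK hxb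
  obtain ⟨g3, g4⟩ := hgood x' hxK' hxb'
  have hxp := hx0 x hxK
  set k := W / D / C with hk
  have hk0 : 0 < k := by positivity
  rw [Real.dist_eq]
  exact abs_lt_of_rpow_bounds hxp hxx' hk0 hηε hε g1 g2 g3 g4

lemma priorObjective_congr {g w' : ℝ → ℝ} {K : Set ℝ} (hK : MeasurableSet K) (α u : ℝ)
    (he : ∀ x ∈ K, w x = w' x) : priorObjective g w α K u = priorObjective g w' α K u := by
  rw [priorObjective, priorObjective]
  congr 1
  refine setIntegral_congr_fun hK fun x hx => ?_
  simp only [he x hx]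

/-- The minimisers of the functional converge to `a`, without a measurability assumption on `w`:
its values outside `X` do not matter. -/
theorem tendsto_minimiser (h : PowerTail X w a C) (hE : Exhausts X m M) (h0 : 0 < α) {u : ℕ → ℝ}
    (hu : ∀ i, priorObjective id w α (Icc (m i) (M i)) (u i) ≤
      priorObjective id w α (Icc (m i) (M i)) a) : Tendsto u atTop (𝓝 a) := by
  have he : ∀ x ∈ X, w x = X.indicator w x := fun x hx => (indicator_of_mem hx w).symm
  have h' : PowerTail X (X.indicator w) a C :=
    { measurableSet := h.measurableSet
      subset := h.subset
      cont := h.cont.congr fun x hx => (he x hx).symm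
      pos := fun x hx => by rw [← he x hx]; exact h.pos x hx
      const_pos := h.const_pos
      tail := fun ε hε => by
        obtain ⟨T, hTX, hT, hb⟩ := h.tail ε hε
        exact ⟨T, hTX, hT, fun x hx => by rw [← he x hx.1]; exact hb x hx⟩
      lower := h.lower
      wide := h.wide }
  classical
  have hm : Measurable (X.indicator w) := by
    rw [← piecewise_eq_indicator]
    exact h.cont.measurable_piecewise continuousOn_const h.measurableSet
  refine h'.tendsto_minimiser_of_measurable hm hE h0 (u := u) fun i => ?_
  rw [← priorObjective_congr measurableSet_Icc α (u i) fun x hx => he x (hE.sub i hx),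
    ← priorObjective_congr measurableSet_Icc α a fun x hx => he x (hE.sub i hx)]
  exact hu i

end PowerTail

/-! ### Power priors and their restrictions to compact intervals -/

/-- Every compact subset is eventually contained in the members of an openly increasing
sequence. -/
lemma OpenlyIncreasing.exists_subset {S T : Set ℝ} {K : ℕ → Set ℝ} (h : OpenlyIncreasing S K)
    (hT : IsCompact T) (hTS : T ⊆ S) : ∀ᶠ i in atTop, T ⊆ K i := by
  obtain ⟨-, hmono, hun, i₀, V, hV⟩ := h
  choose O hO hVO using fun i : ℕ => (hV (i₀ + i) (Nat.le_add_right _ _)).1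
  have hcov : T ⊆ ⋃ i, O i := fun x hx => by
    have hxS := hTS hx
    rw [← hun] at hxS
    obtain ⟨j, hj⟩ := mem_iUnion.1 hxS
    have h1 : x ∈ V (i₀ + j) :=
      (hV (i₀ + j) (Nat.le_add_right _ _)).2.1 (hmono (Nat.le_add_left _ _) hj)
    rw [hVO] at h1
    exact mem_iUnion.2 ⟨j, h1.1⟩
  obtain ⟨F, hF⟩ := hT.elim_finite_subcover O hO hcov
  filter_upwards [eventually_ge_atTop (i₀ + F.sup id + 1)] with i hi x hx
  obtain ⟨j, hj, hxj⟩ := mem_iUnion₂.1 (hF hx)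
  have h1 : x ∈ V (i₀ + j) := by rw [hVO]; exact ⟨hxj, hTS hx⟩
  have h2 := (hV (i₀ + j) (Nat.le_add_right _ _)).2.2 h1
  have h3 : j ≤ F.sup id := Finset.le_sup (f := id) hj
  exact hmono (by omega) h2

lemma OpenlyIncreasing.subset {S : Set ℝ} {K : ℕ → Set ℝ} (h : OpenlyIncreasing S K) (i : ℕ) :
    K i ⊆ S := by
  rw [← h.2.2.1]; exact subset_iUnion K i

lemma openlyIncreasing_const {S : Set ℝ} (hS : IsCompact S) : OpenlyIncreasing S fun _ => S :=
  ⟨fun _ => hS, monotone_const, iUnion_const S, 0, fun _ => S, fun _ _ =>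
    ⟨⟨univ, isOpen_univ, (univ_inter S).symm⟩, Subset.rfl, Subset.rfl⟩⟩

lemma isPrior_of_continuousOn {S : Set ℝ} (hS : MeasurableSet S) {f : ℝ → ℝ} (hfm : Measurable f)
    (hf0 : ∀ θ, 0 ≤ f θ) (hfc : ContinuousOn f S) {π : Measure ℝ} (hπ0 : π ≠ 0)
    (hπ : π = (volume.restrict S).withDensity fun θ => ENNReal.ofReal (f θ)) : IsPrior S π := by
  refine ⟨hπ0, f, hfm, hf0, fun θ hθ => ⟨f θ + 1, ?_⟩, ?_, hπ⟩
  · filter_upwards [(hfc θ hθ).tendsto.eventually_lt_const (lt_add_one (f θ))] with t ht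
    exact ht.le
  · exact (ae_restrict_iff' hS).2 (Eventually.of_forall fun θ hθ => hfc θ hθ)

/-- A nonnegative continuous function on the line that is positive on the parameter space; its
powers are the densities of the priors under consideration. -/
structure PriorBase (Θ : Set ℝ) (g : ℝ → ℝ) : Prop where
  measurableSet : MeasurableSet Θ
  cont : Continuous g
  nonneg : ∀ θ, 0 ≤ g θ
  pos : ∀ θ ∈ Θ, 0 < g θ

/-- Density, on `[s, t]`, of the probability measure proportional to `g ^ u`. -/
noncomputable def normPower (g : ℝ → ℝ) (s t u θ : ℝ) : ℝ :=
  g θ ^ u / ∫ x in Icc s t, g x ^ u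

namespace PriorBase

variable {Θ : Set ℝ} {g : ℝ → ℝ} {s t : ℝ}

lemma measurable_rpow (hg : PriorBase Θ g) (u : ℝ) : Measurable fun θ => g θ ^ u :=
  hg.cont.measurable.pow_const u

lemma continuousOn_rpow (hg : PriorBase Θ g) (u : ℝ) : ContinuousOn (fun θ => g θ ^ u) Θ :=
  hg.cont.continuousOn.rpow_const fun x hx => Or.inl (hg.pos x hx).ne'

lemma integrableOn_rpow (hg : PriorBase Θ g) (hsub : Icc s t ⊆ Θ) (u : ℝ) :
    IntegrableOn (fun θ => g θ ^ u) (Icc s t) :=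
  ((hg.continuousOn_rpow u).mono hsub).integrableOn_Icc

lemma integral_rpow_pos (hg : PriorBase Θ g) (hst : s < t) (hsub : Icc s t ⊆ Θ) (u : ℝ) :
    0 < ∫ x in Icc s t, g x ^ u := by
  rw [integral_Icc_eq_integral_Ioc, ← intervalIntegral.integral_of_le hst.le]
  exact intervalIntegral.intervalIntegral_pos_of_pos_on
    (((hg.continuousOn_rpow u).mono hsub).intervalIntegrable_of_Icc hst.le)
    (fun x hx => Real.rpow_pos_of_pos (hg.pos x (hsub (Ioo_subset_Icc_self hx))) _) hst

lemma powerPrior_Icc (hg : PriorBase Θ g) (hsub : Icc s t ⊆ Θ) (u : ℝ) :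
    powerPrior Θ g u (Icc s t) = ENNReal.ofReal (∫ x in Icc s t, g x ^ u) := by
  rw [powerPrior, withDensity_apply _ measurableSet_Icc,
    Measure.restrict_restrict measurableSet_Icc, inter_eq_left.2 hsub,
    ofReal_integral_eq_lintegral_ofReal (hg.integrableOn_rpow hsub u)
      (Eventually.of_forall fun x => Real.rpow_nonneg (hg.nonneg x) _)]

lemma normPower_measurable (hg : PriorBase Θ g) (u : ℝ) : Measurable (normPower g s t u) :=
  (hg.measurable_rpow u).div_const _

lemma normPower_nonneg (hg : PriorBase Θ g) (u θ : ℝ) : 0 ≤ normPower g s t u θ :=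
  div_nonneg (Real.rpow_nonneg (hg.nonneg θ) _)
    (integral_nonneg fun x => Real.rpow_nonneg (hg.nonneg x) _)

lemma normPower_continuousOn (hg : PriorBase Θ g) (hsub : Icc s t ⊆ Θ) (u : ℝ) :
    ContinuousOn (normPower g s t u) (Icc s t) :=
  ((hg.continuousOn_rpow u).mono hsub).div_const _

lemma integral_normPower (hg : PriorBase Θ g) (hst : s < t) (hsub : Icc s t ⊆ Θ) (u : ℝ) :
    ∫ θ in Icc s t, normPower g s t u θ = 1 := by
  simp only [normPower]
  rw [integral_div, div_self (hg.integral_rpow_pos hst hsub u).ne']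

lemma densityOn_normPower_apply (hg : PriorBase Θ g) (hst : s < t) (hsub : Icc s t ⊆ Θ) (u : ℝ) :
    densityOn s t (normPower g s t u) (Icc s t) = 1 := by
  rw [densityOn, withDensity_apply _ measurableSet_Icc, Measure.restrict_restrict measurableSet_Icc,
    inter_self, ← ofReal_integral_eq_lintegral_ofReal
      ((hg.normPower_continuousOn hsub u).integrableOn_Icc)
      (Eventually.of_forall fun x => hg.normPower_nonneg u x), hg.integral_normPower hst hsub,
    ENNReal.ofReal_one]

lemma cond_densityOn_self (hg : PriorBase Θ g) (hst : s < t) (hsub : Icc s t ⊆ Θ) (u : ℝ) :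
    ProbabilityTheory.cond (densityOn s t (normPower g s t u)) (Icc s t) =
      densityOn s t (normPower g s t u) := by
  rw [ProbabilityTheory.cond, hg.densityOn_normPower_apply hst hsub, inv_one, one_smul, densityOn,
    restrict_withDensity measurableSet_Icc, Measure.restrict_restrict measurableSet_Icc, inter_self]

lemma cond_eq_densityOn (hg : PriorBase Θ g) (hst : s < t) (hsub : Icc s t ⊆ Θ) {u : ℝ}
    {π : Measure ℝ} (hπ : PropEquiv π (powerPrior Θ g u)) :
    ProbabilityTheory.cond π (Icc s t) = densityOn s t (normPower g s t u) := by
  obtain ⟨δ, hδ, rfl⟩ := hπ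
  have hD := hg.integral_rpow_pos hst hsub u
  rw [ProbabilityTheory.cond, Measure.restrict_smul, Measure.smul_apply, hg.powerPrior_Icc hsub,
    powerPrior, restrict_withDensity measurableSet_Icc, Measure.restrict_restrict measurableSet_Icc,
    inter_eq_left.2 hsub, smul_smul, smul_eq_mul, ← ENNReal.ofReal_mul hδ.le,
    ← ENNReal.ofReal_inv_of_pos (by positivity), ← ENNReal.ofReal_mul (by positivity), densityOn,
    ← withDensity_smul _ (hg.measurable_rpow u).ennreal_ofReal]
  congr 1
  ext θ
  simp only [Pi.smul_apply, smul_eq_mul, normPower]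
  rw [← ENNReal.ofReal_mul (by positivity)]
  congr 1
  field_simp

lemma powerPrior_ne_zero (hg : PriorBase Θ g) (hst : s < t) (hsub : Icc s t ⊆ Θ) {u : ℝ}
    {π : Measure ℝ} (hπ : PropEquiv π (powerPrior Θ g u)) : 0 < π (Icc s t) := by
  obtain ⟨δ, hδ, rfl⟩ := hπ
  rw [Measure.smul_apply, hg.powerPrior_Icc hsub, smul_eq_mul, ← ENNReal.ofReal_mul hδ.le]
  exact ENNReal.ofReal_pos.2 (mul_pos hδ (hg.integral_rpow_pos hst hsub u))

lemma isPrior_of_mem (hg : PriorBase Θ g) (hst : s < t) (hsub : Icc s t ⊆ Θ) {π : Measure ℝ}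
    (hπ : π ∈ powerClass Θ g) : IsPrior Θ π := by
  obtain ⟨u, hu⟩ := hπ
  have h0 := hg.powerPrior_ne_zero hst hsub hu
  obtain ⟨δ, hδ, rfl⟩ := hu
  refine isPrior_of_continuousOn hg.measurableSet ((hg.measurable_rpow u).const_mul δ)
    (fun θ => mul_nonneg hδ.le (Real.rpow_nonneg (hg.nonneg θ) _))
    ((hg.continuousOn_rpow u).const_mul δ) (fun h => by rw [h] at h0; simp at h0) ?_
  rw [powerPrior, ← withDensity_smul _ (hg.measurable_rpow u).ennreal_ofReal]
  congr 1
  ext θ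
  simp only [Pi.smul_apply, smul_eq_mul]
  rw [← ENNReal.ofReal_mul hδ.le]

lemma mem_renormRestrictions_iff (hg : PriorBase Θ g) (hst : s < t) (hsub : Icc s t ⊆ Θ)
    {ρ : Measure ℝ} : ρ ∈ renormRestrictions (powerClass Θ g) (Icc s t) ↔
      ∃ u, ρ = densityOn s t (normPower g s t u) := by
  constructor
  · rintro ⟨π, ⟨u, hu⟩, -, rfl⟩
    exact ⟨u, hg.cond_eq_densityOn hst hsub hu⟩
  · rintro ⟨u, rfl⟩
    have hu : PropEquiv (powerPrior Θ g u) (powerPrior Θ g u) := ⟨1, one_pos, by simp⟩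
    exact ⟨powerPrior Θ g u, ⟨u, hu⟩, hg.powerPrior_ne_zero hst hsub hu,
      (hg.cond_eq_densityOn hst hsub hu).symm⟩

lemma isPrior_densityOn (hg : PriorBase Θ g) (hst : s < t) (hsub : Icc s t ⊆ Θ) (u : ℝ) :
    IsPrior (Icc s t) (densityOn s t (normPower g s t u)) := by
  refine isPrior_of_continuousOn measurableSet_Icc (hg.normPower_measurable u)
    (hg.normPower_nonneg u) (hg.normPower_continuousOn hsub u) (fun h => ?_) rfl
  have := hg.densityOn_normPower_apply hst hsub u
  rw [h] at this
  simp at this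

variable {𝓨 : Type*} [MeasurableSpace 𝓨] {μ : Measure 𝓨} {ℓ : 𝓨 → ℝ → ℝ} {α : ℝ}

/-- Differences of mutual informations of restricted power priors are governed by the functional
`priorObjective`. -/
lemma tendsto_mutualInfo_sub (hg : PriorBase Θ g) (hmodel : RegularModel μ ℓ Θ) [SigmaFinite μ]
    (hΘ : UniqueDiffOn ℝ Θ) (h0 : 0 < α) (h1 : α < 1) (hst : s < t) (hsub : Icc s t ⊆ Θ)
    (u v : ℝ) :
    Tendsto (fun k : ℕ => (k : ℝ) ^ (α / 2) *
      (mutualInfo μ ℓ α (densityOn s t (normPower g s t u)) k -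
        mutualInfo μ ℓ α (densityOn s t (normPower g s t v)) k)) atTop
      (𝓝 (limitConst α / (α * (1 - α)) *
        (priorObjective g (fun θ => √(fisherInfo μ ℓ Θ θ)) α (Icc s t) v -
          priorObjective g (fun θ => √(fisherInfo μ ℓ Θ θ)) α (Icc s t) u))) := by
  obtain ⟨ℓ₁, hmodel₁, he, hpos, hC⟩ := hmodel.exists_regular_version
  have hF := hmodel₁.smoothFamily hpos hC hΘ hst hsub
  rw [← fisherInfo_congr he] at hF
  have key := fun w : ℝ => hF.tendsto_mutualInfo (hg.normPower_measurable w) (hg.normPower_nonneg w)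
    (hg.normPower_continuousOn hsub w) (hg.integral_normPower hst hsub w) h0 h1
  have hobj : ∀ w : ℝ, ∫ x in Icc s t, normPower g s t w x *
      (normPower g s t w x ^ α * (√(fisherInfo μ ℓ Θ x) ^ α)⁻¹) =
      priorObjective g (fun θ => √(fisherInfo μ ℓ Θ θ)) α (Icc s t) w := by
    intro w
    rw [priorObjective, ← integral_div]
    refine setIntegral_congr_fun measurableSet_Icc fun x hx => ?_
    have hD := hg.integral_rpow_pos hst hsub w
    have hgx := hg.pos x (hsub hx)
    have hgw := Real.rpow_pos_of_pos hgx w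
    simp only [normPower]
    rw [Real.div_rpow hgw.le hD.le, Real.rpow_mul hgx.le, Real.rpow_add hgw, Real.rpow_add hD,
      Real.rpow_one, Real.rpow_one]
    field_simp
  simp_rw [hobj] at key
  refine ((key u).sub (key v)).congr' ?_ |>.trans (le_of_eq ?_)
  · refine Eventually.of_forall fun k => ?_
    simp only [mutualInfo_congr he]
    ring
  · congr 1
    have : 1 - α ≠ 0 := by linarith
    have : α - 1 ≠ 0 := by linarith
    field_simp
    ring

/-- The reference priors among the restrictions of power priors to a compact interval are the
minimisers of `priorObjective`. -/
lemma isReferencePrior_iff (hg : PriorBase Θ g) (hmodel : RegularModel μ ℓ Θ) [SigmaFinite μ]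
    (hΘ : UniqueDiffOn ℝ Θ) (h0 : 0 < α) (h1 : α < 1) (hst : s < t) (hsub : Icc s t ⊆ Θ)
    {ρ : Measure ℝ} :
    IsReferencePrior μ ℓ α (fun k => (k : ℝ) ^ (α / 2)) (Icc s t)
      (renormRestrictions (powerClass Θ g) (Icc s t)) ρ ↔
    ∃ u, ρ = densityOn s t (normPower g s t u) ∧ ∀ v,
      priorObjective g (fun θ => √(fisherInfo μ ℓ Θ θ)) α (Icc s t) u ≤
        priorObjective g (fun θ => √(fisherInfo μ ℓ Θ θ)) α (Icc s t) v := by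
  have hc : 0 < limitConst α / (α * (1 - α)) :=
    div_pos (limitConst_pos h1) (mul_pos h0 (by linarith))
  constructor
  · rintro ⟨-, hρ, K, hK, -, hlim⟩
    obtain ⟨u, rfl⟩ := (hg.mem_renormRestrictions_iff hst hsub).1 hρ
    refine ⟨u, rfl, fun v => ?_⟩
    -- an openly increasing sequence in a compact set is eventually constant
    obtain ⟨i, hi⟩ := (hK.exists_subset isCompact_Icc Subset.rfl).exists
    have hKi : K i = Icc s t := (hK.subset i).antisymm hi
    obtain ⟨L, hL, hLt⟩ := hlim i _ ((hg.mem_renormRestrictions_iff hst hsub).2 ⟨v, rfl⟩) (by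
      rw [hKi, hg.densityOn_normPower_apply hst hsub]; exact one_pos)
    rw [hKi, hg.cond_densityOn_self hst hsub, hg.cond_densityOn_self hst hsub] at hLt
    have := tendsto_nhds_unique hLt (hg.tendsto_mutualInfo_sub hmodel hΘ h0 h1 hst hsub u v)
    rw [this] at hL
    exact sub_nonneg.1 (nonneg_of_mul_nonneg_right hL hc)
  · rintro ⟨u, rfl, hu⟩
    refine ⟨fun π hπ => ?_, (hg.mem_renormRestrictions_iff hst hsub).2 ⟨u, rfl⟩, fun _ => Icc s t,
      openlyIncreasing_const isCompact_Icc, fun _ => ?_, fun _ π hπ _ => ?_⟩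
    · obtain ⟨v, rfl⟩ := (hg.mem_renormRestrictions_iff hst hsub).1 hπ
      exact hg.isPrior_densityOn hst hsub v
    · rw [hg.densityOn_normPower_apply hst hsub]; exact one_pos
    · obtain ⟨v, rfl⟩ := (hg.mem_renormRestrictions_iff hst hsub).1 hπ
      rw [hg.cond_densityOn_self hst hsub, hg.cond_densityOn_self hst hsub]
      exact ⟨_, mul_nonneg hc.le (sub_nonneg.2 (hu v)),
        hg.tendsto_mutualInfo_sub hmodel hΘ h0 h1 hst hsub u v⟩

end PriorBase

/-! ### Q-vague limits of restricted power priors -/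

namespace PriorBase

variable {Θ : Set ℝ} {g : ℝ → ℝ} {s t : ℝ}

lemma integral_powerPrior (hg : PriorBase Θ g) (u : ℝ) (f : ℝ → ℝ) :
    ∫ θ, f θ ∂(powerPrior Θ g u) = ∫ θ in Θ, g θ ^ u * f θ := by
  rw [powerPrior, integral_withDensity_eq_integral_toReal_smul (hg.measurable_rpow u).ennreal_ofReal
    (Eventually.of_forall fun y => ENNReal.ofReal_lt_top)]
  refine integral_congr_ae (Eventually.of_forall fun y => ?_)
  simp only [ENNReal.toReal_ofReal (Real.rpow_nonneg (hg.nonneg y) u), smul_eq_mul]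

lemma integral_densityOn_normPower (hg : PriorBase Θ g) (u : ℝ) (f : ℝ → ℝ) :
    ∫ θ, f θ ∂(densityOn s t (normPower g s t u)) =
      (∫ θ in Icc s t, g θ ^ u * f θ) / ∫ x in Icc s t, g x ^ u := by
  rw [integral_densityOn (hg.normPower_measurable u) (hg.normPower_nonneg u), ← integral_div]
  simp only [normPower, div_mul_eq_mul_div]

/-- Vague convergence of the restrictions of `g ^ u i` when `u i → a`. -/
lemma tendsto_setIntegral (hg : PriorBase Θ g) {S T : ℕ → ℝ}
    (hK : OpenlyIncreasing Θ fun i => Icc (S i) (T i)) {u : ℕ → ℝ} {a : ℝ}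
    (hu : Tendsto u atTop (𝓝 a)) {f : ℝ → ℝ} (hf : ContinuousOn f Θ) {Q : Set ℝ} (hQΘ : Q ⊆ Θ)
    (hQ : IsCompact Q) (hf0 : ∀ θ, θ ∉ Q → f θ = 0) :
    Tendsto (fun i => ∫ θ in Icc (S i) (T i), g θ ^ u i * f θ) atTop
      (𝓝 (∫ θ in Θ, g θ ^ a * f θ)) := by
  have hlim : Tendsto (fun i => ∫ θ in Q, g θ ^ u i * f θ) atTop (𝓝 (∫ θ in Q, g θ ^ a * f θ)) := by
    have hlogc : ContinuousOn (fun θ => Real.log (g θ)) Q :=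
      hg.cont.continuousOn.log fun x hx => (hg.pos x (hQΘ hx)).ne'
    have hbc : ContinuousOn (fun θ => Real.exp ((|a| + 1) * |Real.log (g θ)|) * |f θ|) Q :=
      (Real.continuous_exp.comp_continuousOn (continuousOn_const.mul hlogc.abs)).mul
        (hf.mono hQΘ).abs
    refine tendsto_integral_filter_of_dominated_convergence
      (fun θ => Real.exp ((|a| + 1) * |Real.log (g θ)|) * |f θ|) ?_ ?_
      (hbc.integrableOn_compact hQ) ?_
    · exact Eventually.of_forall fun i => (((hg.continuousOn_rpow _).mul hf).mono
        hQΘ).aestronglyMeasurable hQ.measurableSet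
    · filter_upwards [hu.abs.eventually_le_const (lt_add_one |a|)] with i hi
      refine (ae_restrict_iff' hQ.measurableSet).2 (Eventually.of_forall fun θ hθ => ?_)
      have hgθ := hg.pos θ (hQΘ hθ)
      rw [norm_mul, Real.norm_eq_abs, Real.norm_eq_abs, abs_of_pos (Real.rpow_pos_of_pos hgθ _),
        Real.rpow_def_of_pos hgθ]
      refine mul_le_mul_of_nonneg_right (Real.exp_le_exp.2 ?_) (abs_nonneg _)
      refine (le_abs_self _).trans ?_
      rw [abs_mul, mul_comm]
      exact mul_le_mul_of_nonneg_right hi (abs_nonneg _)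
    · refine (ae_restrict_iff' hQ.measurableSet).2 (Eventually.of_forall fun θ hθ => ?_)
      exact (((Real.continuousAt_const_rpow (hg.pos θ (hQΘ hθ)).ne').tendsto.comp hu)).mul_const _
  rw [setIntegral_eq_of_subset_of_forall_sdiff_eq_zero hg.measurableSet hQΘ
    fun x hx => by rw [hf0 x hx.2, mul_zero]]
  refine hlim.congr' ?_
  filter_upwards [hK.exists_subset hQ hQΘ] with i hi
  exact (setIntegral_eq_of_subset_of_forall_sdiff_eq_zero measurableSet_Icc hi
    fun x hx => by rw [hf0 x hx.2, mul_zero]).symm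

lemma qVagueTendsto (hg : PriorBase Θ g) {S T : ℕ → ℝ} (hST : ∀ i, S i < T i)
    (hK : OpenlyIncreasing Θ fun i => Icc (S i) (T i)) {u : ℕ → ℝ} {a : ℝ}
    (hu : Tendsto u atTop (𝓝 a)) {π : Measure ℝ} (hπ : PropEquiv π (powerPrior Θ g a)) :
    QVagueTendsto Θ (fun i => densityOn (S i) (T i) (normPower g (S i) (T i) (u i))) π := by
  obtain ⟨δ, hδ, rfl⟩ := hπ
  have hD := fun i => hg.integral_rpow_pos (hST i) (hK.subset i) (u i)
  refine ⟨fun i => δ * ∫ x in Icc (S i) (T i), g x ^ u i, fun i => mul_pos hδ (hD i), ?_⟩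
  rintro f hf ⟨Q, hQΘ, hQ, hf0⟩
  rw [integral_smul_measure, hg.integral_powerPrior, ENNReal.toReal_ofReal hδ.le, smul_eq_mul]
  refine ((hg.tendsto_setIntegral hK hu hf hQΘ hQ hf0).const_mul δ).congr fun i => ?_
  rw [hg.integral_densityOn_normPower]
  have := (hD i).ne'
  field_simp

/-- Two Q-vague limits of the same sequence of power priors have the same exponent. -/
lemma eq_of_qVagueTendsto (hg : PriorBase Θ g) (hinj : InjOn g Θ) {S T : ℕ → ℝ}
    (hST : ∀ i, S i < T i) (hK : OpenlyIncreasing Θ fun i => Icc (S i) (T i)) {u : ℕ → ℝ} {a b : ℝ}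
    (hu : Tendsto u atTop (𝓝 a)) {π : Measure ℝ} (hπ : PropEquiv π (powerPrior Θ g b))
    (hq : QVagueTendsto Θ (fun i => densityOn (S i) (T i) (normPower g (S i) (T i) (u i))) π) :
    a = b := by
  obtain ⟨δ, hδ, rfl⟩ := hπ
  obtain ⟨σ, -, hσ⟩ := hq
  have hsub := hK.subset 0
  set s := S 0
  set t := T 0
  have hst : s < t := hST 0
  -- a continuous cutoff supported by `[s, t]` and positive inside
  set χ : ℝ → ℝ := fun θ => max 0 (min (θ - s) (t - θ)) with hχ
  have hχc : Continuous χ := by fun_prop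
  have hχ0 : ∀ θ, 0 ≤ χ θ := fun θ => le_max_left _ _
  have hχs : ∀ θ, θ ∉ Icc s t → χ θ = 0 := fun θ hθ => by
    refine max_eq_left ?_
    by_contra! h
    rw [lt_min_iff] at h
    exact hθ ⟨by linarith [h.1], by linarith [h.2]⟩
  have hχp : ∀ θ ∈ Ioo s t, 0 < χ θ := fun θ hθ =>
    lt_max_of_lt_right (lt_min (by linarith [hθ.1]) (by linarith [hθ.2]))
  have hlim : ∀ f : ℝ → ℝ, ContinuousOn f Θ → (∀ θ, θ ∉ Icc s t → f θ = 0) →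
      Tendsto (fun i => (σ i / ∫ x in Icc (S i) (T i), g x ^ u i) *
        ∫ θ in Icc (S i) (T i), g θ ^ u i * f θ) atTop (𝓝 (δ * ∫ θ in Θ, g θ ^ b * f θ)) := by
    intro f hf hf0
    have := hσ f hf ⟨Icc s t, hsub, isCompact_Icc, hf0⟩
    rw [integral_smul_measure, hg.integral_powerPrior, ENNReal.toReal_ofReal hδ.le,
      smul_eq_mul] at this
    refine this.congr fun i => ?_
    rw [hg.integral_densityOn_normPower]
    ring
  have hlim' : ∀ f : ℝ → ℝ, ContinuousOn f Θ → (∀ θ, θ ∉ Icc s t → f θ = 0) →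
      Tendsto (fun i => ∫ θ in Icc (S i) (T i), g θ ^ u i * f θ) atTop
        (𝓝 (∫ θ in Θ, g θ ^ a * f θ)) := fun f hf hf0 =>
    hg.tendsto_setIntegral hK hu hf hsub isCompact_Icc hf0
  have hΘIcc : ∀ (v : ℝ) (f : ℝ → ℝ), (∀ θ, θ ∉ Icc s t → f θ = 0) →
      ∫ θ in Θ, g θ ^ v * f θ = ∫ θ in Icc s t, g θ ^ v * f θ := fun v f hf0 =>
    setIntegral_eq_of_subset_of_forall_sdiff_eq_zero hg.measurableSet hsub
      fun x hx => by rw [hf0 x hx.2, mul_zero]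
  have hpos : ∀ v : ℝ, 0 < ∫ θ in Θ, g θ ^ v * χ θ := fun v => by
    rw [hΘIcc v χ hχs, integral_Icc_eq_integral_Ioc, ← intervalIntegral.integral_of_le hst.le]
    exact intervalIntegral.intervalIntegral_pos_of_pos_on
      ((((hg.continuousOn_rpow v).mono hsub).mul
        hχc.continuousOn).intervalIntegrable_of_Icc hst.le)
      (fun x hx => mul_pos (Real.rpow_pos_of_pos (hg.pos x (hsub (Ioo_subset_Icc_self hx))) _)
        (hχp x hx)) hst
  -- the scaling constants converge
  set τ := δ * (∫ θ in Θ, g θ ^ b * χ θ) / ∫ θ in Θ, g θ ^ a * χ θ with hτ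
  have hτ0 : 0 < τ := div_pos (mul_pos hδ (hpos b)) (hpos a)
  have hτlim : Tendsto (fun i => σ i / ∫ x in Icc (S i) (T i), g x ^ u i) atTop (𝓝 τ) := by
    refine ((hlim χ hχc.continuousOn hχs).div (hlim' χ hχc.continuousOn hχs)
      (hpos a).ne').congr' ?_
    filter_upwards [(hlim' χ hχc.continuousOn hχs).eventually_const_lt (hpos a)] with i hi
    simp only [Pi.div_apply]
    field_simp
  -- testing against the difference of the two densities shows that they agree
  set h : ℝ → ℝ := fun θ => τ * g θ ^ a - δ * g θ ^ b with hh
  have hhc : ContinuousOn h Θ :=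
    ((hg.continuousOn_rpow a).const_mul τ).sub ((hg.continuousOn_rpow b).const_mul δ)
  have hfc : ContinuousOn (fun θ => h θ * χ θ) Θ := hhc.mul hχc.continuousOn
  have hf0 : ∀ θ, θ ∉ Icc s t → h θ * χ θ = 0 := fun θ hθ => by rw [hχs θ hθ, mul_zero]
  have heq : τ * ∫ θ in Θ, g θ ^ a * (h θ * χ θ) = δ * ∫ θ in Θ, g θ ^ b * (h θ * χ θ) :=
    tendsto_nhds_unique (hτlim.mul (hlim' _ hfc hf0)) (hlim _ hfc hf0)
  have hi : ∀ v : ℝ, IntegrableOn (fun θ => g θ ^ v * (h θ * χ θ)) (Icc s t) := fun v =>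
    (((hg.continuousOn_rpow v).mul hfc).mono hsub).integrableOn_Icc
  have hzero : ∫ θ in Icc s t, h θ ^ 2 * χ θ = 0 := by
    rw [hΘIcc a _ hf0, hΘIcc b _ hf0] at heq
    have : ∫ θ in Icc s t, (τ * (g θ ^ a * (h θ * χ θ)) - δ * (g θ ^ b * (h θ * χ θ))) = 0 := by
      rw [integral_sub ((hi a).const_mul τ) ((hi b).const_mul δ), integral_const_mul,
        integral_const_mul, heq, sub_self]
    rw [← this]
    refine setIntegral_congr_fun measurableSet_Icc fun θ _ => ?_
    simp only [hh]; ring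
  have hcc : ContinuousOn (fun θ => h θ ^ 2 * χ θ) (Icc s t) :=
    ((hhc.mono hsub).pow 2).mul hχc.continuousOn
  have hvan : ∀ θ ∈ Ioo s t, h θ = 0 := by
    intro θ hθ
    have hae : (fun θ => h θ ^ 2 * χ θ) =ᵐ[volume.restrict (Icc s t)] fun _ => (0 : ℝ) :=
      (setIntegral_eq_zero_iff_of_nonneg_ae (Eventually.of_forall fun θ =>
        mul_nonneg (sq_nonneg _) (hχ0 θ)) hcc.integrableOn_Icc).1 hzero
    have := Measure.eqOn_Icc_of_ae_eq volume hst.ne hae hcc continuousOn_const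
      (Ioo_subset_Icc_self hθ)
    simp only [mul_eq_zero, (hχp θ hθ).ne', or_false] at this
    exact pow_eq_zero_iff two_ne_zero |>.1 this
  have hconst : ∀ θ ∈ Ioo s t, (b - a) * Real.log (g θ) = Real.log (τ / δ) := by
    intro θ hθ
    have hgθ := hg.pos θ (hsub (Ioo_subset_Icc_self hθ))
    have h1 := hvan θ hθ
    have h2 : g θ ^ (b - a) = τ / δ := by
      rw [Real.rpow_sub hgθ, div_eq_div_iff (Real.rpow_pos_of_pos hgθ _).ne' hδ.ne']
      simp only [hh] at h1
      linarith
    rw [← h2, Real.log_rpow hgθ]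
  obtain ⟨p, hp1, hp2⟩ := exists_between hst
  obtain ⟨p', hp1', hp2'⟩ := exists_between hp2
  have hp : p ∈ Ioo s t := ⟨hp1, hp2⟩
  have hp' : p' ∈ Ioo s t := ⟨hp1.trans hp1', hp2'⟩
  have hne : Real.log (g p) ≠ Real.log (g p') := fun hl => hp1'.ne (hinj
    (hsub (Ioo_subset_Icc_self hp)) (hsub (Ioo_subset_Icc_self hp'))
    (Real.log_injOn_pos (hg.pos p (hsub (Ioo_subset_Icc_self hp)))
      (hg.pos p' (hsub (Ioo_subset_Icc_self hp'))) hl))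
  have : (b - a) * (Real.log (g p) - Real.log (g p')) = 0 := by
    rw [mul_sub, hconst p hp, hconst p' hp', sub_self]
  rcases mul_eq_zero.1 this with h1 | h1
  · linarith
  · exact absurd (sub_eq_zero.1 h1) hne

variable {𝓨 : Type*} [MeasurableSpace 𝓨] {μ : Measure 𝓨} {ℓ : 𝓨 → ℝ → ℝ} {α : ℝ}

/-- If the minimisers of `priorObjective` along exhausting intervals converge to `a`, then the
prior proportional to `g ^ a` is the quasi reference prior. -/
theorem isTheQuasiReferencePrior (hg : PriorBase Θ g) (hinj : InjOn g Θ)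
    (hmodel : RegularModel μ ℓ Θ) [SigmaFinite μ] (hΘ : UniqueDiffOn ℝ Θ) (h0 : 0 < α) (h1 : α < 1)
    {a : ℝ}
    (hmin : ∀ s t : ℝ, s < t → Icc s t ⊆ Θ → ∃ u, ∀ v,
      priorObjective g (fun θ => √(fisherInfo μ ℓ Θ θ)) α (Icc s t) u ≤
        priorObjective g (fun θ => √(fisherInfo μ ℓ Θ θ)) α (Icc s t) v)
    (hconv : ∀ S T : ℕ → ℝ, (∀ i, S i < T i) → OpenlyIncreasing Θ (fun i => Icc (S i) (T i)) →
      ∀ u : ℕ → ℝ, (∀ i v,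
        priorObjective g (fun θ => √(fisherInfo μ ℓ Θ θ)) α (Icc (S i) (T i)) (u i) ≤
          priorObjective g (fun θ => √(fisherInfo μ ℓ Θ θ)) α (Icc (S i) (T i)) v) →
      Tendsto u atTop (𝓝 a))
    (hex : ∃ S T : ℕ → ℝ, (∀ i, S i < T i) ∧ OpenlyIncreasing Θ fun i => Icc (S i) (T i))
    {πs : Measure ℝ} (hπs : PropEquiv πs (powerPrior Θ g a)) :
    IsTheQuasiReferencePrior μ ℓ α (fun k => (k : ℝ) ^ (α / 2)) Θ (powerClass Θ g) πs := by
  have along : ∀ S T : ℕ → ℝ, (∀ i, S i < T i) → OpenlyIncreasing Θ (fun i => Icc (S i) (T i)) →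
      ∀ π, PropEquiv π (powerPrior Θ g a) →
      IsQuasiReferencePriorAlong μ ℓ α (fun k => (k : ℝ) ^ (α / 2)) Θ (powerClass Θ g)
        (fun i => Icc (S i) (T i)) π := by
    intro S T hST hK π hπ
    choose u hu using fun i => hmin (S i) (T i) (hST i) (hK.subset i)
    exact ⟨fun π' hπ' => hg.isPrior_of_mem (hST 0) (hK.subset 0) hπ', ⟨a, hπ⟩, hK,
      fun i => densityOn (S i) (T i) (normPower g (S i) (T i) (u i)), fun i =>
        (hg.isReferencePrior_iff hmodel hΘ h0 h1 (hST i) (hK.subset i)).2 ⟨u i, rfl, hu i⟩,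
      hg.qVagueTendsto hST hK (hconv S T hST hK u hu) hπ⟩
  constructor
  · obtain ⟨S, T, hST, hK⟩ := hex
    exact ⟨_, along S T hST hK πs hπs⟩
  · intro K hK hKi π
    choose S T hST hKe using hKi
    obtain rfl : K = fun i => Icc (S i) (T i) := funext hKe
    constructor
    · rintro ⟨-, ⟨b, hb⟩, -, ρ, hρ, hq⟩
      choose u hρu hu using fun i =>
        (hg.isReferencePrior_iff hmodel hΘ h0 h1 (hST i) (hK.subset i)).1 (hρ i)
      obtain rfl : ρ = fun i => densityOn (S i) (T i) (normPower g (S i) (T i) (u i)) :=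
        funext hρu
      obtain rfl := hg.eq_of_qVagueTendsto hinj hST hK (hconv S T hST hK u hu) hb hq
      obtain ⟨δ, hδ, rfl⟩ := hb
      obtain ⟨δ', hδ', rfl⟩ := hπs
      refine ⟨δ / δ', div_pos hδ hδ', ?_⟩
      rw [smul_smul, ← ENNReal.ofReal_mul (div_pos hδ hδ').le, div_mul_cancel₀ _ hδ'.ne']
    · rintro ⟨δ, hδ, rfl⟩
      obtain ⟨δ', hδ', rfl⟩ := hπs
      refine along S T hST hK _ ⟨δ * δ', mul_pos hδ hδ', ?_⟩
      rw [smul_smul, ← ENNReal.ofReal_mul hδ.le]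

end PriorBase

/-! ### Half-open intervals and half-lines -/

lemma openlyIncreasing_Icc_right {Θ : Set ℝ} {c : ℝ} {T : ℕ → ℝ} (hT : StrictMono T)
    (hsub : ∀ i, Icc c (T i) ⊆ Θ) (hΘ : Θ ⊆ Ici c) (hcov : ∀ x ∈ Θ, ∃ i, x ≤ T i) :
    OpenlyIncreasing Θ fun i => Icc c (T i) := by
  refine ⟨fun i => isCompact_Icc, fun i j hij => Icc_subset_Icc_right (hT.monotone hij),
    (iUnion_subset hsub).antisymm fun x hx => ?_, 0, fun i => Iio (T (i + 1)) ∩ Θ, fun i _ =>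
    ⟨⟨_, isOpen_Iio, rfl⟩, fun x hx => ⟨hx.2.trans_lt (hT (Nat.lt_succ_self i)), hsub i hx⟩,
      fun x hx => ⟨hΘ hx.2, le_of_lt hx.1⟩⟩⟩
  obtain ⟨i, hi⟩ := hcov x hx
  exact mem_iUnion.2 ⟨i, hΘ hx, hi⟩

lemma openlyIncreasing_Icc_left {Θ : Set ℝ} {c : ℝ} {S : ℕ → ℝ} (hS : StrictAnti S)
    (hsub : ∀ i, Icc (S i) c ⊆ Θ) (hΘ : Θ ⊆ Iic c) (hcov : ∀ x ∈ Θ, ∃ i, S i ≤ x) :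
    OpenlyIncreasing Θ fun i => Icc (S i) c := by
  refine ⟨fun i => isCompact_Icc, fun i j hij => Icc_subset_Icc_left (hS.antitone hij),
    (iUnion_subset hsub).antisymm fun x hx => ?_, 0, fun i => Ioi (S (i + 1)) ∩ Θ, fun i _ =>
    ⟨⟨_, isOpen_Ioi, rfl⟩, fun x hx => ⟨(hS (Nat.lt_succ_self i)).trans_le hx.1, hsub i hx⟩,
      fun x hx => ⟨le_of_lt hx.1, hΘ hx.2⟩⟩⟩
  obtain ⟨i, hi⟩ := hcov x hx
  exact mem_iUnion.2 ⟨i, hi, hΘ hx⟩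

lemma strictAnti_div_nat {r : ℝ} (hr : 0 < r) : StrictAnti fun i : ℕ => r / ((i : ℝ) + 2) := by
  intro i j hij
  have : (i : ℝ) < j := Nat.cast_lt.2 hij
  exact div_lt_div_of_pos_left hr (by positivity) (by linarith)

lemma exists_div_nat_le {r x : ℝ} (hx : 0 < x) : ∃ i : ℕ, r / ((i : ℝ) + 2) ≤ x := by
  obtain ⟨i, hi⟩ := exists_nat_gt (r / x)
  refine ⟨i, ?_⟩
  rw [div_lt_iff₀ hx] at hi
  rw [div_le_iff₀ (by positivity)]
  nlinarith

lemma div_nat_bounds {r : ℝ} (hr : 0 < r) (i : ℕ) :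
    0 < r / ((i : ℝ) + 2) ∧ r / ((i : ℝ) + 2) < r :=
  ⟨by positivity, div_lt_self hr (by linarith [Nat.cast_nonneg (α := ℝ) i])⟩

/-- A change of variable `θ = σ x + β`, `σ = ±1`, between `x ∈ X` and `θ ∈ Θ` under which the
function `g` becomes the identity. -/
structure AffineChart (Θ X : Set ℝ) (g : ℝ → ℝ) (σ β : ℝ) : Prop where
  sign : σ = 1 ∨ σ = -1
  mem_iff : ∀ x, σ * x + β ∈ Θ ↔ x ∈ X
  apply : ∀ x ∈ X, g (σ * x + β) = x

namespace AffineChart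

variable {Θ X : Set ℝ} {g w : ℝ → ℝ} {σ β s t : ℝ}

lemma sq (h : AffineChart Θ X g σ β) : σ * σ = 1 := by rcases h.sign with rfl | rfl <;> norm_num

lemma right_inv (h : AffineChart Θ X g σ β) (θ : ℝ) : σ * (σ * (θ - β)) + β = θ := by
  rw [← mul_assoc, h.sq]; ring

lemma eq_of_mem (h : AffineChart Θ X g σ β) {θ : ℝ} (hθ : θ ∈ Θ) :
    σ * (θ - β) ∈ X ∧ g θ = σ * (θ - β) := by
  have h1 : σ * (θ - β) ∈ X := (h.mem_iff _).1 (by rwa [h.right_inv])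
  refine ⟨h1, ?_⟩
  have := h.apply _ h1
  rwa [h.right_inv] at this

lemma injOn (h : AffineChart Θ X g σ β) : InjOn g Θ := fun θ hθ θ' hθ' he => by
  rw [(h.eq_of_mem hθ).2, (h.eq_of_mem hθ').2] at he
  rw [← h.right_inv θ, he, h.right_inv]

/-- Transport of an interval: the endpoints are exchanged if `σ = -1`. -/
lemma exists_Icc (h : AffineChart Θ X g σ β) (hst : s < t) : ∃ m M, m < M ∧
    (∀ x, x ∈ Icc m M ↔ σ * x + β ∈ Icc s t) ∧
    ∀ F : ℝ → ℝ, ∫ θ in Icc s t, F θ = ∫ x in Icc m M, F (σ * x + β) := by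
  rcases h.sign with rfl | rfl
  · refine ⟨s - β, t - β, by linarith, fun x => ?_, fun F => ?_⟩
    · simp only [mem_Icc, one_mul, sub_le_iff_le_add, le_sub_iff_add_le]
    · simp only [one_mul]
      rw [integral_Icc_eq_integral_Ioc, integral_Icc_eq_integral_Ioc,
        ← intervalIntegral.integral_of_le hst.le,
        ← intervalIntegral.integral_of_le (by linarith), intervalIntegral.integral_comp_add_right]
      simp
  · refine ⟨β - t, β - s, by linarith, fun x => ?_, fun F => ?_⟩
    · simp only [mem_Icc]
      constructor <;> rintro ⟨h1, h2⟩ <;> constructor <;> linarith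
    · have e : ∀ x, F (-1 * x + β) = F (β - x) := fun x => by congr 1; ring
      simp only [e]
      rw [integral_Icc_eq_integral_Ioc, integral_Icc_eq_integral_Ioc,
        ← intervalIntegral.integral_of_le hst.le,
        ← intervalIntegral.integral_of_le (by linarith), intervalIntegral.integral_comp_sub_left]
      simp

lemma priorObjective_eq (h : AffineChart Θ X g σ β) {m M : ℝ} (hsub : Icc s t ⊆ Θ)
    (hmem : ∀ x, x ∈ Icc m M ↔ σ * x + β ∈ Icc s t)
    (hint : ∀ F : ℝ → ℝ, ∫ θ in Icc s t, F θ = ∫ x in Icc m M, F (σ * x + β)) (α u : ℝ) :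
    priorObjective g w α (Icc s t) u =
      priorObjective id (fun x => w (σ * x + β)) α (Icc m M) u := by
  have e : ∀ x ∈ Icc m M, g (σ * x + β) = x := fun x hx =>
    h.apply x ((h.mem_iff x).1 (hsub ((hmem x).1 hx)))
  rw [priorObjective, priorObjective, hint, hint]
  congr 1
  · refine setIntegral_congr_fun measurableSet_Icc fun x hx => ?_
    simp only [e x hx, id]
  · congr 1
    refine setIntegral_congr_fun measurableSet_Icc fun x hx => ?_
    simp only [e x hx, id]

variable {𝓨 : Type*} [MeasurableSpace 𝓨] {μ : Measure 𝓨} {ℓ : 𝓨 → ℝ → ℝ} {α a C : ℝ}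

/-- In the coordinate `x` the priors are powers of the identity, so the analysis of weights with a
power tail applies to the Jeffreys prior. -/
theorem isTheQuasiReferencePrior (h : AffineChart Θ X g σ β) (hg : PriorBase Θ g)
    (hmodel : RegularModel μ ℓ Θ) [SigmaFinite μ] (hΘ : UniqueDiffOn ℝ Θ) (h0 : 0 < α) (h1 : α < 1)
    (htail : PowerTail X (fun x => √(fisherInfo μ ℓ Θ (σ * x + β))) a C)
    (hex : ∃ S T : ℕ → ℝ, (∀ i, S i < T i) ∧ OpenlyIncreasing Θ fun i => Icc (S i) (T i))
    {πs : Measure ℝ} (hπs : PropEquiv πs (powerPrior Θ g a)) :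
    IsTheQuasiReferencePrior μ ℓ α (fun k => (k : ℝ) ^ (α / 2)) Θ (powerClass Θ g) πs := by
  refine hg.isTheQuasiReferencePrior h.injOn hmodel hΘ h0 h1 ?_ ?_ hex hπs
  · intro s t hst hsub
    obtain ⟨m, M, hmM, hmem, hint⟩ := h.exists_Icc hst
    have hX : Icc m M ⊆ X := fun x hx => (h.mem_iff x).1 (hsub ((hmem x).1 hx))
    obtain ⟨u, hu⟩ := exists_forall_priorObjective_le
      (htail.subset m (hX (left_mem_Icc.2 hmM.le))) hmM (htail.cont.mono hX)
      (fun x hx => htail.pos x (hX hx)) h0 h1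
    refine ⟨u, fun v => ?_⟩
    rw [h.priorObjective_eq hsub hmem hint, h.priorObjective_eq hsub hmem hint]
    exact hu v
  · intro S T hST hK u hu
    choose m M hmM hmem hint using fun i => h.exists_Icc (hST i)
    refine htail.tendsto_minimiser (m := m) (M := M) ⟨hmM, fun i x hx =>
      (h.mem_iff x).1 (hK.subset i ((hmem i x).1 hx)), fun x hx => ?_⟩ h0 fun i => ?_
    · filter_upwards [hK.exists_subset isCompact_singleton
        (singleton_subset_iff.2 ((h.mem_iff x).2 hx))] with i hi
      exact (hmem i x).2 (singleton_subset_iff.1 hi)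
    · have := hu i a
      rwa [h.priorObjective_eq (hK.subset i) (hmem i) (hint i),
        h.priorObjective_eq (hK.subset i) (hmem i) (hint i)] at this

/-- The tail condition for the Jeffreys prior from its asymptotic equivalent along `F`. The constant
`C` is positive because the Jeffreys density is. -/
lemma powerTail (h : AffineChart Θ X g σ β) (hmodel : RegularModel μ ℓ Θ) {F l : Filter ℝ}
    [l.NeBot] (hX : MeasurableSet X) (hX0 : ∀ x ∈ X, 0 < x)
    (heq : Asymptotics.IsEquivalent F (jeffreys μ ℓ Θ) fun θ => C * g θ ^ a)
    (hlF : Tendsto (fun x => σ * x + β) l F) (hlX : ∀ᶠ x in l, x ∈ X)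
    (hlT : ∀ p : ℝ → Prop, (∀ᶠ x in l, p x) → ∃ T ⊆ X, IsCompact T ∧ ∀ x ∈ X \ T, p x)
    (hlower : ∃ κ > 0, ∀ x ∈ X, κ ≤ x ^ (a + 1)) (hwide : ∀ A : ℝ, ∃ x ∈ X, ∃ x' ∈ X, A * x ≤ x') :
    PowerTail X (fun x => √(fisherInfo μ ℓ Θ (σ * x + β))) a C := by
  have hI : ∀ x ∈ X, 0 < fisherInfo μ ℓ Θ (σ * x + β) := fun x hx =>
    hmodel.fisher_pos _ ((h.mem_iff x).2 hx)
  obtain ⟨r, hr, hreq⟩ := heq.exists_eq_mul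
  have hev : ∀ᶠ x in l, √(fisherInfo μ ℓ Θ (σ * x + β)) = r (σ * x + β) * (C * x ^ a) := by
    filter_upwards [hlF.eventually hreq, hlX] with x hx hxX
    simpa [jeffreys, abs_of_pos (hI x hxX), h.apply x hxX] using hx
  have hr' := hr.comp hlF
  have hC : 0 < C := by
    obtain ⟨x, hx, hxX, hrx⟩ := (hev.and (hlX.and (hr'.eventually_const_lt one_pos))).exists
    have h2 := Real.sqrt_pos.2 (hI x hxX)
    rw [hx] at h2
    exact pos_of_mul_pos_left (pos_of_mul_pos_right h2 (le_of_lt hrx))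
      (Real.rpow_nonneg (hX0 x hxX).le _)
  refine ⟨hX, hX0, ?_, fun x hx => Real.sqrt_pos.2 (hI x hx), hC, fun ε hε => ?_, hlower, hwide⟩
  · exact (hmodel.fisher_continuousOn.comp (f := fun x => σ * x + β) (by fun_prop)
      fun x hx => (h.mem_iff x).2 hx).sqrt
  · have hclose : ∀ᶠ x in l, |r (σ * x + β) - 1| ≤ ε / C := by
      filter_upwards [Metric.tendsto_nhds.1 hr' (ε / C) (by positivity)] with x hx
      exact le_of_lt hx
    obtain ⟨T, hTX, hT, hb⟩ := hlT _ (hev.and hclose)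
    refine ⟨T, hTX, hT, fun x hx => ?_⟩
    obtain ⟨b1, b2⟩ := hb x hx
    have hxa := Real.rpow_pos_of_pos (hX0 x hx.1) a
    rw [b1, show r (σ * x + β) * (C * x ^ a) - C * x ^ a =
      (r (σ * x + β) - 1) * (C * x ^ a) by ring, abs_mul, abs_of_pos (mul_pos hC hxa)]
    refine (mul_le_mul_of_nonneg_right b2 (mul_pos hC hxa).le).trans (le_of_eq ?_)
    field_simp

/-- The Jeffreys prior near a finite endpoint. -/
lemma powerTail_Ioc {R : ℝ} (hR : 0 < R) (h : AffineChart Θ (Ioc 0 R) g σ β)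
    (hmodel : RegularModel μ ℓ Θ) (ha : a ≤ -1)
    (heq : Asymptotics.IsEquivalent (𝓝[Θ] β) (jeffreys μ ℓ Θ) fun θ => C * g θ ^ a) :
    PowerTail (Ioc 0 R) (fun x => √(fisherInfo μ ℓ Θ (σ * x + β))) a C := by
  have hl : (𝓝[Ioc 0 R] (0 : ℝ)) = 𝓝[>] 0 := nhdsWithin_Ioc_eq_nhdsGT hR
  have : (𝓝[Ioc 0 R] (0 : ℝ)).NeBot := by rw [hl]; infer_instance
  refine h.powerTail hmodel (l := 𝓝[Ioc 0 R] 0) measurableSet_Ioc (fun x hx => hx.1) heq ?_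
    self_mem_nhdsWithin (fun p hp => ?_) ⟨R ^ (a + 1), by positivity, fun x hx =>
      Real.rpow_le_rpow_of_nonpos hx.1 hx.2 (by linarith)⟩ fun A => ?_
  · refine tendsto_nhdsWithin_iff.2 ⟨?_, eventually_nhdsWithin_of_forall fun x hx =>
      (h.mem_iff x).2 hx⟩
    have : Continuous fun x : ℝ => σ * x + β := by fun_prop
    simpa using (this.tendsto 0).mono_left nhdsWithin_le_nhds
  · rw [hl] at hp
    obtain ⟨δ, hδ, hpδ⟩ := mem_nhdsGT_iff_exists_Ioo_subset.1 hp
    refine ⟨Icc δ R, fun x hx => ⟨lt_of_lt_of_le hδ hx.1, hx.2⟩, isCompact_Icc, fun x hx =>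
      hpδ ⟨hx.1.1, ?_⟩⟩
    by_contra! hc
    exact hx.2 ⟨hc, hx.1.2⟩
  · refine ⟨R / (|A| + 1), ⟨by positivity, div_le_self hR.le (by linarith [abs_nonneg A])⟩, R,
      ⟨hR, le_rfl⟩, ?_⟩
    rw [mul_div_assoc', div_le_iff₀ (by positivity)]
    nlinarith [le_abs_self A]

/-- The Jeffreys prior near an infinite endpoint. -/
lemma powerTail_Ici {R : ℝ} (hR : 0 < R) (h : AffineChart Θ (Ici R) g σ β)
    (hmodel : RegularModel μ ℓ Θ) (ha : -1 ≤ a) {F : Filter ℝ}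
    (hF : Tendsto (fun x => σ * x + β) atTop F)
    (heq : Asymptotics.IsEquivalent F (jeffreys μ ℓ Θ) fun θ => C * g θ ^ a) :
    PowerTail (Ici R) (fun x => √(fisherInfo μ ℓ Θ (σ * x + β))) a C := by
  refine h.powerTail hmodel (l := atTop) measurableSet_Ici (fun x hx => hR.trans_le hx) heq hF
    (eventually_ge_atTop R) (fun p hp => ?_) ⟨R ^ (a + 1), by positivity, fun x hx =>
      Real.rpow_le_rpow hR.le hx (by linarith)⟩ fun A => ?_
  · obtain ⟨B, hB⟩ := eventually_atTop.1 hp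
    refine ⟨Icc R B, fun x hx => hx.1, isCompact_Icc, fun x hx => hB x ?_⟩
    by_contra! hc
    exact hx.2 ⟨hx.1, hc.le⟩
  · refine ⟨R, self_mem_Ici, (|A| + 1) * R, ?_, ?_⟩
    · rw [mem_Ici]; nlinarith [abs_nonneg A]
    · nlinarith [le_abs_self A]

end AffineChart

end QuasiRef

theorem mainTheorem1 {𝓨 : Type*} [MeasurableSpace 𝓨] [StandardBorelSpace 𝓨]
    (μ : Measure 𝓨) [SigmaFinite μ] (ℓ : 𝓨 → ℝ → ℝ) (α : ℝ) (hα₀ : 0 < α) (hα₁ : α < 1)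
    (Θ : Set ℝ) (hmodel : QuasiRef.RegularModel μ ℓ Θ) :
    (∀ b c : ℝ, (c < b ∧ Θ = Ico c b) ∨ (b < c ∧ Θ = Ioc b c) →
      ∀ C a : ℝ, a ≤ -1 →
        Asymptotics.IsEquivalent (𝓝[Θ] b) (QuasiRef.jeffreys μ ℓ Θ)
          (fun θ => C * |θ - b| ^ a) →
        ∀ πs : Measure ℝ,
          QuasiRef.PropEquiv πs (QuasiRef.powerPrior Θ (fun θ => |θ - b|) a) →
          QuasiRef.IsTheQuasiReferencePrior μ ℓ α (fun k => (k : ℝ) ^ (α / 2)) Θ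
            (QuasiRef.powerClass Θ (fun θ => |θ - b|)) πs) ∧
    (∀ (c : ℝ) (F : Filter ℝ),
      (0 < c ∧ Θ = Ici c ∧ F = atTop) ∨ (c < 0 ∧ Θ = Iic c ∧ F = atBot) →
      ∀ C a : ℝ, -1 ≤ a →
        Asymptotics.IsEquivalent F (QuasiRef.jeffreys μ ℓ Θ) (fun θ => C * |θ| ^ a) →
        ∀ πs : Measure ℝ,
          QuasiRef.PropEquiv πs (QuasiRef.powerPrior Θ (fun θ => |θ|) a) →
          QuasiRef.IsTheQuasiReferencePrior μ ℓ α (fun k => (k : ℝ) ^ (α / 2)) Θ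
            (QuasiRef.powerClass Θ (fun θ => |θ|)) πs) := by
  constructor
  · rintro b c hcase C a ha heq πs hπs
    rcases hcase with ⟨hcb, rfl⟩ | ⟨hbc, rfl⟩
    · have hg : QuasiRef.PriorBase (Ico c b) fun θ => |θ - b| :=
        ⟨measurableSet_Ico, by fun_prop, fun θ => abs_nonneg _,
          fun θ hθ => abs_pos.2 (by linarith [hθ.2])⟩
      have hch : QuasiRef.AffineChart (Ico c b) (Ioc 0 (b - c)) (fun θ => |θ - b|) (-1) b := by
        refine ⟨Or.inr rfl, fun x => ?_, fun x hx => ?_⟩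
        · simp only [mem_Ico, mem_Ioc]
          constructor <;> rintro ⟨h1, h2⟩ <;> constructor <;> linarith
        · simp [abs_of_pos hx.1]
      have hr : 0 < b - c := by linarith
      refine hch.isTheQuasiReferencePrior hg hmodel (uniqueDiffOn_Ico c b) hα₀ hα₁
        (hch.powerTail_Ioc hr hmodel ha heq) ⟨fun _ => c,
        fun i => b - (b - c) / ((i : ℝ) + 2), fun i => ?_, ?_⟩ hπs
      · linarith [(QuasiRef.div_nat_bounds hr i).2]
      · refine QuasiRef.openlyIncreasing_Icc_right (fun i j hij => ?_) (fun i x hx => ⟨hx.1, ?_⟩)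
          (fun x hx => hx.1) fun x hx => ?_
        · exact sub_lt_sub_left (QuasiRef.strictAnti_div_nat hr hij) b
        · linarith [(QuasiRef.div_nat_bounds hr i).1, hx.2]
        · obtain ⟨i, hi⟩ := QuasiRef.exists_div_nat_le (r := b - c) (sub_pos.2 hx.2)
          exact ⟨i, by linarith⟩
    · have hg : QuasiRef.PriorBase (Ioc b c) fun θ => |θ - b| :=
        ⟨measurableSet_Ioc, by fun_prop, fun θ => abs_nonneg _,
          fun θ hθ => abs_pos.2 (by linarith [hθ.1])⟩
      have hch : QuasiRef.AffineChart (Ioc b c) (Ioc 0 (c - b)) (fun θ => |θ - b|) 1 b := by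
        refine ⟨Or.inl rfl, fun x => ?_, fun x hx => ?_⟩
        · simp only [mem_Ioc]
          constructor <;> rintro ⟨h1, h2⟩ <;> constructor <;> linarith
        · simp [abs_of_pos hx.1]
      have hr : 0 < c - b := by linarith
      refine hch.isTheQuasiReferencePrior hg hmodel (uniqueDiffOn_Ioc b c) hα₀ hα₁
        (hch.powerTail_Ioc hr hmodel ha heq) ⟨fun i => b + (c - b) / ((i : ℝ) + 2),
        fun _ => c, fun i => ?_, ?_⟩ hπs
      · linarith [(QuasiRef.div_nat_bounds hr i).2]
      · refine QuasiRef.openlyIncreasing_Icc_left (fun i j hij => ?_) (fun i x hx => ⟨?_, hx.2⟩)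
          (fun x hx => hx.2) fun x hx => ?_
        · have := QuasiRef.strictAnti_div_nat hr hij
          simp only at this ⊢
          linarith
        · linarith [(QuasiRef.div_nat_bounds hr i).1, hx.1]
        · obtain ⟨i, hi⟩ := QuasiRef.exists_div_nat_le (r := c - b) (sub_pos.2 hx.1)
          exact ⟨i, by linarith⟩
  · rintro c F hcase C a ha heq πs hπs
    rcases hcase with ⟨hc, rfl, rfl⟩ | ⟨hc, rfl, rfl⟩
    · have hg : QuasiRef.PriorBase (Ici c) fun θ => |θ| :=
        ⟨measurableSet_Ici, by fun_prop, fun θ => abs_nonneg _,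
          fun θ hθ => abs_pos.2 (hc.trans_le hθ).ne'⟩
      have hch : QuasiRef.AffineChart (Ici c) (Ici c) (fun θ => |θ|) 1 0 :=
        ⟨Or.inl rfl, fun x => by simp, fun x hx => by simp [abs_of_pos (hc.trans_le hx)]⟩
      refine hch.isTheQuasiReferencePrior hg hmodel (uniqueDiffOn_Ici c) hα₀ hα₁
        (hch.powerTail_Ici hc hmodel ha (by simp only [one_mul, add_zero]; exact tendsto_id) heq)
        ⟨fun _ => c, fun i => c + ((i : ℝ) + 1), fun i => ?_, ?_⟩ hπs
      · linarith [Nat.cast_nonneg (α := ℝ) i]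
      · refine QuasiRef.openlyIncreasing_Icc_right (fun i j hij => ?_) (fun i x hx => hx.1)
          Subset.rfl fun x _ => ?_
        · simpa using hij
        · obtain ⟨i, hi⟩ := exists_nat_gt (x - c)
          exact ⟨i, by linarith⟩
    · have hg : QuasiRef.PriorBase (Iic c) fun θ => |θ| :=
        ⟨measurableSet_Iic, by fun_prop, fun θ => abs_nonneg _,
          fun θ hθ => abs_pos.2 (lt_of_le_of_lt hθ hc).ne⟩
      have hch : QuasiRef.AffineChart (Iic c) (Ici (-c)) (fun θ => |θ|) (-1) 0 := by
        refine ⟨Or.inr rfl, fun x => ?_, fun x hx => ?_⟩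
        · simp only [mem_Iic, mem_Ici]
          constructor <;> intro h <;> linarith
        · rw [mem_Ici] at hx
          simp [abs_of_pos (show 0 < x by linarith)]
      refine hch.isTheQuasiReferencePrior hg hmodel (uniqueDiffOn_Iic c) hα₀ hα₁
        (hch.powerTail_Ici (by linarith) hmodel ha (by simpa using tendsto_neg_atTop_atBot) heq)
        ⟨fun i => c - ((i : ℝ) + 1), fun _ => c, fun i => ?_, ?_⟩ hπs
      · linarith [Nat.cast_nonneg (α := ℝ) i]
      · refine QuasiRef.openlyIncreasing_Icc_left (fun i j hij => ?_) (fun i x hx => hx.2)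
          Subset.rfl fun x _ => ?_
        · simpa using hij
        · obtain ⟨i, hi⟩ := exists_nat_gt (c - x)
          exact ⟨i, by linarith⟩
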